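/- **Theorem (Herbrand's Fundamental Theorem à la Heijenoort).** Formulas are first-order formulas without equality, built from atomic formulas with $\neg,\vee,\wedge,\exists,\forall$ over an arbitrary first-order language and named variables. Let $A$ be a *rectified* formula: it contains no vacuous quantifier, no variable has both free and bound occurrences in $A$, and no two quantifiers of $A$ bind occurrences of the same variable. Then the following two statements are equivalent. 1. There is a positive natural number $n$ such that $A$ has Property C of order $n$. 2. There are a sentential tautology $B$ and a derivation of $A$ from $B$ consisting of applications of the generalized rules of simplification, of $\gamma$-quantification and of $\delta^-$-quantification, and of renamings of bound variables (a finite sequence of formulas over the given language that starts with $B$, ends with $A$, and in which each formula but the first follows from its predecessor). Moreover, a witness for each statement can be constructed from a witness for the other one, in the following sense. If the language is effectively given (its function and predicate symbols are effectively coded and their arities are computable), then there is an algorithm that, given a rectified formula $A$ and a positive $n$ such that $A$ has Property C of order $n$, outputs a derivation as in (2), and there is an algorithm that, given a derivation as in (2) of a rectified formula $A$, outputs a positive $n$ such that $A$ has Property C of order $n$. *Definitions.* - A position in a formula is *positive* if it is in the scope of an even number of negation symbols, and *negative* otherwise. A quantifier is a *$\gamma$-quantifier* if it is existential at a positive position or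 universal at a negative position; otherwise it is a *$\delta$-quantifier*. A quantifier is *accessible* if it is in the scope of no quantifier. - A *sentential tautology* is a quantifier-free formula that is truth-functionally valid when its atomic subformulas are read as sentential variables. - The *outer Skolemized form* $F$ of $A$ results from $A$ by removing every $\delta$-quantifier and replacing its bound variable $y$ with the term $y^\delta(x_1,\dots,x_m)$, where $y^\delta$ is a fresh function symbol and $x_1,\dots,x_m$, in this order, are the variables of the $\gamma$-quantifiers in whose scope the $\delta$-quantifier occurs. - The *height* of a variable is $1$, and $|f(t_1,\dots,t_m)|=1+\max\{0,|t_1|,\dots,|t_m|\}$. The *champ fini* $T_n(F)$ *of order $n$* is the set of all terms $t$ with $|t|<n$ built from the function symbols, constant symbols and free variables of $F$; if $F$ has neither constant symbols nor free variables, a fresh constant symbol $\bullet$ is admitted in addition. - The *expansion* of $F$ with respect to a finite set $T$ of terms is $F$ itself if $F$ is quantifier-free, is formed componentwise for $\neg,\vee,\wedge$, and for $\exists x.F'$ (respectively $\forall x.F'$) is $\bigvee_{t\in T}F''\{x\mapsto t\}$ (respectively $\bigwedge_{t\in T}F''\{x\mapsto t\}$), where $F''$ is the expansion of $F'$; it is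 undefined if $F$ contains a quantifier and $T=\emptyset$. - $A$ has *Property C of order $n$* if the expansion of $F$ with respect to $T_n(F)$ is defined and is a sentential tautology, where $F$ is the outer Skolemized form of $A$. - Rules, where $A[\ldots]$ is a formula context with one hole. *Simplification:* from $A[H\circ H']$ infer $A[H]$, where $H'$ is $H$ or results from $H$ by renaming bound variables, and $\circ$ is $\vee$ if the hole is positive and $\wedge$ if it is negative. *$\gamma$-quantification:* from $A[H\{x\mapsto t\}]$ infer $A[Qx.H]$, where $Qx.$ is an accessible $\gamma$-quantifier of $A[Qx.H]$ and the variables of the term $t$ are not bound by quantifiers in $H$. *$\delta^-$-quantification:* from $A[H]$ infer $A[Qy.H]$, where $Qy.$ is an accessible $\delta$-quantifier of $A[Qy.H]$ and $y$ does not occur free in the context $A[\ldots]$. -/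

import Mathlib

universe u v

namespace Herbrand

/-! ### Terms

Terms are Mathlib's terms over a first-order language, with natural numbers as names of variables.
-/

section Terms

variable {L : FirstOrder.Language.{u, v}}

/-- The height of a term. A variable counts as a constant symbol: it has height one. -/
def termHeight : L.Term ℕ → ℕ
  | .var _ => 1
  | .func _ ts => 1 + Finset.univ.sup fun i => termHeight (ts i)

/-- The function symbols (including constant symbols) that occur in a term. -/
def termFuncs : L.Term ℕ → Set (Σ n, L.Functions n)
  | .var _ => ∅
  | .func f ts => {⟨_, f⟩} ∪ ⋃ i, termFuncs (ts i)

/-- The replacement `s{x ↦ t}` in a term `s`. -/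
def termSubst (x : ℕ) (t : L.Term ℕ) (s : L.Term ℕ) : L.Term ℕ :=
  s.subst (Function.update FirstOrder.Language.Term.var x t)

end Terms

/-! ### Formulas -/

/-- First-order formulas without equality, with named variables and the connectives
negation, disjunction, conjunction. -/
inductive Formula (L : FirstOrder.Language.{u, v}) : Type (max u v)
  | atom {k : ℕ} (R : L.Relations k) (ts : Fin k → L.Term ℕ) : Formula L
  | neg (A : Formula L) : Formula L
  | or (A B : Formula L) : Formula L
  | and (A B : Formula L) : Formula L
  | ex (x : ℕ) (A : Formula L) : Formula L
  | all (x : ℕ) (A : Formula L) : Formula L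

namespace Formula

variable {L : FirstOrder.Language.{u, v}}

/-- The variables with a free occurrence. -/
def freeVars : Formula L → Finset ℕ
  | atom _ ts => Finset.univ.biUnion fun i => (ts i).varFinset
  | neg A => A.freeVars
  | or A B => A.freeVars ∪ B.freeVars
  | and A B => A.freeVars ∪ B.freeVars
  | ex x A => A.freeVars.erase x
  | all x A => A.freeVars.erase x

/-- The variables of the quantifiers of a formula, one entry for each quantifier. -/
def boundVars : Formula L → List ℕ
  | atom _ _ => []
  | neg A => A.boundVars
  | or A B => A.boundVars ++ B.boundVars
  | and A B => A.boundVars ++ B.boundVars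
  | ex x A => x :: A.boundVars
  | all x A => x :: A.boundVars

/-- The function symbols (including constant symbols) that occur in a formula. -/
def funcs : Formula L → Set (Σ n, L.Functions n)
  | atom _ ts => ⋃ i, termFuncs (ts i)
  | neg A => A.funcs
  | or A B => A.funcs ∪ B.funcs
  | and A B => A.funcs ∪ B.funcs
  | ex _ A => A.funcs
  | all _ A => A.funcs

/-- The formula contains no quantifier. -/
def QuantifierFree : Formula L → Prop
  | atom _ _ => True
  | neg A => A.QuantifierFree
  | or A B => A.QuantifierFree ∧ B.QuantifierFree
  | and A B => A.QuantifierFree ∧ B.QuantifierFree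
  | ex _ _ => False
  | all _ _ => False

/-- The formula contains no vacuous quantifier. -/
def NoVacuous : Formula L → Prop
  | atom _ _ => True
  | neg A => A.NoVacuous
  | or A B => A.NoVacuous ∧ B.NoVacuous
  | and A B => A.NoVacuous ∧ B.NoVacuous
  | ex x A => x ∈ A.freeVars ∧ A.NoVacuous
  | all x A => x ∈ A.freeVars ∧ A.NoVacuous

/-- A formula is rectified if it contains no vacuous quantifier, no variable has free and bound
occurrences in it, and no two quantifiers bind occurrences of the same variable. -/
def Rectified (A : Formula L) : Prop :=
  A.NoVacuous ∧ (∀ x ∈ A.boundVars, x ∉ A.freeVars) ∧ A.boundVars.Nodup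

/-- The replacement `A{x ↦ t}` of all free occurrences of `x` with `t`, without renaming of bound
variables. -/
def subst (x : ℕ) (t : L.Term ℕ) : Formula L → Formula L
  | atom R ts => atom R fun i => termSubst x t (ts i)
  | neg A => neg (A.subst x t)
  | or A B => or (A.subst x t) (B.subst x t)
  | and A B => and (A.subst x t) (B.subst x t)
  | ex y A => if y = x then ex y A else ex y (A.subst x t)
  | all y A => if y = x then all y A else all y (A.subst x t)

/-- `Variant A B` means that `B` is `A` or results from `A` by renaming bound variables. -/
inductive Variant : Formula L → Formula L → Prop
  | refl (A : Formula L) : Variant A A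
  | symm {A B : Formula L} : Variant A B → Variant B A
  | trans {A B C : Formula L} : Variant A B → Variant B C → Variant A C
  | neg {A B : Formula L} : Variant A B → Variant (neg A) (neg B)
  | or {A B A' B' : Formula L} : Variant A A' → Variant B B' → Variant (or A B) (or A' B')
  | and {A B A' B' : Formula L} : Variant A A' → Variant B B' → Variant (and A B) (and A' B')
  | ex {A B : Formula L} (x : ℕ) : Variant A B → Variant (ex x A) (ex x B)
  | all {A B : Formula L} (x : ℕ) : Variant A B → Variant (all x A) (all x B)
  | renameEx {A : Formula L} {x y : ℕ} : y ∉ A.freeVars → y ∉ A.boundVars →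
      Variant (ex x A) (ex y (A.subst x (FirstOrder.Language.Term.var y)))
  | renameAll {A : Formula L} {x y : ℕ} : y ∉ A.freeVars → y ∉ A.boundVars →
      Variant (all x A) (all y (A.subst x (FirstOrder.Language.Term.var y)))

/-! ### Sentential tautologies -/

/-- The truth value of a quantifier-free formula, with its atomic subformulas read as sentential
variables that are valuated by `w`. (The value at a quantified formula is irrelevant.) -/
def Truth (w : ∀ k, L.Relations k → (Fin k → L.Term ℕ) → Prop) : Formula L → Prop
  | atom R ts => w _ R ts
  | neg A => ¬ A.Truth w
  | or A B => A.Truth w ∨ B.Truth w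
  | and A B => A.Truth w ∧ B.Truth w
  | ex _ _ => False
  | all _ _ => False

/-- A sentential tautology: quantifier-free and truth-functionally valid. -/
def IsSententialTautology (A : Formula L) : Prop :=
  A.QuantifierFree ∧ ∀ w, A.Truth w

/-! ### Expansions -/

/-- The disjunction of the formulas `A :: l`. -/
def bigOr : Formula L → List (Formula L) → Formula L
  | A, [] => A
  | A, B :: l => or A (bigOr B l)

/-- The conjunction of the formulas `A :: l`. -/
def bigAnd : Formula L → List (Formula L) → Formula L
  | A, [] => A
  | A, B :: l => and A (bigAnd B l)

/-- `IsExpansion T A B` means that `B` is an expansion of `A` with respect to the (finite) set `T`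
of terms. In the quantifier cases `t₀ :: l` is a list of the elements of `T`; so there is no
expansion of a quantifier if `T` is empty. -/
inductive IsExpansion (T : Set (L.Term ℕ)) : Formula L → Formula L → Prop
  | atom {k : ℕ} (R : L.Relations k) (ts : Fin k → L.Term ℕ) :
      IsExpansion T (atom R ts) (atom R ts)
  | neg {A B : Formula L} : IsExpansion T A B → IsExpansion T (neg A) (neg B)
  | or {A₁ A₂ B₁ B₂ : Formula L} : IsExpansion T A₁ B₁ → IsExpansion T A₂ B₂ →
      IsExpansion T (or A₁ A₂) (or B₁ B₂)
  | and {A₁ A₂ B₁ B₂ : Formula L} : IsExpansion T A₁ B₁ → IsExpansion T A₂ B₂ →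
      IsExpansion T (and A₁ A₂) (and B₁ B₂)
  | ex {A B : Formula L} (x : ℕ) (t₀ : L.Term ℕ) (l : List (L.Term ℕ)) :
      (t₀ :: l).Nodup → (∀ t, t ∈ t₀ :: l ↔ t ∈ T) → IsExpansion T A B →
      IsExpansion T (ex x A) (bigOr (B.subst x t₀) (l.map fun t => B.subst x t))
  | all {A B : Formula L} (x : ℕ) (t₀ : L.Term ℕ) (l : List (L.Term ℕ)) :
      (t₀ :: l).Nodup → (∀ t, t ∈ t₀ :: l ↔ t ∈ T) → IsExpansion T A B →
      IsExpansion T (all x A) (bigAnd (B.subst x t₀) (l.map fun t => B.subst x t))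

end Formula

/-! ### Outer Skolemized form, champ fini, Property C -/

/-- The new function symbols: a Skolem function symbol for each variable and arity, and one
additional constant symbol. -/
inductive NewSymbol : ℕ → Type
  | skolem (y m : ℕ) : NewSymbol m
  | bullet : NewSymbol 0

/-- The language that consists of the new function symbols. -/
def newLanguage : FirstOrder.Language.{0, 0} := ⟨NewSymbol, fun _ => Empty⟩

/-- The extension of a language by the new function symbols. -/
abbrev Ext (L : FirstOrder.Language.{u, v}) : FirstOrder.Language.{u, v} := L.sum newLanguage

section Skolem

variable {L : FirstOrder.Language.{u, v}}

/-- The fresh constant symbol of the extended language. -/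
def bulletSymbol : Σ n, (Ext L).Functions n := ⟨0, Sum.inr NewSymbol.bullet⟩

/-- The Skolem term for the variable `y` with the list `xs` of variables as its arguments. -/
def skolemTerm (y : ℕ) (xs : List ℕ) : (Ext L).Term ℕ :=
  FirstOrder.Language.Term.func (Sum.inr (NewSymbol.skolem y xs.length) : (Ext L).Functions xs.length)
    fun i => FirstOrder.Language.Term.var (xs.get i)

/-- The outer Skolemized form of an occurrence of a subformula, which is positive iff `pos = true`
and in the scope of γ-quantifiers for the variables `xs` (from the outermost to the innermost).
A quantifier is a γ-quantifier if it is existential and positive, or universal and negative. The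
other quantifiers (δ-quantifiers) are removed and their variables replaced by Skolem terms. -/
def Formula.skolemizeAux : Bool → List ℕ → Formula L → Formula (Ext L)
  | _, _, .atom R ts =>
      .atom (Sum.inl R : (Ext L).Relations _) fun i => FirstOrder.Language.LHom.sumInl.onTerm (ts i)
  | pos, xs, .neg A => .neg (A.skolemizeAux (!pos) xs)
  | pos, xs, .or A B => .or (A.skolemizeAux pos xs) (B.skolemizeAux pos xs)
  | pos, xs, .and A B => .and (A.skolemizeAux pos xs) (B.skolemizeAux pos xs)
  | true, xs, .ex x A => .ex x (A.skolemizeAux true (xs ++ [x]))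
  | false, xs, .ex y A => (A.skolemizeAux false xs).subst y (skolemTerm y xs)
  | false, xs, .all x A => .all x (A.skolemizeAux false (xs ++ [x]))
  | true, xs, .all y A => (A.skolemizeAux true xs).subst y (skolemTerm y xs)

/-- The outer Skolemized form of a (rectified) formula. -/
def Formula.outerSkolemizedForm (A : Formula L) : Formula (Ext L) :=
  A.skolemizeAux true []

/-- The champ fini of order `n` for `F`: the terms of height less than `n` over the function
symbols and the free variables of `F`; if `F` has neither constant symbols nor free variables, then
the fresh constant symbol is admitted in addition. -/
def champFini (n : ℕ) (F : Formula (Ext L)) : Set ((Ext L).Term ℕ) :=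
  {t | termHeight t < n ∧ t.varFinset ⊆ F.freeVars ∧
    ∀ f ∈ termFuncs t, f ∈ F.funcs ∨
      (f = bulletSymbol ∧ F.freeVars = ∅ ∧ ∀ c : (Ext L).Functions 0, ⟨0, c⟩ ∉ F.funcs)}

/-- Property C of order `n`: the expansion of the outer Skolemized form `F` over the champ fini of
order `n` for `F` is a sentential tautology. (The expansion is unique up to the order in which the
elements of the champ fini are listed.) -/
def Formula.HasPropertyC (n : ℕ) (A : Formula L) : Prop :=
  ∃ B, Formula.IsExpansion (champFini n A.outerSkolemizedForm) A.outerSkolemizedForm B ∧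
    B.IsSententialTautology

end Skolem

/-! ### The calculus -/

/-- Formula contexts `A[…]`: formulas with one hole. -/
inductive Context (L : FirstOrder.Language.{u, v}) : Type (max u v)
  | hole : Context L
  | neg (C : Context L) : Context L
  | orLeft (C : Context L) (B : Formula L) : Context L
  | orRight (B : Formula L) (C : Context L) : Context L
  | andLeft (C : Context L) (B : Formula L) : Context L
  | andRight (B : Formula L) (C : Context L) : Context L
  | ex (x : ℕ) (C : Context L) : Context L
  | all (x : ℕ) (C : Context L) : Context L

namespace Context

variable {L : FirstOrder.Language.{u, v}}

/-- The formula `A[H]`; variables of `H` may be captured. -/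
def fill : Context L → Formula L → Formula L
  | hole, H => H
  | neg C, H => .neg (C.fill H)
  | orLeft C B, H => .or (C.fill H) B
  | orRight B C, H => .or B (C.fill H)
  | andLeft C B, H => .and (C.fill H) B
  | andRight B C, H => .and B (C.fill H)
  | ex x C, H => .ex x (C.fill H)
  | all x C, H => .all x (C.fill H)

/-- `true` if the hole is in the scope of an even number of negation symbols, else `false`. -/
def positive : Context L → Bool
  | hole => true
  | neg C => !C.positive
  | orLeft C _ => C.positive
  | orRight _ C => C.positive
  | andLeft C _ => C.positive
  | andRight _ C => C.positive
  | ex _ C => C.positive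
  | all _ C => C.positive

/-- The hole is in the scope of no quantifier; so a quantifier at the top of a formula that is
filled into the hole is accessible. -/
def Accessible : Context L → Prop
  | hole => True
  | neg C => C.Accessible
  | orLeft C _ => C.Accessible
  | orRight _ C => C.Accessible
  | andLeft C _ => C.Accessible
  | andRight _ C => C.Accessible
  | ex _ _ => False
  | all _ _ => False

/-- The variables that occur free in the context. -/
def freeVars : Context L → Finset ℕ
  | hole => ∅
  | neg C => C.freeVars
  | orLeft C B => C.freeVars ∪ B.freeVars
  | orRight B C => B.freeVars ∪ C.freeVars
  | andLeft C B => C.freeVars ∪ B.freeVars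
  | andRight B C => B.freeVars ∪ C.freeVars
  | ex x C => C.freeVars.erase x
  | all x C => C.freeVars.erase x

end Context

/-- `Step P Q` means that the conclusion `Q` follows from the single premise `P` by an application
of the generalized rule of simplification, of γ-quantification or of δ⁻-quantification, or by
renaming of bound variables. -/
inductive Step {L : FirstOrder.Language.{u, v}} : Formula L → Formula L → Prop
  | simplificationOr (C : Context L) (H H' : Formula L) :
      C.positive = true → H.Variant H' → Step (C.fill (.or H H')) (C.fill H)
  | simplificationAnd (C : Context L) (H H' : Formula L) :
      C.positive = false → H.Variant H' → Step (C.fill (.and H H')) (C.fill H)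
  | gammaEx (C : Context L) (x : ℕ) (H : Formula L) (t : L.Term ℕ) :
      C.Accessible → C.positive = true → (∀ z ∈ t.varFinset, z ∉ H.boundVars) →
      Step (C.fill (H.subst x t)) (C.fill (.ex x H))
  | gammaAll (C : Context L) (x : ℕ) (H : Formula L) (t : L.Term ℕ) :
      C.Accessible → C.positive = false → (∀ z ∈ t.varFinset, z ∉ H.boundVars) →
      Step (C.fill (H.subst x t)) (C.fill (.all x H))
  | deltaAll (C : Context L) (y : ℕ) (H : Formula L) :
      C.Accessible → C.positive = true → y ∉ C.freeVars →
      Step (C.fill H) (C.fill (.all y H))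
  | deltaEx (C : Context L) (y : ℕ) (H : Formula L) :
      C.Accessible → C.positive = false → y ∉ C.freeVars →
      Step (C.fill H) (C.fill (.ex y H))
  | rename {A B : Formula L} : A.Variant B → Step A B

/-- The list `D` of formulas is a (linear) derivation of `A` from `B`. -/
def IsDerivation {L : FirstOrder.Language.{u, v}} (D : List (Formula L)) (B A : Formula L) : Prop :=
  D.head? = some B ∧ D.getLast? = some A ∧ D.IsChain Step

/-- The list `D` of formulas is a derivation of `A` from some sentential tautology. -/
def IsProof {L : FirstOrder.Language.{u, v}} (D : List (Formula L)) (A : Formula L) : Prop :=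
  ∃ B : Formula L, B.IsSententialTautology ∧ IsDerivation D B A

/-! ### Formulas as strings of symbols -/

/-- The symbols from which formulas are written: variables, function symbols, predicate symbols,
and the five logical symbols. -/
abbrev Token (L : FirstOrder.Language.{u, v}) : Type (max u v) :=
  (ℕ ⊕ (Σ n, L.Functions n)) ⊕ ((Σ n, L.Relations n) ⊕ Fin 5)

/-- A formula in prefix (Polish) notation. -/
def Formula.code {L : FirstOrder.Language.{u, v}} : Formula L → List (Token L)
  | .atom R ts => Sum.inr (Sum.inl ⟨_, R⟩) ::
      (List.finRange _).flatMap fun i => (ts i).listEncode.map Sum.inl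
  | .neg A => Sum.inr (Sum.inr 0) :: A.code
  | .or A B => Sum.inr (Sum.inr 1) :: (A.code ++ B.code)
  | .and A B => Sum.inr (Sum.inr 2) :: (A.code ++ B.code)
  | .ex x A => Sum.inr (Sum.inr 3) :: Sum.inl (Sum.inl x) :: A.code
  | .all x A => Sum.inr (Sum.inr 4) :: Sum.inl (Sum.inl x) :: A.code

end Herbrand

/-! From (2) to (1) the argument is semantic. A strategy chooses the values of the δ-quantifiers,
depending on the previous choices, while the γ-quantifiers range over a set. Structures are graded
by a filtration in which a function symbol raises the level by one, and a strategy respects the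
filtration if its values lie at most one level above what has been reached. `ValidUpTo N P` says
that `P` holds whenever the γ-quantifiers range over level `N` and the strategy respects the
filtration. A sentential tautology is valid up to every `N`; simplification, renaming and
δ⁻-quantification preserve `N`; γ-quantification with the term `t` costs at most `|t|` levels
(`ValidUpTo.gamma`). As `t` occurs in the premise or can be replaced by a variable, the cost is at
most the length of the premise, so that the final order is computed from the lengths of the formulas
alone. In the term model graded by the champs finis, the strategy that answers with Skolem terms
respects the filtration, and validity becomes Property C (`ValidUpTo.hasPropertyC`).

From (1) to (2), the Skolem terms and `•` are replaced by fresh variables, their names. The terms of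
the champ fini are listed by nondecreasing height. A state (`Naming.state`) carries, for each
γ-quantifier, the instances for the listed terms together with the quantified formula itself. The
last listed term `t` can be dropped from the state by a derivation (`derives_advance`): every Skolem
term with `t` among its arguments is higher than all listed terms, so its name is confined to one
instance and meets the eigenvariable condition. Thus the instance for `t` collapses to the matrix
(`derives_collapse`), is generalized to a copy of the kept quantified formula, and is merged with it
by contraction. When no term is left, the state collapses to `A`. At the other end, the quantified
formulas that the full state still contains are derived from quantifier-free instances with fresh
variables (`exists_quantifierFree_derives`). The full state is true already when these quantified
formulas are counted as false at positive and as true at negative positions, because then it says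
what the expansion says (`lowerTruth_state`). Hence the quantifier-free formula obtained is a
tautology.

The algorithm for this direction is an unbounded search. Formulas are strings in Polish notation,
and the correctness of a derivation is certified by a finite list of rules on strings, with
decidable side conditions. These rules are sound (`Derivable.holds`) and complete for the
derivations just described (`provable_derivation`), and a certificate is a list of rule instances,
hence coded by a number. So the search halts, and whatever it finds is a derivation. -/

namespace Herbrand

open FirstOrder Language Function

variable {L : FirstOrder.Language.{u, v}}

/-! ### Terms -/

section Terms

/-- The value of a term under an interpretation of the function symbols and an environment. -/
def ev {M : Type*} (fn : ∀ k, L.Functions k → (Fin k → M) → M) (e : ℕ → M) : L.Term ℕ → M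
  | .var z => e z
  | .func f ts => fn _ f fun i => ev fn e (ts i)

theorem mem_varFinset_func {k : ℕ} (f : L.Functions k) (ts : Fin k → L.Term ℕ) (z : ℕ) :
    z ∈ (Term.func f ts).varFinset ↔ ∃ i, z ∈ (ts i).varFinset := by
  simp [Term.varFinset]

theorem ev_congr {M : Type*} {fn : ∀ k, L.Functions k → (Fin k → M) → M} {e e' : ℕ → M}
    {t : L.Term ℕ} (h : ∀ z ∈ t.varFinset, e z = e' z) : ev fn e t = ev fn e' t := by
  induction t with
  | var z => exact h z (by simp [Term.varFinset])
  | func f ts ih =>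
    simp only [ev]
    congr 1
    funext i
    exact ih i fun z hz => h z ((mem_varFinset_func f ts z).2 ⟨i, hz⟩)

theorem ev_subst {M : Type*} (fn : ∀ k, L.Functions k → (Fin k → M) → M) (e : ℕ → M)
    (τ : ℕ → L.Term ℕ) (t : L.Term ℕ) :
    ev fn e (t.subst τ) = ev fn (fun z => ev fn e (τ z)) t := by
  induction t with
  | var z => rfl
  | func f ts ih => simp only [Term.subst, ev, ih]

theorem subst_congr {τ τ' : ℕ → L.Term ℕ} {t : L.Term ℕ} (h : ∀ z ∈ t.varFinset, τ z = τ' z) :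
    t.subst τ = t.subst τ' := by
  induction t with
  | var z => exact h z (by simp [Term.varFinset])
  | func f ts ih =>
    simp only [Term.subst]
    congr 1
    funext i
    exact ih i fun z hz => h z ((mem_varFinset_func f ts z).2 ⟨i, hz⟩)

theorem subst_subst (τ τ' : ℕ → L.Term ℕ) (t : L.Term ℕ) :
    (t.subst τ).subst τ' = t.subst fun z => (τ z).subst τ' := by
  induction t with
  | var z => rfl
  | func f ts ih => simp only [Term.subst, ih]

theorem subst_var (t : L.Term ℕ) : t.subst Term.var = t := by
  induction t with
  | var z => rfl
  | func f ts ih => simp only [Term.subst, ih]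

theorem subst_eq_self {τ : ℕ → L.Term ℕ} {t : L.Term ℕ}
    (h : ∀ z ∈ t.varFinset, τ z = Term.var z) : t.subst τ = t := by
  rw [subst_congr h]
  exact subst_var t

theorem mem_varFinset_subst (τ : ℕ → L.Term ℕ) (t : L.Term ℕ) (v : ℕ) :
    v ∈ (t.subst τ).varFinset ↔ ∃ z ∈ t.varFinset, v ∈ (τ z).varFinset := by
  induction t with
  | var z => simp [Term.subst, Term.varFinset]
  | func f ts ih =>
    simp only [Term.subst, mem_varFinset_func, ih]
    constructor
    · rintro ⟨i, z, hz, hv⟩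
      exact ⟨z, ⟨i, hz⟩, hv⟩
    · rintro ⟨z, ⟨i, hz⟩, hv⟩
      exact ⟨i, z, hz, hv⟩

end Terms

namespace Formula

/-! ### Uniform notation for connectives and quantifiers -/

/-- Disjunction for `true`, conjunction for `false`. -/
def conn : Bool → Formula L → Formula L → Formula L
  | true => or
  | false => and

/-- The existential quantifier for `true`, the universal quantifier for `false`. -/
def quant : Bool → ℕ → Formula L → Formula L
  | true => ex
  | false => all

theorem induct {motive : Formula L → Prop}
    (atom : ∀ {k : ℕ} (R : L.Relations k) (ts : Fin k → L.Term ℕ), motive (atom R ts))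
    (neg : ∀ A, motive A → motive (neg A))
    (conn : ∀ b A B, motive A → motive B → motive (conn b A B))
    (quant : ∀ b x A, motive A → motive (quant b x A)) (A : Formula L) : motive A := by
  induction A with
  | atom R ts => exact atom R ts
  | neg A ih => exact neg A ih
  | or A B ihA ihB => exact conn true A B ihA ihB
  | and A B ihA ihB => exact conn false A B ihA ihB
  | ex x A ih => exact quant true x A ih
  | all x A ih => exact quant false x A ih

/-- All variables of a formula, including those of the quantifiers. -/
def allVars : Formula L → Finset ℕ
  | atom _ ts => Finset.univ.biUnion fun i => (ts i).varFinset
  | neg A => A.allVars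
  | or A B => A.allVars ∪ B.allVars
  | and A B => A.allVars ∪ B.allVars
  | ex x A => insert x A.allVars
  | all x A => insert x A.allVars

/-- The simultaneous replacement of the free occurrences of all variables, without renaming of
bound variables. -/
def ssubst : (ℕ → L.Term ℕ) → Formula L → Formula L
  | τ, atom R ts => atom R fun i => (ts i).subst τ
  | τ, neg A => neg (A.ssubst τ)
  | τ, or A B => or (A.ssubst τ) (B.ssubst τ)
  | τ, and A B => and (A.ssubst τ) (B.ssubst τ)
  | τ, ex x A => ex x (A.ssubst (update τ x (Term.var x)))
  | τ, all x A => all x (A.ssubst (update τ x (Term.var x)))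

/-- The number of connectives and quantifiers. -/
def size : Formula L → ℕ
  | atom _ _ => 0
  | neg A => A.size + 1
  | or A B => A.size + B.size + 1
  | and A B => A.size + B.size + 1
  | ex _ A => A.size + 1
  | all _ A => A.size + 1

section Simp

variable (b : Bool) (x y : ℕ) (A B : Formula L) (t : L.Term ℕ) (τ : ℕ → L.Term ℕ)

@[simp] theorem freeVars_conn : (conn b A B).freeVars = A.freeVars ∪ B.freeVars := by
  cases b <;> rfl
@[simp] theorem freeVars_quant : (quant b x A).freeVars = A.freeVars.erase x := by cases b <;> rfl
@[simp] theorem boundVars_conn : (conn b A B).boundVars = A.boundVars ++ B.boundVars := by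
  cases b <;> rfl
@[simp] theorem boundVars_quant : (quant b x A).boundVars = x :: A.boundVars := by cases b <;> rfl
@[simp] theorem allVars_conn : (conn b A B).allVars = A.allVars ∪ B.allVars := by cases b <;> rfl
@[simp] theorem allVars_quant : (quant b x A).allVars = insert x A.allVars := by cases b <;> rfl
@[simp] theorem subst_conn :
    (conn b A B).subst x t = conn b (A.subst x t) (B.subst x t) := by cases b <;> rfl
@[simp] theorem subst_quant :
    (quant b y A).subst x t = if y = x then quant b y A else quant b y (A.subst x t) := by
  cases b <;> rfl
@[simp] theorem ssubst_conn :
    (conn b A B).ssubst τ = conn b (A.ssubst τ) (B.ssubst τ) := by cases b <;> rfl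
@[simp] theorem ssubst_quant :
    (quant b x A).ssubst τ = quant b x (A.ssubst (update τ x (Term.var x))) := by cases b <;> rfl
@[simp] theorem size_conn : (conn b A B).size = A.size + B.size + 1 := by cases b <;> rfl
@[simp] theorem size_quant : (quant b x A).size = A.size + 1 := by cases b <;> rfl
@[simp] theorem funcs_conn : (conn b A B).funcs = A.funcs ∪ B.funcs := by cases b <;> rfl
@[simp] theorem funcs_quant : (quant b x A).funcs = A.funcs := by cases b <;> rfl
@[simp] theorem noVacuous_conn : (conn b A B).NoVacuous ↔ A.NoVacuous ∧ B.NoVacuous := by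
  cases b <;> rfl
@[simp] theorem noVacuous_quant :
    (quant b x A).NoVacuous ↔ x ∈ A.freeVars ∧ A.NoVacuous := by cases b <;> rfl
@[simp] theorem quantifierFree_conn :
    (conn b A B).QuantifierFree ↔ A.QuantifierFree ∧ B.QuantifierFree := by cases b <;> rfl
@[simp] theorem quantifierFree_quant : (quant b x A).QuantifierFree ↔ False := by cases b <;> rfl

end Simp

theorem boundVars_subst (x : ℕ) (t : L.Term ℕ) (A : Formula L) :
    (A.subst x t).boundVars = A.boundVars := by
  induction A using induct with
  | atom R ts => rfl
  | neg A ih => exact ih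
  | conn b A B ihA ihB => simp [ihA, ihB]
  | quant b y A ih =>
    rw [subst_quant]
    split_ifs
    · rfl
    · simp [ih]

theorem boundVars_ssubst (τ : ℕ → L.Term ℕ) (A : Formula L) :
    (A.ssubst τ).boundVars = A.boundVars := by
  induction A using induct generalizing τ with
  | atom R ts => rfl
  | neg A ih => exact ih τ
  | conn b A B ihA ihB => simp [ihA, ihB]
  | quant b y A ih => simp [ih]

theorem size_subst (x : ℕ) (t : L.Term ℕ) (A : Formula L) : (A.subst x t).size = A.size := by
  induction A using induct with
  | atom R ts => rfl
  | neg A ih => simp [subst, size, ih]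
  | conn b A B ihA ihB => simp [ihA, ihB]
  | quant b y A ih =>
    rw [subst_quant]
    split_ifs
    · rfl
    · simp [ih]

theorem freeVars_subset_allVars (A : Formula L) : A.freeVars ⊆ A.allVars := by
  induction A using induct with
  | atom R ts => exact subset_rfl
  | neg A ih => exact ih
  | conn b A B ihA ihB => simpa using Finset.union_subset_union ihA ihB
  | quant b y A ih =>
    simp only [freeVars_quant, allVars_quant]
    exact (Finset.erase_subset _ _).trans (ih.trans (Finset.subset_insert _ _))

theorem boundVars_subset_allVars (A : Formula L) : ∀ x ∈ A.boundVars, x ∈ A.allVars := by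
  induction A using induct with
  | atom R ts => simp [boundVars]
  | neg A ih => exact ih
  | conn b A B ihA ihB =>
    intro x hx
    simp only [boundVars_conn, List.mem_append] at hx
    simp only [allVars_conn, Finset.mem_union]
    exact hx.imp (ihA x) (ihB x)
  | quant b y A ih =>
    intro x hx
    simp only [boundVars_quant, List.mem_cons] at hx
    simp only [allVars_quant, Finset.mem_insert]
    exact hx.imp_right (ih x)

theorem ssubst_var (A : Formula L) : A.ssubst Term.var = A := by
  induction A using induct with
  | atom R ts => simp [ssubst, Herbrand.subst_var]
  | neg A ih => simp [ssubst, ih]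
  | conn b A B ihA ihB => simp [ihA, ihB]
  | quant b y A ih => simp [ih]

theorem subst_of_notMem {x : ℕ} {t : L.Term ℕ} {A : Formula L} (hx : x ∉ A.freeVars) :
    A.subst x t = A := by
  induction A using induct with
  | atom R ts =>
    simp only [subst, termSubst]
    congr 1
    funext i
    apply subst_eq_self
    intro z hz
    apply update_of_ne
    rintro rfl
    exact hx (by simpa [freeVars] using ⟨i, hz⟩)
  | neg A ih => simp [subst, ih hx]
  | conn b A B ihA ihB =>
    simp only [freeVars_conn, Finset.mem_union, not_or] at hx
    simp [ihA hx.1, ihB hx.2]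
  | quant b y A ih =>
    rw [subst_quant]
    split_ifs with h
    · rfl
    · rw [ih]
      simpa [Ne.symm h] using hx

/-- Instantiation after a simultaneous replacement that leaves the variable alone. -/
theorem subst_ssubst_update {τ : ℕ → L.Term ℕ} {x : ℕ} {t : L.Term ℕ} {A : Formula L}
    (hx : x ∉ A.boundVars) (hτ : ∀ z ∈ A.freeVars, z ≠ x → x ∉ (τ z).varFinset) :
    (A.ssubst (update τ x (Term.var x))).subst x t = A.ssubst (update τ x t) := by
  induction A using induct generalizing τ with
  | atom R ts =>
    simp only [subst, ssubst, termSubst]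
    congr 1
    funext i
    rw [subst_subst]
    apply subst_congr
    intro z hz
    by_cases hzx : z = x
    · subst hzx
      simp [Term.subst]
    · simp only [update_of_ne hzx]
      apply subst_eq_self
      intro w hw
      apply update_of_ne
      rintro rfl
      exact hτ z (by simpa [freeVars] using ⟨i, hz⟩) hzx hw
  | neg A ih => simp [subst, ssubst, ih hx hτ]
  | conn b A B ihA ihB =>
    simp only [boundVars_conn, List.mem_append, not_or] at hx
    simp only [freeVars_conn, Finset.mem_union] at hτ
    simp [ihA hx.1 fun z hz => hτ z (.inl hz), ihB hx.2 fun z hz => hτ z (.inr hz)]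
  | quant b y A ih =>
    simp only [boundVars_quant, List.mem_cons, not_or] at hx
    simp only [ssubst_quant, subst_quant, Ne.symm hx.1, if_false]
    rw [update_comm hx.1, ih hx.2, update_comm hx.1]
    intro z hz hzx
    by_cases hzy : z = y
    · subst hzy
      simpa [Term.varFinset] using hx.1
    · rw [update_of_ne hzy]
      exact hτ z (by simp [hzy, hz]) hzx

theorem mem_allVars_ssubst {τ : ℕ → L.Term ℕ} {A : Formula L} {v : ℕ}
    (h : v ∈ (A.ssubst τ).allVars) :
    v ∈ A.boundVars ∨ ∃ z ∈ A.freeVars, v ∈ (τ z).varFinset := by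
  induction A using induct generalizing τ with
  | atom R ts =>
    simp only [ssubst, allVars, Finset.mem_biUnion, Finset.mem_univ, true_and,
      mem_varFinset_subst] at h
    obtain ⟨i, z, hz, hv⟩ := h
    exact .inr ⟨z, by simpa [freeVars] using ⟨i, hz⟩, hv⟩
  | neg A ih => exact ih h
  | conn b A B ihA ihB =>
    simp only [ssubst_conn, allVars_conn, Finset.mem_union] at h
    simp only [boundVars_conn, List.mem_append, freeVars_conn, Finset.mem_union]
    rcases h with h | h
    · rcases ihA h with h | ⟨z, hz, hv⟩
      exacts [.inl (.inl h), .inr ⟨z, .inl hz, hv⟩]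
    · rcases ihB h with h | ⟨z, hz, hv⟩
      exacts [.inl (.inr h), .inr ⟨z, .inr hz, hv⟩]
  | quant b y A ih =>
    simp only [ssubst_quant, allVars_quant, Finset.mem_insert] at h
    simp only [boundVars_quant, List.mem_cons, freeVars_quant, Finset.mem_erase]
    rcases h with h | h
    · exact .inl (.inl h)
    · rcases ih h with h | ⟨z, hz, hv⟩
      · exact .inl (.inr h)
      · by_cases hzy : z = y
        · subst hzy
          simp only [update_self, Term.varFinset, Finset.mem_singleton] at hv
          exact .inl (.inl hv)
        · rw [update_of_ne hzy] at hv
          exact .inr ⟨z, ⟨hzy, hz⟩, hv⟩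

end Formula

/-! ### Contexts -/

namespace Context

/-- The polarity of the hole, if the context itself has polarity `p`. -/
def pol : Bool → Context L → Bool
  | p, hole => p
  | p, neg C => C.pol (!p)
  | p, orLeft C _ => C.pol p
  | p, orRight _ C => C.pol p
  | p, andLeft C _ => C.pol p
  | p, andRight _ C => C.pol p
  | p, ex _ C => C.pol p
  | p, all _ C => C.pol p

theorem pol_not (C : Context L) (p : Bool) : C.pol (!p) = !C.pol p := by
  induction C generalizing p with
  | hole => rfl
  | neg C ih => exact ih (!p)
  | _ => rename_i ih; exact ih p

theorem pol_true (C : Context L) : C.pol true = C.positive := by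
  induction C with
  | neg C ih => rw [positive, ← ih, ← pol_not]; rfl
  | _ => simp_all [pol, positive]

/-- All variables of a context, including those of the quantifiers. -/
def allVars : Context L → Finset ℕ
  | hole => ∅
  | neg C => C.allVars
  | orLeft C B => C.allVars ∪ B.allVars
  | orRight B C => B.allVars ∪ C.allVars
  | andLeft C B => C.allVars ∪ B.allVars
  | andRight B C => B.allVars ∪ C.allVars
  | ex x C => insert x C.allVars
  | all x C => insert x C.allVars

theorem freeVars_subset_allVars (C : Context L) : C.freeVars ⊆ C.allVars := by
  induction C with
  | hole => exact subset_rfl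
  | neg C ih => exact ih
  | orLeft C B ih => exact Finset.union_subset_union ih B.freeVars_subset_allVars
  | orRight B C ih => exact Finset.union_subset_union B.freeVars_subset_allVars ih
  | andLeft C B ih => exact Finset.union_subset_union ih B.freeVars_subset_allVars
  | andRight B C ih => exact Finset.union_subset_union B.freeVars_subset_allVars ih
  | ex x C ih => exact (Finset.erase_subset _ _).trans (ih.trans (Finset.subset_insert _ _))
  | all x C ih => exact (Finset.erase_subset _ _).trans (ih.trans (Finset.subset_insert _ _))

/-- The composition of contexts. -/
def comp : Context L → Context L → Context L
  | hole, D => D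
  | neg C, D => neg (C.comp D)
  | orLeft C B, D => orLeft (C.comp D) B
  | orRight B C, D => orRight B (C.comp D)
  | andLeft C B, D => andLeft (C.comp D) B
  | andRight B C, D => andRight B (C.comp D)
  | ex x C, D => ex x (C.comp D)
  | all x C, D => all x (C.comp D)

theorem fill_comp (C D : Context L) (H : Formula L) : (C.comp D).fill H = C.fill (D.fill H) := by
  induction C <;> simp_all [comp, fill]

theorem positive_comp (C D : Context L) : (C.comp D).positive = D.pol C.positive := by
  induction C <;> simp_all [comp, positive, pol_not, pol_true]

theorem Accessible.comp {C D : Context L} (hC : C.Accessible) (hD : D.Accessible) :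
    (C.comp D).Accessible := by
  induction C <;> simp_all [Context.comp, Accessible]

theorem allVars_comp (C D : Context L) : (C.comp D).allVars = C.allVars ∪ D.allVars := by
  induction C <;> simp_all [comp, allVars, Finset.union_comm]

end Context

end Herbrand

/-! ### From derivations to validity: strategies, filtrations, and the cost of each rule. -/

namespace Herbrand

open FirstOrder Language Function

variable {L : FirstOrder.Language.{u, v}}

/-! ### Validity of a finite order, relative to strategies for the δ-quantifiers -/

/-- The implication from left to right for `true`, from right to left for `false`. -/
def Below : Bool → Prop → Prop → Prop
  | true, X, Y => X → Y
  | false, X, Y => Y → X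

theorem Below.of_iff {X Y : Prop} (b : Bool) (h : X ↔ Y) : Below b X Y := by
  cases b
  exacts [h.2, h.1]

theorem Below.not {X Y : Prop} {b : Bool} (h : Below (!b) X Y) : Below b (¬X) (¬Y) := by
  cases b
  exacts [mt h, mt h]

theorem Below.or {X Y X' Y' : Prop} {b : Bool} (h : Below b X Y) (h' : Below b X' Y') :
    Below b (X ∨ X') (Y ∨ Y') := by
  cases b
  exacts [Or.imp h h', Or.imp h h']

theorem Below.and {X Y X' Y' : Prop} {b : Bool} (h : Below b X Y) (h' : Below b X' Y') :
    Below b (X ∧ X') (Y ∧ Y') := by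
  cases b
  exacts [And.imp h h', And.imp h h']

/-- A strategy gives values to the δ-quantifiers, depending on the list of the previous choices:
the left (`true`) or right (`false`) immediate subformula, or the value of a γ-quantifier. -/
abbrev Strategy (M : Type*) := List (Bool ⊕ M) → M

namespace Strategy

variable {M : Type*}

/-- The strategy for an immediate subformula. -/
def sub (sk : Strategy M) (b : Bool) : Strategy M := fun h => sk (Sum.inl b :: h)

/-- The strategy for an instance of a γ-quantifier. -/
def inst (sk : Strategy M) (m : M) : Strategy M := fun h => sk (Sum.inr m :: h)

/-- The strategy with given strategies after the first choice. -/
def glue (m₀ : M) (s : Bool → Strategy M) (g : M → Strategy M) : Strategy M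
  | [] => m₀
  | Sum.inl b :: h => s b h
  | Sum.inr m :: h => g m h

@[simp] theorem glue_nil (m₀ : M) (s : Bool → Strategy M) (g : M → Strategy M) :
    glue m₀ s g [] = m₀ := rfl
@[simp] theorem sub_glue (m₀ : M) (s : Bool → Strategy M) (g : M → Strategy M) (b : Bool) :
    (glue m₀ s g).sub b = s b := rfl
@[simp] theorem inst_glue (m₀ : M) (s : Bool → Strategy M) (g : M → Strategy M) (m : M) :
    (glue m₀ s g).inst m = g m := rfl

end Strategy

section Semantics

variable {M : Type*}

/-- The truth of an occurrence of polarity `pos` of a formula, where the γ-quantifiers range over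
`U` and the δ-quantifiers take their values from a strategy. -/
def Holds (fn : ∀ k, L.Functions k → (Fin k → M) → M)
    (rel : ∀ k, L.Relations k → (Fin k → M) → Prop) (U : Set M) :
    Bool → Strategy M → (ℕ → M) → Formula L → Prop
  | _, _, e, .atom R ts => rel _ R fun i => ev fn e (ts i)
  | pos, sk, e, .neg A => ¬ Holds fn rel U (!pos) sk e A
  | pos, sk, e, .or A B =>
      Holds fn rel U pos (sk.sub true) e A ∨ Holds fn rel U pos (sk.sub false) e B
  | pos, sk, e, .and A B =>
      Holds fn rel U pos (sk.sub true) e A ∧ Holds fn rel U pos (sk.sub false) e B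
  | true, sk, e, .ex x A => ∃ m ∈ U, Holds fn rel U true (sk.inst m) (update e x m) A
  | false, sk, e, .all x A => ∀ m ∈ U, Holds fn rel U false (sk.inst m) (update e x m) A
  | false, sk, e, .ex y A => Holds fn rel U false (sk.sub true) (update e y (sk [])) A
  | true, sk, e, .all y A => Holds fn rel U true (sk.sub true) (update e y (sk [])) A

/-- The strategy respects the filtration `T` if at most `k` has been reached so far. -/
def Respects (T : ℕ → Set M) : ℕ → Bool → Strategy M → Formula L → Prop
  | _, _, _, .atom _ _ => True
  | k, pos, sk, .neg A => Respects T k (!pos) sk A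
  | k, pos, sk, .or A B => Respects T k pos (sk.sub true) A ∧ Respects T k pos (sk.sub false) B
  | k, pos, sk, .and A B => Respects T k pos (sk.sub true) A ∧ Respects T k pos (sk.sub false) B
  | k, true, sk, .ex _ A => ∀ j, k ≤ j → ∀ m ∈ T j, Respects T j true (sk.inst m) A
  | k, false, sk, .all _ A => ∀ j, k ≤ j → ∀ m ∈ T j, Respects T j false (sk.inst m) A
  | k, false, sk, .ex _ A => sk [] ∈ T (k + 1) ∧ Respects T k false (sk.sub true) A
  | k, true, sk, .all _ A => sk [] ∈ T (k + 1) ∧ Respects T k true (sk.sub true) A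

variable {fn : ∀ k, L.Functions k → (Fin k → M) → M}
  {rel : ∀ k, L.Relations k → (Fin k → M) → Prop} {U : Set M} {T : ℕ → Set M}

theorem holds_conn (b pos : Bool) (sk : Strategy M) (e : ℕ → M) (A B : Formula L) :
    Holds fn rel U pos sk e (.conn b A B) ↔
      if b then Holds fn rel U pos (sk.sub true) e A ∨ Holds fn rel U pos (sk.sub false) e B
      else Holds fn rel U pos (sk.sub true) e A ∧ Holds fn rel U pos (sk.sub false) e B := by
  cases b <;> simp [Formula.conn, Holds]

theorem holds_gamma (pos : Bool) (sk : Strategy M) (e : ℕ → M) (x : ℕ) (A : Formula L) :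
    Holds fn rel U pos sk e (.quant pos x A) ↔
      if pos then ∃ m ∈ U, Holds fn rel U pos (sk.inst m) (update e x m) A
      else ∀ m ∈ U, Holds fn rel U pos (sk.inst m) (update e x m) A := by
  cases pos <;> simp [Formula.quant, Holds]

theorem holds_delta (pos : Bool) (sk : Strategy M) (e : ℕ → M) (x : ℕ) (A : Formula L) :
    Holds fn rel U pos sk e (.quant (!pos) x A) ↔
      Holds fn rel U pos (sk.sub true) (update e x (sk [])) A := by
  cases pos <;> simp [Formula.quant, Holds]

theorem respects_conn (b pos : Bool) (k : ℕ) (sk : Strategy M) (A B : Formula L) :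
    Respects T k pos sk (.conn b A B) ↔
      Respects T k pos (sk.sub true) A ∧ Respects T k pos (sk.sub false) B := by
  cases b <;> simp [Formula.conn, Respects]

theorem respects_gamma (pos : Bool) (k : ℕ) (sk : Strategy M) (x : ℕ) (A : Formula L) :
    Respects T k pos sk (.quant pos x A) ↔
      ∀ j, k ≤ j → ∀ m ∈ T j, Respects T j pos (sk.inst m) A := by
  cases pos <;> simp [Formula.quant, Respects]

theorem respects_delta (pos : Bool) (k : ℕ) (sk : Strategy M) (x : ℕ) (A : Formula L) :
    Respects T k pos sk (.quant (!pos) x A) ↔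
      sk [] ∈ T (k + 1) ∧ Respects T k pos (sk.sub true) A := by
  cases pos <;> simp [Formula.quant, Respects]

theorem Formula.quant_cases (b pos : Bool) : b = pos ∨ b = !pos := by
  cases b <;> cases pos <;> simp

theorem Holds.congr_env {pos : Bool} {sk : Strategy M} {e e' : ℕ → M} {A : Formula L}
    (h : ∀ z ∈ A.freeVars, e z = e' z) :
    Holds fn rel U pos sk e A ↔ Holds fn rel U pos sk e' A := by
  induction A using Formula.induct generalizing pos sk e e' with
  | atom R ts =>
    simp only [Holds]
    rw [show (fun i => ev fn e (ts i)) = fun i => ev fn e' (ts i) from funext fun i =>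
      ev_congr fun z hz => h z (by simpa [Formula.freeVars] using ⟨i, hz⟩)]
  | neg A ih => simp only [Holds, ih h]
  | conn b A B ihA ihB =>
    simp only [Formula.freeVars_conn, Finset.mem_union] at h
    rw [holds_conn, holds_conn, ihA fun z hz => h z (.inl hz), ihB fun z hz => h z (.inr hz)]
  | quant b x A ih =>
    have key : ∀ m, ∀ z ∈ A.freeVars, update e x m z = update e' x m z := by
      intro m z hz
      by_cases hzx : z = x
      · simp [hzx]
      · simpa [hzx] using h z (by simp [hzx, hz])
    rcases Formula.quant_cases b pos with rfl | rfl
    · simp only [holds_gamma, fun s m => ih (pos := b) (sk := s) (key m)]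
    · simp only [holds_delta, fun s m => ih (pos := pos) (sk := s) (key m)]

/-- A strategy sees only the history of moves, and the replacement of a variable by a term leaves
the possible moves unchanged; so one strategy serves both sides. The condition on `t` excludes
captures, as `subst` does not rename. -/
theorem holds_subst {pos : Bool} {sk : Strategy M} {e : ℕ → M} {x : ℕ} {t : L.Term ℕ}
    {A : Formula L} (ht : ∀ z ∈ t.varFinset, z ∉ A.boundVars) :
    Holds fn rel U pos sk e (A.subst x t) ↔
      Holds fn rel U pos sk (update e x (ev fn e t)) A := by
  induction A using Formula.induct generalizing pos sk e with
  | atom R ts =>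
    simp only [Formula.subst, Holds, termSubst, ev_subst]
    rw [show (fun z => ev fn e (update Term.var x t z)) = update e x (ev fn e t) from ?_]
    funext z
    by_cases hzx : z = x
    · simp [hzx]
    · simp [hzx, ev]
  | neg A ih => simp only [Formula.subst, Holds, ih ht]
  | conn b A B ihA ihB =>
    simp only [Formula.boundVars_conn, List.mem_append, not_or] at ht
    rw [Formula.subst_conn, holds_conn, holds_conn, ihA fun z hz => (ht z hz).1,
      ihB fun z hz => (ht z hz).2]
  | quant b y A ih =>
    simp only [Formula.boundVars_quant, List.mem_cons, not_or] at ht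
    rw [Formula.subst_quant]
    split_ifs with hyx
    · subst hyx
      exact Holds.congr_env fun z hz => by simp_all
    · have key : ∀ m s (p : Bool), Holds fn rel U p s (update e y m) (A.subst x t) ↔
          Holds fn rel U p s (update (update e x (ev fn e t)) y m) A := by
        intro m s p
        rw [ih fun z hz => (ht z hz).2, update_comm hyx,
          ev_congr (e := update e y m) (e' := e) fun z hz => update_of_ne (ht z hz).1 _ _]
      rcases Formula.quant_cases b pos with rfl | rfl
      · simp only [holds_gamma, key]
      · simp only [holds_delta, key]

/-- No condition against captures is needed: whether a strategy respects a filtration depends on the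
connectives and quantifiers, not on the terms. -/
theorem respects_subst {pos : Bool} {k : ℕ} {sk : Strategy M} {x : ℕ} {t : L.Term ℕ}
    {A : Formula L} : Respects T k pos sk (A.subst x t) ↔ Respects T k pos sk A := by
  induction A using Formula.induct generalizing pos k sk with
  | atom R ts => simp [Formula.subst, Respects]
  | neg A ih => simp only [Formula.subst, Respects, ih]
  | conn b A B ihA ihB => rw [Formula.subst_conn, respects_conn, respects_conn, ihA, ihB]
  | quant b y A ih =>
    rw [Formula.subst_quant]
    split_ifs
    · rfl
    · rcases Formula.quant_cases b pos with rfl | rfl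
      · simp only [respects_gamma, ih]
      · simp only [respects_delta, ih]

/-- A higher starting level permits higher δ-values and leaves fewer levels `j` to be considered at
γ-quantifiers. -/
theorem Respects.mono (hT : Monotone T) {pos : Bool} {k k' : ℕ} (hk : k ≤ k') {sk : Strategy M}
    {A : Formula L} (h : Respects T k pos sk A) : Respects T k' pos sk A := by
  induction A using Formula.induct generalizing pos k k' sk with
  | atom R ts => trivial
  | neg A ih => exact ih hk h
  | conn b A B ihA ihB =>
    rw [respects_conn] at h ⊢
    exact ⟨ihA hk h.1, ihB hk h.2⟩
  | quant b y A ih =>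
    rcases Formula.quant_cases b pos with rfl | rfl
    · rw [respects_gamma] at h ⊢
      exact fun j hj => h j (hk.trans hj)
    · rw [respects_delta] at h ⊢
      exact ⟨hT (Nat.succ_le_succ hk) h.1, ih hk h.2⟩

theorem Respects.shift {pos : Bool} {k d : ℕ} {sk : Strategy M} {A : Formula L}
    (h : Respects T (k + d) pos sk A) : Respects (fun j => T (j + d)) k pos sk A := by
  induction A using Formula.induct generalizing pos k sk with
  | atom R ts => trivial
  | neg A ih => exact ih h
  | conn b A B ihA ihB =>
    rw [respects_conn] at h ⊢
    exact ⟨ihA h.1, ihB h.2⟩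
  | quant b y A ih =>
    rcases Formula.quant_cases b pos with rfl | rfl
    · rw [respects_gamma] at h ⊢
      exact fun j hj m hm => ih (h (j + d) (by omega) m hm)
    · rw [respects_delta] at h ⊢
      refine ⟨?_, ih h.2⟩
      have := h.1
      rwa [show k + d + 1 = k + 1 + d by omega] at this

/-- Renaming changes neither the moves nor the values that reach the atoms, so the strategy can be
kept as it is. -/
theorem Formula.Variant.semantics {A B : Formula L} (h : A.Variant B) :
    (∀ (pos : Bool) (sk : Strategy M) (e : ℕ → M),
      Holds fn rel U pos sk e A ↔ Holds fn rel U pos sk e B) ∧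
    ∀ (pos : Bool) (sk : Strategy M) (k : ℕ), Respects T k pos sk A ↔ Respects T k pos sk B := by
  have rename : ∀ (b : Bool) (A : Formula L) (x y : ℕ), y ∉ A.freeVars → y ∉ A.boundVars →
      (∀ (pos : Bool) (sk : Strategy M) (e : ℕ → M),
        Holds fn rel U pos sk e (.quant b x A) ↔
          Holds fn rel U pos sk e (.quant b y (A.subst x (Term.var y)))) ∧
      ∀ (pos : Bool) (sk : Strategy M) (k : ℕ), Respects T k pos sk (.quant b x A) ↔
        Respects T k pos sk (.quant b y (A.subst x (Term.var y))) := by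
    intro b A x y hf hb
    have key : ∀ (pos : Bool) (sk : Strategy M) (e : ℕ → M) (m : M),
        Holds fn rel U pos sk (update e x m) A ↔
          Holds fn rel U pos sk (update e y m) (A.subst x (Term.var y)) := by
      intro pos sk e m
      rw [holds_subst (by simpa [Term.varFinset] using hb)]
      apply Holds.congr_env
      intro z hz
      have hzy : z ≠ y := by rintro rfl; exact hf hz
      by_cases hzx : z = x
      · simp [hzx, ev]
      · simp [hzx, hzy]
    constructor
    · intro pos sk e
      rcases Formula.quant_cases b pos with rfl | rfl
      · simp only [holds_gamma, key]
      · simp only [holds_delta, key]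
    · intro pos sk k
      rcases Formula.quant_cases b pos with rfl | rfl
      · simp only [respects_gamma, respects_subst]
      · simp only [respects_delta, respects_subst]
  have under : ∀ (b : Bool) (x : ℕ) (A B : Formula L),
      ((∀ (pos : Bool) (sk : Strategy M) (e : ℕ → M),
        Holds fn rel U pos sk e A ↔ Holds fn rel U pos sk e B) ∧
      ∀ (pos : Bool) (sk : Strategy M) (k : ℕ),
        Respects T k pos sk A ↔ Respects T k pos sk B) →
      (∀ (pos : Bool) (sk : Strategy M) (e : ℕ → M),
        Holds fn rel U pos sk e (.quant b x A) ↔ Holds fn rel U pos sk e (.quant b x B)) ∧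
      ∀ (pos : Bool) (sk : Strategy M) (k : ℕ),
        Respects T k pos sk (.quant b x A) ↔ Respects T k pos sk (.quant b x B) := by
    rintro b x A B ⟨h₁, h₂⟩
    constructor
    · intro pos sk e
      rcases Formula.quant_cases b pos with rfl | rfl
      · simp only [holds_gamma, h₁]
      · simp only [holds_delta, h₁]
    · intro pos sk k
      rcases Formula.quant_cases b pos with rfl | rfl
      · simp only [respects_gamma, h₂]
      · simp only [respects_delta, h₂]
  induction h with
  | refl A => exact ⟨fun _ _ _ => Iff.rfl, fun _ _ _ => Iff.rfl⟩
  | symm _ ih => exact ⟨fun p s e => (ih.1 p s e).symm, fun p s k => (ih.2 p s k).symm⟩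
  | trans _ _ ih ih' =>
    exact ⟨fun p s e => (ih.1 p s e).trans (ih'.1 p s e),
      fun p s k => (ih.2 p s k).trans (ih'.2 p s k)⟩
  | neg _ ih => simp only [Holds, Respects, ih, implies_true, and_self]
  | or _ _ ih ih' => simp only [Holds, Respects, ih, ih', implies_true, and_self]
  | and _ _ ih ih' => simp only [Holds, Respects, ih, ih', implies_true, and_self]
  | ex x _ ih => exact under true x _ _ ih
  | all x _ ih => exact under false x _ _ ih
  | renameEx hf hb => exact rename true _ _ _ hf hb
  | renameAll hf hb => exact rename false _ _ _ hf hb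

/-- Every strategy for `Q` can be turned into one for `P` in such a way that `P` is below `Q`. -/
def Entails (fn : ∀ k, L.Functions k → (Fin k → M) → M)
    (rel : ∀ k, L.Relations k → (Fin k → M) → Prop) (U : Set M) (T : ℕ → Set M)
    (pos : Bool) (P Q : Formula L) : Prop :=
  ∀ sk : Strategy M, ∃ sk' : Strategy M,
    (∀ k, Respects T k pos sk Q → Respects T k pos sk' P) ∧
    ∀ e, Below pos (Holds fn rel U pos sk' e P) (Holds fn rel U pos sk e Q)

theorem Entails.conn_left {pos : Bool} {P Q : Formula L} (h : Entails fn rel U T pos P Q)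
    (b : Bool) (B : Formula L) : Entails fn rel U T pos (.conn b P B) (.conn b Q B) := by
  intro sk
  obtain ⟨s, hs, hs'⟩ := h (sk.sub true)
  refine ⟨Strategy.glue (sk []) (fun c => if c then s else sk.sub false) sk.inst, ?_, ?_⟩
  · intro k
    simp only [respects_conn, Strategy.sub_glue]
    exact And.imp (hs k) id
  · intro e
    simp only [holds_conn, Strategy.sub_glue]
    cases b
    exacts [(hs' e).and (.of_iff _ Iff.rfl), (hs' e).or (.of_iff _ Iff.rfl)]

theorem Entails.conn_right {pos : Bool} {P Q : Formula L} (h : Entails fn rel U T pos P Q)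
    (b : Bool) (B : Formula L) : Entails fn rel U T pos (.conn b B P) (.conn b B Q) := by
  intro sk
  obtain ⟨s, hs, hs'⟩ := h (sk.sub false)
  refine ⟨Strategy.glue (sk []) (fun c => if c then sk.sub true else s) sk.inst, ?_, ?_⟩
  · intro k
    simp only [respects_conn, Strategy.sub_glue]
    exact And.imp id (hs k)
  · intro e
    simp only [holds_conn, Strategy.sub_glue]
    cases b
    exacts [.and (.of_iff _ Iff.rfl) (hs' e), .or (.of_iff _ Iff.rfl) (hs' e)]

theorem Entails.quant {pos : Bool} {P Q : Formula L} (h : Entails fn rel U T pos P Q)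
    (b : Bool) (x : ℕ) : Entails fn rel U T pos (.quant b x P) (.quant b x Q) := by
  intro sk
  rcases Formula.quant_cases b pos with rfl | rfl
  -- Different instances of a γ-quantifier may need differently transformed strategies; they are
  -- glued after the move `m`.
  · choose s hs hs' using fun m => h (sk.inst m)
    refine ⟨Strategy.glue (sk []) sk.sub s, ?_, ?_⟩
    · intro k
      simp only [respects_gamma, Strategy.inst_glue]
      exact fun hk j hj m hm => hs m j (hk j hj m hm)
    · intro e
      simp only [holds_gamma, Strategy.inst_glue]
      cases b
      · exact fun H m hm => hs' m _ (H m hm)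
      · rintro ⟨m, hm, H⟩
        exact ⟨m, hm, hs' m _ H⟩
  · obtain ⟨s, hs, hs'⟩ := h (sk.sub true)
    refine ⟨Strategy.glue (sk []) (fun _ => s) sk.inst, ?_, ?_⟩
    · intro k
      simp only [respects_delta, Strategy.sub_glue, Strategy.glue_nil]
      exact And.imp id (hs k)
    · intro e
      simp only [holds_delta, Strategy.sub_glue, Strategy.glue_nil]
      exact hs' _

/-- The hole may lie under quantifiers, because `Entails` demands a strategy that works for all
environments and all levels at once. This is what simplification and renaming need, which are not
restricted to accessible positions. -/
theorem Entails.fill {C : Context L} {pos : Bool} {P Q : Formula L}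
    (h : Entails fn rel U T (C.pol pos) P Q) :
    Entails fn rel U T pos (C.fill P) (C.fill Q) := by
  induction C generalizing pos with
  | hole => exact h
  | neg C ih =>
    intro sk
    obtain ⟨s, hs, hs'⟩ := ih h sk
    exact ⟨s, hs, fun e => (hs' e).not⟩
  | orLeft C B ih => exact (ih h).conn_left true B
  | orRight B C ih => exact (ih h).conn_right true B
  | andLeft C B ih => exact (ih h).conn_left false B
  | andRight B C ih => exact (ih h).conn_right false B
  | ex x C ih => exact (ih h).quant true x
  | all x C ih => exact (ih h).quant false x

/-- The same strategy is played in both copies, so the two have the same truth value and one of them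
is redundant. -/
theorem entails_simplification {pos : Bool} {H H' : Formula L} (h : H.Variant H') :
    Entails fn rel U T pos (.conn pos H H') H := by
  intro sk
  obtain ⟨h₁, h₂⟩ := h.semantics (M := M) (fn := fn) (rel := rel) (U := U) (T := T)
  refine ⟨Strategy.glue (sk []) (fun _ => sk) sk.inst, ?_, ?_⟩
  · intro k hk
    rw [respects_conn]
    exact ⟨hk, (h₂ _ _ _).1 hk⟩
  · intro e
    simp only [holds_conn, Strategy.sub_glue]
    cases pos
    · exact fun H => ⟨H, (h₁ _ _ _).1 H⟩
    · exact fun H => H.elim id (h₁ _ _ _).2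

theorem entails_of_variant {pos : Bool} {A B : Formula L} (h : A.Variant B) :
    Entails fn rel U T pos A B := by
  intro sk
  obtain ⟨h₁, h₂⟩ := h.semantics (M := M) (fn := fn) (rel := rel) (U := U) (T := T)
  exact ⟨sk, fun k => (h₂ _ _ _).2, fun e => .of_iff _ (h₁ _ _ _)⟩

/-- Replacement in the hole of an accessible context. The environment may change at variables that
are not free in the context. -/
theorem accessible_replace {T' : ℕ → Set M}
    (hT : ∀ (pos : Bool) (sk : Strategy M) (A : Formula L),
      Respects T 0 pos sk A → Respects T' 0 pos sk A)
    {P Q : Formula L} {C : Context L} (hC : C.Accessible) {pos : Bool} {sk : Strategy M}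
    (hsk : Respects T 0 pos sk (C.fill Q)) :
    ∃ s : Strategy M, Respects T 0 (C.pol pos) s Q ∧
      ∀ s' : Strategy M, Respects T' 0 (C.pol pos) s' P →
        ∃ sk' : Strategy M, Respects T' 0 pos sk' (C.fill P) ∧
          ∀ e e' : ℕ → M, (∀ z ∈ C.freeVars, e z = e' z) →
            Below (C.pol pos) (Holds fn rel U (C.pol pos) s' e' P)
              (Holds fn rel U (C.pol pos) s e Q) →
            Below pos (Holds fn rel U pos sk' e' (C.fill P))
              (Holds fn rel U pos sk e (C.fill Q)) := by
  -- The induction step at a connective. The strategy for the untouched argument `B` is kept: it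
  -- passes from `T` to `T'` by `hT`, and its outcome is unaffected because `e` and `e'` agree on
  -- the free variables of `B`. The level stays zero, since an accessible hole lies below no
  -- quantifier.
  have left : ∀ (b : Bool) (C : Context L) (B : Formula L) (pos : Bool) (sk : Strategy M)
      (_ : ∀ {pos : Bool} {sk : Strategy M}, Respects T 0 pos sk (C.fill Q) →
        ∃ s : Strategy M, Respects T 0 (C.pol pos) s Q ∧
        ∀ s' : Strategy M, Respects T' 0 (C.pol pos) s' P →
          ∃ sk' : Strategy M, Respects T' 0 pos sk' (C.fill P) ∧
            ∀ e e' : ℕ → M, (∀ z ∈ C.freeVars, e z = e' z) →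
              Below (C.pol pos) (Holds fn rel U (C.pol pos) s' e' P)
                (Holds fn rel U (C.pol pos) s e Q) →
              Below pos (Holds fn rel U pos sk' e' (C.fill P))
                (Holds fn rel U pos sk e (C.fill Q))),
      Respects T 0 pos sk (.conn b (C.fill Q) B) →
        ∃ s : Strategy M, Respects T 0 (C.pol pos) s Q ∧
        ∀ s' : Strategy M, Respects T' 0 (C.pol pos) s' P →
          ∃ sk' : Strategy M, Respects T' 0 pos sk' (.conn b (C.fill P) B) ∧
            ∀ e e' : ℕ → M, (∀ z ∈ C.freeVars ∪ B.freeVars, e z = e' z) →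
              Below (C.pol pos) (Holds fn rel U (C.pol pos) s' e' P)
                (Holds fn rel U (C.pol pos) s e Q) →
              Below pos (Holds fn rel U pos sk' e' (.conn b (C.fill P) B))
                (Holds fn rel U pos sk e (.conn b (C.fill Q) B)) := by
    intro b C B pos sk ih h
    rw [respects_conn] at h
    obtain ⟨s, hs, H⟩ := ih h.1
    refine ⟨s, hs, fun s' hs' => ?_⟩
    obtain ⟨sk', hsk', H'⟩ := H s' hs'
    refine ⟨Strategy.glue (sk []) (fun c => if c then sk' else sk.sub false) sk.inst, ?_, ?_⟩
    · rw [respects_conn]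
      exact ⟨hsk', hT _ _ _ h.2⟩
    · intro e e' he hb
      have h₁ := H' e e' (fun z hz => he z (Finset.mem_union_left _ hz)) hb
      have h₂ : Holds fn rel U pos (sk.sub false) e' B ↔ Holds fn rel U pos (sk.sub false) e B :=
        Holds.congr_env fun z hz => (he z (Finset.mem_union_right _ hz)).symm
      simp only [holds_conn, Strategy.sub_glue]
      cases b
      exacts [h₁.and (.of_iff _ h₂), h₁.or (.of_iff _ h₂)]
  have right : ∀ (b : Bool) (C : Context L) (B : Formula L) (pos : Bool) (sk : Strategy M)
      (_ : ∀ {pos : Bool} {sk : Strategy M}, Respects T 0 pos sk (C.fill Q) →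
        ∃ s : Strategy M, Respects T 0 (C.pol pos) s Q ∧
        ∀ s' : Strategy M, Respects T' 0 (C.pol pos) s' P →
          ∃ sk' : Strategy M, Respects T' 0 pos sk' (C.fill P) ∧
            ∀ e e' : ℕ → M, (∀ z ∈ C.freeVars, e z = e' z) →
              Below (C.pol pos) (Holds fn rel U (C.pol pos) s' e' P)
                (Holds fn rel U (C.pol pos) s e Q) →
              Below pos (Holds fn rel U pos sk' e' (C.fill P))
                (Holds fn rel U pos sk e (C.fill Q))),
      Respects T 0 pos sk (.conn b B (C.fill Q)) →
        ∃ s : Strategy M, Respects T 0 (C.pol pos) s Q ∧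
        ∀ s' : Strategy M, Respects T' 0 (C.pol pos) s' P →
          ∃ sk' : Strategy M, Respects T' 0 pos sk' (.conn b B (C.fill P)) ∧
            ∀ e e' : ℕ → M, (∀ z ∈ B.freeVars ∪ C.freeVars, e z = e' z) →
              Below (C.pol pos) (Holds fn rel U (C.pol pos) s' e' P)
                (Holds fn rel U (C.pol pos) s e Q) →
              Below pos (Holds fn rel U pos sk' e' (.conn b B (C.fill P)))
                (Holds fn rel U pos sk e (.conn b B (C.fill Q))) := by
    intro b C B pos sk ih h
    rw [respects_conn] at h
    obtain ⟨s, hs, H⟩ := ih h.2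
    refine ⟨s, hs, fun s' hs' => ?_⟩
    obtain ⟨sk', hsk', H'⟩ := H s' hs'
    refine ⟨Strategy.glue (sk []) (fun c => if c then sk.sub true else sk') sk.inst, ?_, ?_⟩
    · rw [respects_conn]
      exact ⟨hT _ _ _ h.1, hsk'⟩
    · intro e e' he hb
      have h₁ := H' e e' (fun z hz => he z (Finset.mem_union_right _ hz)) hb
      have h₂ : Holds fn rel U pos (sk.sub true) e' B ↔ Holds fn rel U pos (sk.sub true) e B :=
        Holds.congr_env fun z hz => (he z (Finset.mem_union_left _ hz)).symm
      simp only [holds_conn, Strategy.sub_glue]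
      cases b
      exacts [.and (.of_iff _ h₂) h₁, .or (.of_iff _ h₂) h₁]
  induction C generalizing pos sk with
  | hole => exact ⟨sk, hsk, fun s' hs' => ⟨s', hs', fun _ _ _ h => h⟩⟩
  | neg C ih =>
    obtain ⟨s, hs, H⟩ := ih hC hsk
    refine ⟨s, hs, fun s' hs' => ?_⟩
    obtain ⟨sk', hsk', H'⟩ := H s' hs'
    exact ⟨sk', hsk', fun e e' he hb => (H' e e' he hb).not⟩
  | orLeft C B ih => exact left true C B pos sk (ih hC) hsk
  | orRight B C ih => exact right true C B pos sk (ih hC) hsk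
  | andLeft C B ih => exact left false C B pos sk (ih hC) hsk
  | andRight B C ih => exact right false C B pos sk (ih hC) hsk
  | ex x C ih => exact hC.elim
  | all x C ih => exact hC.elim

end Semantics

/-- A filtration by which the heights of terms are measured. -/
structure IsFiltration {M : Type*} (fn : ∀ k, L.Functions k → (Fin k → M) → M)
    (T : ℕ → Set M) : Prop where
  mono : Monotone T
  fn_mem : ∀ k (f : L.Functions k) (ms : Fin k → M) (j : ℕ), (∀ i, ms i ∈ T j) →
    fn k f ms ∈ T (j + 1)

theorem IsFiltration.shift {M : Type*} {fn : ∀ k, L.Functions k → (Fin k → M) → M}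
    {T : ℕ → Set M} (h : IsFiltration fn T) (d : ℕ) : IsFiltration fn fun j => T (j + d) where
  mono _ _ hab := h.mono (Nat.add_le_add_right hab d)
  fn_mem k f ms j hms := by
    have := h.fn_mem k f ms (j + d) hms
    rwa [show j + d + 1 = j + 1 + d by omega] at this

/-- Variables have height one and values of level one; a function symbol adds one to both. -/
theorem IsFiltration.ev_mem {M : Type*} {fn : ∀ k, L.Functions k → (Fin k → M) → M}
    {T : ℕ → Set M} (h : IsFiltration fn T) {e : ℕ → M} (he : ∀ z, e z ∈ T 1) (t : L.Term ℕ) :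
    ev fn e t ∈ T (termHeight t) := by
  induction t with
  | var z => exact he z
  | func f ts ih =>
    simp only [ev, termHeight]
    rw [add_comm]
    exact h.fn_mem _ f _ _ fun i =>
      h.mono (Finset.le_sup (f := fun i => termHeight (ts i)) (Finset.mem_univ i)) (ih i)

/-- Validity in all structures when the γ-quantifiers range over the elements up to height `N`
and the strategies respect the heights. -/
def ValidUpTo (N : ℕ) (P : Formula L) : Prop :=
  ∀ (M : Type u) (fn : ∀ k, L.Functions k → (Fin k → M) → M)
    (rel : ∀ k, L.Relations k → (Fin k → M) → Prop) (T : ℕ → Set M), IsFiltration fn T →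
    ∀ e : ℕ → M, (∀ z, e z ∈ T 1) → ∀ sk : Strategy M, Respects T 0 true sk P →
      Holds fn rel (T N) true sk e P

/-- Level `N + d` is level `N` of the filtration shifted by `d`, and a shift only makes the
conditions on environments and strategies weaker. -/
theorem ValidUpTo.add {N : ℕ} {P : Formula L} (h : ValidUpTo N P) (d : ℕ) :
    ValidUpTo (N + d) P := by
  intro M fn rel T hT e he sk hsk
  exact h M fn rel (fun j => T (j + d)) (hT.shift d) e (fun z => hT.mono (by omega) (he z)) sk
    (Respects.shift (hsk.mono hT.mono (Nat.zero_le _)))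

/-- Without quantifiers, neither the strategy nor the range matters, and the structure induces one
of the valuations under which the tautology is true. -/
theorem validUpTo_of_tautology {B : Formula L} (h : B.IsSententialTautology) (N : ℕ) :
    ValidUpTo N B := by
  intro M fn rel T _ e _ sk _
  have key : ∀ (A : Formula L) (pos : Bool) (sk : Strategy M), A.QuantifierFree →
      (A.Truth (fun k R ts => rel k R fun i => ev fn e (ts i)) ↔
        Holds fn rel (T N) pos sk e A) := by
    intro A
    induction A with
    | atom R ts => exact fun _ _ _ => Iff.rfl
    | neg A ih => exact fun pos sk hA => not_congr (ih _ _ hA)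
    | or A B ihA ihB => exact fun pos sk hA => or_congr (ihA _ _ hA.1) (ihB _ _ hA.2)
    | and A B ihA ihB => exact fun pos sk hA => and_congr (ihA _ _ hA.1) (ihB _ _ hA.2)
    | ex x A ih => exact fun _ _ hA => hA.elim
    | all x A ih => exact fun _ _ hA => hA.elim
  exact (key B true sk h.1).1 (h.2 _)

theorem ValidUpTo.of_entails {N : ℕ} {C : Context L} {P Q : Formula L}
    (h : ∀ (M : Type u) (fn : ∀ k, L.Functions k → (Fin k → M) → M)
      (rel : ∀ k, L.Relations k → (Fin k → M) → Prop) (U : Set M) (T : ℕ → Set M),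
      Entails fn rel U T C.positive P Q) (hv : ValidUpTo N (C.fill P)) :
    ValidUpTo N (C.fill Q) := by
  intro M fn rel T hT e he sk hsk
  obtain ⟨sk', h₁, h₂⟩ := Entails.fill (pos := true) (C.pol_true.symm ▸ h M fn rel (T N) T) sk
  exact h₂ e (hv M fn rel T hT e he sk' (h₁ 0 hsk))

/-- The value of `t` has level `|t|`. In the filtration shifted by `|t|` it counts as a value of
level zero, so the strategy that follows this instance of the γ-quantifier is admitted for the
premise at level zero. Level `N` of the shifted filtration is level `N + |t|` of the original one.
-/
theorem ValidUpTo.gamma {N : ℕ} {C : Context L} {x : ℕ} {H : Formula L} {t : L.Term ℕ}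
    (hC : C.Accessible) (ht : ∀ z ∈ t.varFinset, z ∉ H.boundVars)
    (hv : ValidUpTo N (C.fill (H.subst x t))) :
    ValidUpTo (N + termHeight t) (C.fill (.quant C.positive x H)) := by
  intro M fn rel T hT e he sk hsk
  obtain ⟨s, hs, h⟩ := accessible_replace (fn := fn) (rel := rel) (U := T (N + termHeight t))
    (T' := fun j => T (j + termHeight t)) (P := H.subst x t)
    (fun _ _ _ hr => (Respects.mono hT.mono (Nat.zero_le _) hr).shift) hC hsk
  simp only [C.pol_true] at hs h
  rw [respects_gamma] at hs
  obtain ⟨sk', hsk', h'⟩ := h (s.inst (ev fn e t)) (respects_subst.2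
    ((hs _ (Nat.zero_le _) _ (hT.ev_mem he t)).mono hT.mono (Nat.zero_add _).ge).shift)
  refine h' e e (fun _ _ => rfl) ?_ (hv M fn rel _ (hT.shift _) e
    (fun z => hT.mono (by omega) (he z)) sk' hsk')
  rw [holds_subst ht, holds_gamma]
  have hm : ev fn e t ∈ T (N + termHeight t) := hT.mono (by omega) (hT.ev_mem he t)
  cases C.positive
  · exact fun H => H _ hm
  · exact fun H => ⟨_, hm, H⟩

/-- At an accessible position the value of `y` lies in level one, which is exactly what is required
of the value of a free variable. So the premise can be used with this value at `y`; the context does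
not notice, as `y` is not free in it. The bound does not grow. -/
theorem ValidUpTo.delta {N : ℕ} {C : Context L} {y : ℕ} {H : Formula L}
    (hC : C.Accessible) (hy : y ∉ C.freeVars) (hv : ValidUpTo N (C.fill H)) :
    ValidUpTo N (C.fill (.quant (!C.positive) y H)) := by
  intro M fn rel T hT e he sk hsk
  obtain ⟨s, hs, h⟩ := accessible_replace (fn := fn) (rel := rel) (U := T N) (T' := T)
    (P := H) (fun _ _ _ hr => hr) hC hsk
  simp only [C.pol_true] at hs h
  rw [respects_delta] at hs
  obtain ⟨sk', hsk', h'⟩ := h (s.sub true) hs.2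
  refine h' e (update e y (s [])) (fun z hz => ?_) (.of_iff _ (holds_delta _ _ _ _ _).symm)
    (hv M fn rel T hT _ (fun z => ?_) sk' hsk')
  · rw [update_of_ne]
    rintro rfl
    exact hy hz
  · by_cases hz : z = y
    · rw [hz, update_self]
      exact hs.1
    · rw [update_of_ne hz]
      exact he z

/-! ### Heights are bounded by lengths of codes -/

theorem termHeight_le_length (t : L.Term ℕ) : termHeight t ≤ t.listEncode.length := by
  induction t with
  | var z => simp [termHeight, Term.listEncode]
  | func f ts ih =>
    simp only [termHeight, Term.listEncode, List.length_cons, List.length_flatMap]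
    rw [add_comm]
    apply Nat.succ_le_succ
    apply Finset.sup_le
    intro i _
    exact (ih i).trans (List.single_le_sum (fun _ _ => Nat.zero_le _) _
      (List.mem_map.2 ⟨i, List.mem_finRange i, rfl⟩))

theorem termHeight_le_subst {x : ℕ} {τ : ℕ → L.Term ℕ} {s : L.Term ℕ}
    (hx : x ∈ s.varFinset) : termHeight (τ x) ≤ termHeight (s.subst τ) := by
  induction s with
  | var z =>
    simp only [Term.varFinset, Finset.mem_singleton] at hx
    rw [hx]
    rfl
  | func f ts ih =>
    obtain ⟨i, hi⟩ := (mem_varFinset_func f ts x).1 hx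
    simp only [Term.subst, termHeight]
    have := Finset.le_sup (f := fun i => termHeight ((ts i).subst τ)) (Finset.mem_univ i)
    have := ih i hi
    omega

namespace Formula

@[simp] theorem length_code_conn (b : Bool) (A B : Formula L) :
    (conn b A B).code.length = A.code.length + B.code.length + 1 := by
  cases b <;> simp [conn, code]

@[simp] theorem length_code_quant (b : Bool) (x : ℕ) (A : Formula L) :
    (quant b x A).code.length = A.code.length + 2 := by
  cases b <;> simp [quant, code]

theorem termHeight_le_length_code_subst {x : ℕ} {t : L.Term ℕ} {A : Formula L}
    (hx : x ∈ A.freeVars) : termHeight t ≤ (A.subst x t).code.length := by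
  induction A using induct with
  | atom R ts =>
    obtain ⟨i, hi⟩ : ∃ i, x ∈ (ts i).varFinset := by simpa [freeVars] using hx
    have h₁ : termHeight t ≤ termHeight (termSubst x t (ts i)) := by
      have := termHeight_le_subst (τ := update Term.var x t) hi
      rwa [update_self] at this
    refine (h₁.trans (termHeight_le_length _)).trans ?_
    simp only [subst, code, List.length_cons, List.length_flatMap, List.length_map]
    exact Nat.le_succ_of_le (List.single_le_sum (fun _ _ => Nat.zero_le _) _
      (List.mem_map.2 ⟨i, List.mem_finRange i, rfl⟩))
  | neg A ih => simpa [subst, code] using (ih hx).trans (Nat.le_succ _)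
  | conn b A B ihA ihB =>
    simp only [freeVars_conn, Finset.mem_union] at hx
    simp only [subst_conn, length_code_conn]
    rcases hx with hx | hx
    · have := ihA hx
      omega
    · have := ihB hx
      omega
  | quant b y A ih =>
    simp only [freeVars_quant, Finset.mem_erase] at hx
    have := ih hx.2
    simp only [subst_quant, Ne.symm hx.1, if_false, length_code_quant]
    omega

theorem code_ne_nil (A : Formula L) : 0 < A.code.length := by
  cases A <;> simp [code]

theorem length_code_le_fill (C : Context L) (H : Formula L) :
    H.code.length ≤ (C.fill H).code.length := by
  induction C <;> simp only [Context.fill, code, List.length_cons, List.length_append] <;> omega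

end Formula

/-- A derivation lists formulas and not the terms used in γ-steps, so the height of `t` is bounded
by the length of the premise in which it occurs. -/
theorem ValidUpTo.gamma_length {N : ℕ} {C : Context L} {x : ℕ} {H : Formula L} {t : L.Term ℕ}
    (hC : C.Accessible) (ht : ∀ z ∈ t.varFinset, z ∉ H.boundVars)
    (hv : ValidUpTo N (C.fill (H.subst x t))) :
    ValidUpTo (N + (C.fill (H.subst x t)).code.length) (C.fill (.quant C.positive x H)) := by
  suffices h : ∃ d ≤ (C.fill (H.subst x t)).code.length,
      ValidUpTo (N + d) (C.fill (.quant C.positive x H)) by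
    obtain ⟨d, hd, h⟩ := h
    have := h.add ((C.fill (H.subst x t)).code.length - d)
    rwa [show N + d + ((C.fill (H.subst x t)).code.length - d) =
      N + (C.fill (H.subst x t)).code.length by omega] at this
  by_cases hx : x ∈ H.freeVars
  · exact ⟨termHeight t, (Formula.termHeight_le_length_code_subst hx).trans
      (Formula.length_code_le_fill _ _), hv.gamma hC ht⟩
  -- If `x` is not free in `H`, then `t` need not occur in the premise and may be arbitrarily high.
  -- But the same premise results from any variable, which has height one.
  · obtain ⟨z, hz⟩ := Infinite.exists_notMem_finset H.boundVars.toFinset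
    rw [Formula.subst_of_notMem hx, ← Formula.subst_of_notMem (t := Term.var z) hx] at hv
    refine ⟨1, (Formula.code_ne_nil _), hv.gamma (t := Term.var z) hC ?_⟩
    simpa [Term.varFinset] using hz

theorem ValidUpTo.step {N : ℕ} {P Q : Formula L} (hv : ValidUpTo N P) (h : Step P Q) :
    ValidUpTo (N + P.code.length) Q := by
  cases h with
  | simplificationOr C H H' hC hH =>
    exact (hv.of_entails fun _ _ _ _ _ => hC ▸ entails_simplification hH).add _
  | simplificationAnd C H H' hC hH =>
    exact (hv.of_entails fun _ _ _ _ _ => hC ▸ entails_simplification hH).add _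
  | gammaEx C x H t hC hp ht =>
    have := hv.gamma_length hC ht
    rwa [hp] at this
  | gammaAll C x H t hC hp ht =>
    have := hv.gamma_length hC ht
    rwa [hp] at this
  | deltaAll C y H hC hp hy =>
    have := hv.delta hC hy
    rw [hp] at this
    exact this.add _
  | deltaEx C y H hC hp hy =>
    have := hv.delta hC hy
    rw [hp] at this
    exact this.add _
  | rename h =>
    exact (hv.of_entails (C := .hole) fun _ _ _ _ _ => entails_of_variant h).add _

theorem ValidUpTo.derivation {D : List (Formula L)} {N : ℕ} {A B : Formula L}
    (hv : ValidUpTo N B) (h : IsDerivation D B A) :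
    ValidUpTo (N + (D.map Formula.code).flatten.length) A := by
  induction D generalizing N B with
  | nil => simp [IsDerivation] at h
  | cons P D ih =>
    obtain ⟨h₁, h₂, h₃⟩ := h
    obtain rfl : P = B := by simpa using h₁
    cases D with
    | nil =>
      obtain rfl : P = A := by simpa using h₂
      exact hv.add _
    | cons Q D =>
      rw [List.isChain_cons_cons] at h₃
      have := ih (hv.step h₃.1) ⟨rfl, by simpa using h₂, h₃.2⟩
      rwa [List.map_cons, List.flatten_cons, List.length_append, ← add_assoc]

end Herbrand

/-! ### From validity to Property C: expansions, Skolemized forms, and the term model. -/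

namespace Herbrand

open FirstOrder Language Function

variable {L : FirstOrder.Language.{u, v}}

/-! ### Expansions and truth -/

section Expansion

variable {L' : FirstOrder.Language.{u, v}}

/-- The truth of a formula in the term model with valuation `w`, where all quantifiers range over
the set `T` of terms. -/
def TruthOver (w : ∀ k, L'.Relations k → (Fin k → L'.Term ℕ) → Prop) (T : Set (L'.Term ℕ)) :
    (ℕ → L'.Term ℕ) → Formula L' → Prop
  | e, .atom R ts => w _ R fun i => (ts i).subst e
  | e, .neg A => ¬ TruthOver w T e A
  | e, .or A B => TruthOver w T e A ∨ TruthOver w T e B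
  | e, .and A B => TruthOver w T e A ∧ TruthOver w T e B
  | e, .ex x A => ∃ t ∈ T, TruthOver w T (update e x t) A
  | e, .all x A => ∀ t ∈ T, TruthOver w T (update e x t) A

variable {w : ∀ k, L'.Relations k → (Fin k → L'.Term ℕ) → Prop} {T : Set (L'.Term ℕ)}

theorem truthOver_conn (b : Bool) (e : ℕ → L'.Term ℕ) (A B : Formula L') :
    TruthOver w T e (.conn b A B) ↔
      if b then TruthOver w T e A ∨ TruthOver w T e B
      else TruthOver w T e A ∧ TruthOver w T e B := by
  cases b <;> simp [Formula.conn, TruthOver]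

theorem truthOver_quant (b : Bool) (e : ℕ → L'.Term ℕ) (x : ℕ) (A : Formula L') :
    TruthOver w T e (.quant b x A) ↔
      if b then ∃ t ∈ T, TruthOver w T (update e x t) A
      else ∀ t ∈ T, TruthOver w T (update e x t) A := by
  cases b <;> simp [Formula.quant, TruthOver]

theorem subst_update_var (e : ℕ → L'.Term ℕ) (x : ℕ) (s : L'.Term ℕ) :
    (fun z => (update Term.var x s z).subst e) = update e x (s.subst e) := by
  funext z
  by_cases hzx : z = x
  · simp [hzx]
  · simp [hzx, Term.subst]

theorem truthOver_subst {e : ℕ → L'.Term ℕ} {x : ℕ} {s : L'.Term ℕ} {A : Formula L'}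
    (hs : ∀ z ∈ s.varFinset, z ∉ A.boundVars) :
    TruthOver w T e (A.subst x s) ↔ TruthOver w T (update e x (s.subst e)) A := by
  induction A using Formula.induct generalizing e with
  | atom R ts => simp only [Formula.subst, TruthOver, termSubst, subst_subst, subst_update_var]
  | neg A ih => simp only [Formula.subst, TruthOver, ih hs]
  | conn b A B ihA ihB =>
    simp only [Formula.boundVars_conn, List.mem_append, not_or] at hs
    rw [Formula.subst_conn, truthOver_conn, truthOver_conn, ihA fun z hz => (hs z hz).1,
      ihB fun z hz => (hs z hz).2]
  | quant b y A ih =>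
    simp only [Formula.boundVars_quant, List.mem_cons, not_or] at hs
    rw [Formula.subst_quant]
    split_ifs with hyx
    · subst hyx
      simp only [truthOver_quant, update_idem]
    · have key : ∀ t, TruthOver w T (update e y t) (A.subst x s) ↔
          TruthOver w T (update (update e x (s.subst e)) y t) A := by
        intro t
        rw [ih fun z hz => (hs z hz).2, update_comm hyx,
          subst_congr (τ := update e y t) (τ' := e) fun z hz => update_of_ne (hs z hz).1 _ _]
      simp only [truthOver_quant, key]

theorem Formula.quantifierFree_bigOr {A : Formula L'} {l : List (Formula L')}
    (h : ∀ B ∈ A :: l, B.QuantifierFree) : (bigOr A l).QuantifierFree := by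
  induction l generalizing A with
  | nil => exact h A (by simp)
  | cons B l ih => exact ⟨h A (by simp), ih fun C hC => h C (by simp at hC ⊢; tauto)⟩

theorem Formula.quantifierFree_bigAnd {A : Formula L'} {l : List (Formula L')}
    (h : ∀ B ∈ A :: l, B.QuantifierFree) : (bigAnd A l).QuantifierFree := by
  induction l generalizing A with
  | nil => exact h A (by simp)
  | cons B l ih => exact ⟨h A (by simp), ih fun C hC => h C (by simp at hC ⊢; tauto)⟩

theorem Formula.QuantifierFree.subst {A : Formula L'} (h : A.QuantifierFree) (x : ℕ)
    (t : L'.Term ℕ) : (A.subst x t).QuantifierFree := by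
  induction A with
  | atom R ts => trivial
  | neg A ih => exact ih h
  | or A B ihA ihB => exact ⟨ihA h.1, ihB h.2⟩
  | and A B ihA ihB => exact ⟨ihA h.1, ihB h.2⟩
  | ex x A ih => exact h.elim
  | all x A ih => exact h.elim

theorem Formula.QuantifierFree.truth_iff {A : Formula L'} (h : A.QuantifierFree)
    (w : ∀ k, L'.Relations k → (Fin k → L'.Term ℕ) → Prop) (T : Set (L'.Term ℕ)) :
    A.Truth w ↔ TruthOver w T Term.var A := by
  induction A with
  | atom R ts => simp only [Truth, TruthOver, subst_var]
  | neg A ih => exact not_congr (ih h)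
  | or A B ihA ihB => exact or_congr (ihA h.1) (ihB h.2)
  | and A B ihA ihB => exact and_congr (ihA h.1) (ihB h.2)
  | ex x A ih => exact h.elim
  | all x A ih => exact h.elim

theorem Formula.QuantifierFree.boundVars {A : Formula L'} (h : A.QuantifierFree) :
    A.boundVars = [] := by
  induction A with
  | atom R ts => rfl
  | neg A ih => exact ih h
  | or A B ihA ihB => simp [Formula.boundVars, ihA h.1, ihB h.2]
  | and A B ihA ihB => simp [Formula.boundVars, ihA h.1, ihB h.2]
  | ex x A ih => exact h.elim
  | all x A ih => exact h.elim

theorem truthOver_bigOr {e : ℕ → L'.Term ℕ} (A : Formula L') (l : List (Formula L')) :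
    TruthOver w T e (.bigOr A l) ↔ ∃ B ∈ A :: l, TruthOver w T e B := by
  induction l generalizing A with
  | nil => simp [Formula.bigOr]
  | cons B l ih => simp [Formula.bigOr, TruthOver, ih]

theorem truthOver_bigAnd {e : ℕ → L'.Term ℕ} (A : Formula L') (l : List (Formula L')) :
    TruthOver w T e (.bigAnd A l) ↔ ∀ B ∈ A :: l, TruthOver w T e B := by
  induction l generalizing A with
  | nil => simp [Formula.bigAnd]
  | cons B l ih => simp [Formula.bigAnd, TruthOver, ih]

namespace Formula.IsExpansion

theorem quantifierFree {F B : Formula L'} (h : IsExpansion T F B) : B.QuantifierFree := by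
  induction h with
  | atom R ts => trivial
  | neg _ ih => exact ih
  | or _ _ ih ih' => exact ⟨ih, ih'⟩
  | and _ _ ih ih' => exact ⟨ih, ih'⟩
  | ex x t₀ l _ _ _ ih =>
    refine quantifierFree_bigOr fun B hB => ?_
    simp only [List.mem_cons, List.mem_map] at hB
    rcases hB with rfl | ⟨t, _, rfl⟩ <;> exact ih.subst _ _
  | all x t₀ l _ _ _ ih =>
    refine quantifierFree_bigAnd fun B hB => ?_
    simp only [List.mem_cons, List.mem_map] at hB
    rcases hB with rfl | ⟨t, _, rfl⟩ <;> exact ih.subst _ _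

/-- An instance `B.subst x t` amounts to updating `x` with `t.subst e`, and this is `t` itself
because `e` fixes the variables of `t`. That they are not bound in `F` keeps them fixed under the
updates made by the quantifiers. -/
theorem truthOver_iff {F B : Formula L'} (h : IsExpansion T F B) {e : ℕ → L'.Term ℕ}
    (hT : ∀ t ∈ T, ∀ z ∈ t.varFinset, z ∉ F.boundVars ∧ e z = Term.var z) :
    TruthOver w T e B ↔ TruthOver w T e F := by
  have inst : ∀ {A B : Formula L'} {x : ℕ}, IsExpansion T A B →
      (∀ {e : ℕ → L'.Term ℕ}, (∀ t ∈ T, ∀ z ∈ t.varFinset, z ∉ A.boundVars ∧ e z = Term.var z) →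
        (TruthOver w T e B ↔ TruthOver w T e A)) → ∀ {e : ℕ → L'.Term ℕ},
      (∀ t ∈ T, ∀ z ∈ t.varFinset, z ∉ x :: A.boundVars ∧ e z = Term.var z) → ∀ t ∈ T,
      (TruthOver w T e (B.subst x t) ↔ TruthOver w T (update e x t) A) := by
    intro A B x hAB ih e hT t ht
    rw [truthOver_subst (by simp [hAB.quantifierFree.boundVars]),
      subst_eq_self fun z hz => (hT t ht z hz).2, ih]
    intro s hs z hz
    have := hT s hs z hz
    simp only [List.mem_cons, not_or] at this
    exact ⟨this.1.2, by rw [update_of_ne this.1.1, this.2]⟩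
  induction h generalizing e with
  | atom R ts => rfl
  | neg _ ih => exact not_congr (ih hT)
  | or _ _ ih ih' =>
    simp only [Formula.boundVars, List.mem_append, not_or] at hT
    exact or_congr (ih fun t ht z hz => ⟨(hT t ht z hz).1.1, (hT t ht z hz).2⟩)
      (ih' fun t ht z hz => ⟨(hT t ht z hz).1.2, (hT t ht z hz).2⟩)
  | and _ _ ih ih' =>
    simp only [Formula.boundVars, List.mem_append, not_or] at hT
    exact and_congr (ih fun t ht z hz => ⟨(hT t ht z hz).1.1, (hT t ht z hz).2⟩)
      (ih' fun t ht z hz => ⟨(hT t ht z hz).1.2, (hT t ht z hz).2⟩)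
  | @ex A B x t₀ l _ hl hAB ih =>
    have mem : ∀ C, C ∈ B.subst x t₀ :: (l.map fun t => B.subst x t) ↔
        ∃ t, t ∈ T ∧ B.subst x t = C := fun C => by
      rw [← List.map_cons (f := fun t => B.subst x t) (a := t₀) (l := l)]
      simp only [List.mem_map, hl]
    rw [truthOver_bigOr]
    simp only [mem]
    constructor
    · rintro ⟨_, ⟨t, ht, rfl⟩, h⟩
      exact ⟨t, ht, (inst hAB ih hT t ht).1 h⟩
    · rintro ⟨t, ht, h⟩
      exact ⟨_, ⟨t, ht, rfl⟩, (inst hAB ih hT t ht).2 h⟩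
  | @all A B x t₀ l _ hl hAB ih =>
    have mem : ∀ C, C ∈ B.subst x t₀ :: (l.map fun t => B.subst x t) ↔
        ∃ t, t ∈ T ∧ B.subst x t = C := fun C => by
      rw [← List.map_cons (f := fun t => B.subst x t) (a := t₀) (l := l)]
      simp only [List.mem_map, hl]
    rw [truthOver_bigAnd]
    simp only [mem]
    constructor
    · exact fun h t ht => (inst hAB ih hT t ht).1 (h _ ⟨t, ht, rfl⟩)
    · rintro h _ ⟨t, ht, rfl⟩
      exact (inst hAB ih hT t ht).2 (h t ht)

end Formula.IsExpansion

/-- One enumeration of `T` serves for all quantifiers. Nonemptiness provides its first element,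
without which quantifiers have no expansion. -/
theorem Formula.exists_isExpansion (hT : T.Finite) (hne : T.Nonempty) (F : Formula L') :
    ∃ B, IsExpansion T F B := by
  classical
  obtain ⟨t₀, l, hnd, hl⟩ : ∃ t₀ l, (t₀ :: l).Nodup ∧ ∀ t, t ∈ t₀ :: l ↔ t ∈ T := by
    rcases h : hT.toFinset.toList with _ | ⟨t₀, l⟩
    · obtain ⟨t, ht⟩ := hne
      have : t ∈ hT.toFinset.toList := by simpa using ht
      simp [h] at this
    · exact ⟨t₀, l, h ▸ Finset.nodup_toList _, fun t => by rw [← h]; simp⟩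
  induction F with
  | atom R ts => exact ⟨_, .atom R ts⟩
  | neg A ih =>
    obtain ⟨B, h⟩ := ih
    exact ⟨_, .neg h⟩
  | or A B ihA ihB =>
    obtain ⟨A', h⟩ := ihA
    obtain ⟨B', h'⟩ := ihB
    exact ⟨_, .or h h'⟩
  | and A B ihA ihB =>
    obtain ⟨A', h⟩ := ihA
    obtain ⟨B', h'⟩ := ihB
    exact ⟨_, .and h h'⟩
  | ex x A ih =>
    obtain ⟨B, h⟩ := ih
    exact ⟨_, .ex x t₀ l hnd hl h⟩
  | all x A ih =>
    obtain ⟨B, h⟩ := ih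
    exact ⟨_, .all x t₀ l hnd hl h⟩

/-! ### Finiteness of sets of terms of bounded height -/

theorem finite_termFuncs (t : L'.Term ℕ) : (termFuncs t).Finite := by
  induction t with
  | var z => exact Set.finite_empty
  | func f ts ih => exact (Set.finite_singleton _).union (Set.finite_iUnion ih)

theorem Formula.finite_funcs (A : Formula L') : A.funcs.Finite := by
  induction A with
  | atom R ts => exact Set.finite_iUnion fun i => finite_termFuncs _
  | neg A ih => exact ih
  | or A B ihA ihB => exact ihA.union ihB
  | and A B ihA ihB => exact ihA.union ihB
  | ex x A ih => exact ih
  | all x A ih => exact ih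

theorem height_arg_lt {k : ℕ} (f : L'.Functions k) (ts : Fin k → L'.Term ℕ) (i : Fin k) :
    termHeight (ts i) < termHeight (Term.func f ts) := by
  have := Finset.le_sup (f := fun i => termHeight (ts i)) (Finset.mem_univ i)
  simp only [termHeight]
  omega

theorem one_le_termHeight (t : L'.Term ℕ) : 1 ≤ termHeight t := by
  cases t <;> simp [termHeight]

/-- Induction on the height: a term is a variable from `V`, or a symbol from `Φ` applied to one of
finitely many tuples of lower terms. -/
theorem finite_terms (V : Finset ℕ) {Φ : Set (Σ n, L'.Functions n)} (hΦ : Φ.Finite) (n : ℕ) :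
    {t : L'.Term ℕ | termHeight t < n ∧ t.varFinset ⊆ V ∧ termFuncs t ⊆ Φ}.Finite := by
  induction n with
  | zero => simp
  | succ n ih =>
    refine ((V.finite_toSet.image Term.var).union
      (hΦ.biUnion fun f _ => (Set.Finite.pi' fun _ : Fin f.1 => ih).image (Term.func f.2))).subset
      ?_
    rintro (z | ⟨f, ts⟩) ⟨h₁, h₂, h₃⟩
    · exact .inl ⟨z, h₂ (by simp [Term.varFinset]), rfl⟩
    · refine .inr (Set.mem_biUnion (x := ⟨_, f⟩) (h₃ (.inl rfl)) ⟨ts, fun i => ?_, rfl⟩)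
      exact ⟨(height_arg_lt f ts i).trans_le (Nat.le_of_lt_succ h₁),
        fun z hz => h₂ ((mem_varFinset_func f ts z).2 ⟨i, hz⟩),
        fun g hg => h₃ (.inr (Set.mem_iUnion.2 ⟨i, hg⟩))⟩

end Expansion

theorem finite_champFini (n : ℕ) (F : Formula (Ext L)) : (champFini n F).Finite := by
  refine (finite_terms F.freeVars (F.finite_funcs.union (Set.finite_singleton bulletSymbol))
    n).subset ?_
  rintro t ⟨h₁, h₂, h₃⟩
  exact ⟨h₁, h₂, fun f hf => (h₃ f hf).imp id And.left⟩

/-! ### The outer Skolemized form -/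

/-- The abbreviation for terms over the extended language. -/
abbrev ExtTerm (L : FirstOrder.Language.{u, v}) := (Ext L).Term ℕ

/-- The embedding of terms into the terms over the extended language. -/
abbrev liftTerm (t : L.Term ℕ) : ExtTerm L := LHom.sumInl.onTerm t

/-- The Skolem term for `y` with arbitrary arguments. -/
def skolemApp (y : ℕ) (l : List (ExtTerm L)) : ExtTerm L :=
  Term.func (Sum.inr (NewSymbol.skolem y l.length) : (Ext L).Functions l.length) l.get

theorem skolemApp_eq_func (y : ℕ) {n : ℕ} (l : List (ExtTerm L)) (h : l.length = n) :
    skolemApp y l = Term.func (Sum.inr (NewSymbol.skolem y n) : (Ext L).Functions n)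
      fun i => l.get (i.cast h.symm) := by
  subst h
  rfl

theorem skolemTerm_subst (y : ℕ) (xs : List ℕ) (e : ℕ → ExtTerm L) :
    (skolemTerm y xs).subst e = skolemApp y (xs.map e) := by
  rw [skolemApp_eq_func y (n := xs.length) _ (by simp)]
  simp [skolemTerm, Term.subst]

theorem mem_termHeight_skolemApp {y : ℕ} {l : List (ExtTerm L)} {t : ExtTerm L} (h : t ∈ l) :
    termHeight t < termHeight (skolemApp y l) := by
  obtain ⟨i, rfl⟩ := List.mem_iff_get.1 h
  exact height_arg_lt _ _ _

section Skolemize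

variable (pos : Bool) (xs : List ℕ) (b : Bool) (x y : ℕ) (A B : Formula L)

theorem skolemizeAux_conn : (Formula.conn b A B).skolemizeAux pos xs =
    .conn b (A.skolemizeAux pos xs) (B.skolemizeAux pos xs) := by
  cases b <;> simp [Formula.conn, Formula.skolemizeAux]

theorem skolemizeAux_gamma : (Formula.quant pos x A).skolemizeAux pos xs =
    .quant pos x (A.skolemizeAux pos (xs ++ [x])) := by
  cases pos <;> simp [Formula.quant, Formula.skolemizeAux]

theorem skolemizeAux_delta : (Formula.quant (!pos) y A).skolemizeAux pos xs =
    (A.skolemizeAux pos xs).subst y (skolemTerm y xs) := by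
  cases pos <;> simp [Formula.quant, Formula.skolemizeAux]

end Skolemize

theorem mem_boundVars_skolemizeAux {pos : Bool} {xs : List ℕ} {A : Formula L} {z : ℕ}
    (h : z ∈ (A.skolemizeAux pos xs).boundVars) : z ∈ A.boundVars := by
  induction A using Formula.induct generalizing pos xs with
  | atom R ts => simp [Formula.skolemizeAux, Formula.boundVars] at h
  | neg A ih =>
    rw [Formula.skolemizeAux] at h
    exact ih h
  | conn b A B ihA ihB =>
    rw [skolemizeAux_conn] at h
    simp only [Formula.boundVars_conn, List.mem_append] at h ⊢
    exact h.imp ihA ihB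
  | quant b x A ih =>
    rcases Formula.quant_cases b pos with rfl | rfl
    · rw [skolemizeAux_gamma] at h
      simp only [Formula.boundVars_quant, List.mem_cons] at h ⊢
      exact h.imp_right ih
    · rw [skolemizeAux_delta, Formula.boundVars_subst] at h
      simp only [Formula.boundVars_quant, List.mem_cons]
      exact .inr (ih h)

theorem varFinset_liftTerm (t : L.Term ℕ) : (liftTerm t).varFinset = t.varFinset := by
  induction t with
  | var z => rfl
  | func f ts ih =>
    ext z
    simp only [mem_varFinset_func, LHom.onTerm, ih]

theorem mem_varFinset_skolemTerm {y z : ℕ} {xs : List ℕ} :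
    z ∈ (skolemTerm (L := L) y xs).varFinset ↔ z ∈ xs := by
  simp [skolemTerm, Term.varFinset, List.mem_iff_get, eq_comm]

theorem Formula.mem_freeVars_of_subst {L' : FirstOrder.Language.{u, v}} {x : ℕ}
    {t : L'.Term ℕ} {A : Formula L'} {z : ℕ} (h : z ∈ (A.subst x t).freeVars) :
    (z ∈ A.freeVars ∧ z ≠ x) ∨ z ∈ t.varFinset := by
  induction A using Formula.induct with
  | atom R ts =>
    simp only [subst, freeVars, Finset.mem_biUnion, Finset.mem_univ, true_and, termSubst,
      mem_varFinset_subst] at h ⊢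
    obtain ⟨i, y, hy, hz⟩ := h
    by_cases hyx : y = x
    · subst hyx
      rw [update_self] at hz
      exact .inr hz
    · rw [update_of_ne hyx] at hz
      simp only [Term.varFinset, Finset.mem_singleton] at hz
      subst hz
      exact .inl ⟨⟨i, hy⟩, hyx⟩
  | neg A ih => exact ih h
  | conn b A B ihA ihB =>
    simp only [subst_conn, freeVars_conn, Finset.mem_union] at h ⊢
    tauto
  | quant b y A ih =>
    rw [subst_quant] at h
    split_ifs at h with hyx
    · simp only [freeVars_quant, Finset.mem_erase] at h ⊢
      exact .inl ⟨h, hyx ▸ h.1⟩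
    · simp only [freeVars_quant, Finset.mem_erase] at h ⊢
      have := ih h.2
      tauto

theorem Formula.mem_freeVars_subst {L' : FirstOrder.Language.{u, v}} {x : ℕ}
    {t : L'.Term ℕ} {A : Formula L'} {z : ℕ} (h : z ∈ A.freeVars) (hz : z ≠ x) :
    z ∈ (A.subst x t).freeVars := by
  induction A using Formula.induct with
  | atom R ts =>
    simp only [subst, freeVars, Finset.mem_biUnion, Finset.mem_univ, true_and, termSubst,
      mem_varFinset_subst] at h ⊢
    obtain ⟨i, hi⟩ := h
    exact ⟨i, z, hi, by simp [update_of_ne hz, Term.varFinset]⟩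
  | neg A ih => exact ih h
  | conn b A B ihA ihB =>
    simp only [subst_conn, freeVars_conn, Finset.mem_union] at h ⊢
    exact h.imp ihA ihB
  | quant b y A ih =>
    rw [subst_quant]
    split_ifs
    · exact h
    · simp only [freeVars_quant, Finset.mem_erase] at h ⊢
      exact ⟨h.1, ih h.2⟩

theorem mem_termFuncs_subst_left {L' : FirstOrder.Language.{u, v}} {τ : ℕ → L'.Term ℕ}
    {s : L'.Term ℕ} {f : Σ n, L'.Functions n} (h : f ∈ termFuncs s) :
    f ∈ termFuncs (s.subst τ) := by
  induction s with
  | var z => simp [termFuncs] at h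
  | func g ts ih =>
    rcases h with h | h
    · exact .inl h
    · obtain ⟨i, hi⟩ := Set.mem_iUnion.1 h
      exact .inr (Set.mem_iUnion.2 ⟨i, ih i hi⟩)

theorem mem_termFuncs_subst_right {L' : FirstOrder.Language.{u, v}} {τ : ℕ → L'.Term ℕ}
    {s : L'.Term ℕ} {z : ℕ} (hz : z ∈ s.varFinset) {f : Σ n, L'.Functions n}
    (h : f ∈ termFuncs (τ z)) : f ∈ termFuncs (s.subst τ) := by
  induction s with
  | var y =>
    simp only [Term.varFinset, Finset.mem_singleton] at hz
    exact hz ▸ h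
  | func g ts ih =>
    obtain ⟨i, hi⟩ := (mem_varFinset_func g ts z).1 hz
    exact .inr (Set.mem_iUnion.2 ⟨i, ih i hi⟩)

theorem Formula.funcs_subset_subst {L' : FirstOrder.Language.{u, v}} (x : ℕ)
    (t : L'.Term ℕ) (A : Formula L') : A.funcs ⊆ (A.subst x t).funcs := by
  induction A using Formula.induct with
  | atom R ts =>
    intro f hf
    obtain ⟨i, hi⟩ := Set.mem_iUnion.1 hf
    exact Set.mem_iUnion.2 ⟨i, mem_termFuncs_subst_left hi⟩
  | neg A ih => exact ih
  | conn b A B ihA ihB => simpa using Set.union_subset_union ihA ihB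
  | quant b y A ih =>
    rw [subst_quant]
    split_ifs
    · rfl
    · simpa using ih

theorem Formula.termFuncs_subset_subst {L' : FirstOrder.Language.{u, v}} {x : ℕ}
    {t : L'.Term ℕ} {A : Formula L'} (hx : x ∈ A.freeVars) :
    termFuncs t ⊆ (A.subst x t).funcs := by
  induction A using Formula.induct with
  | atom R ts =>
    intro f hf
    obtain ⟨i, hi⟩ : ∃ i, x ∈ (ts i).varFinset := by simpa [freeVars] using hx
    exact Set.mem_iUnion.2 ⟨i, mem_termFuncs_subst_right hi (by rwa [update_self])⟩
  | neg A ih => exact ih hx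
  | conn b A B ihA ihB =>
    simp only [freeVars_conn, Finset.mem_union] at hx
    simp only [subst_conn, funcs_conn]
    rcases hx with hx | hx
    · exact (ihA hx).trans Set.subset_union_left
    · exact (ihB hx).trans Set.subset_union_right
  | quant b y A ih =>
    simp only [freeVars_quant, Finset.mem_erase] at hx
    simpa [Ne.symm hx.1] using ih hx.2

/-- A Skolem term contributes only variables of outer γ-quantifiers. For empty `xs` it follows that
the terms of the champ fini contain only free variables of the original formula. -/
theorem mem_freeVars_of_skolemizeAux {pos : Bool} {xs : List ℕ} {A : Formula L} {z : ℕ}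
    (h : z ∈ (A.skolemizeAux pos xs).freeVars) : z ∈ A.freeVars ∨ z ∈ xs := by
  induction A using Formula.induct generalizing pos xs with
  | atom R ts =>
    simp only [Formula.skolemizeAux, Formula.freeVars, Finset.mem_biUnion] at h ⊢
    obtain ⟨i, hi, hz⟩ := h
    exact .inl ⟨i, hi, by rwa [← varFinset_liftTerm]⟩
  | neg A ih =>
    rw [Formula.skolemizeAux] at h
    exact ih h
  | conn b A B ihA ihB =>
    rw [skolemizeAux_conn] at h
    simp only [Formula.freeVars_conn, Finset.mem_union] at h ⊢
    rcases h with h | h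
    · exact (ihA h).imp .inl id
    · exact (ihB h).imp .inr id
  | quant b x A ih =>
    rcases Formula.quant_cases b pos with rfl | rfl
    · rw [skolemizeAux_gamma] at h
      simp only [Formula.freeVars_quant, Finset.mem_erase] at h ⊢
      have := ih h.2
      simp only [List.mem_append, List.mem_singleton] at this
      tauto
    · rw [skolemizeAux_delta] at h
      simp only [Formula.freeVars_quant, Finset.mem_erase]
      rcases Formula.mem_freeVars_of_subst h with ⟨h, hx⟩ | h
      · exact (ih h).imp (fun h => ⟨hx, h⟩) id
      · exact .inr (mem_varFinset_skolemTerm.1 h)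

theorem mem_freeVars_skolemizeAux {pos : Bool} {xs : List ℕ} {A : Formula L} {z : ℕ}
    (h : z ∈ A.freeVars) : z ∈ (A.skolemizeAux pos xs).freeVars := by
  induction A using Formula.induct generalizing pos xs with
  | atom R ts =>
    simp only [Formula.skolemizeAux, Formula.freeVars, Finset.mem_biUnion] at h ⊢
    obtain ⟨i, hi, hz⟩ := h
    exact ⟨i, hi, by rwa [varFinset_liftTerm]⟩
  | neg A ih =>
    rw [Formula.skolemizeAux]
    exact ih h
  | conn b A B ihA ihB =>
    rw [skolemizeAux_conn]
    simp only [Formula.freeVars_conn, Finset.mem_union] at h ⊢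
    exact h.imp ihA ihB
  | quant b x A ih =>
    simp only [Formula.freeVars_quant, Finset.mem_erase] at h
    rcases Formula.quant_cases b pos with rfl | rfl
    · rw [skolemizeAux_gamma]
      simp only [Formula.freeVars_quant, Finset.mem_erase]
      exact ⟨h.1, ih h.2⟩
    · rw [skolemizeAux_delta]
      exact Formula.mem_freeVars_subst (ih h.2) h.1

theorem termFuncs_liftTerm {t : L.Term ℕ} {k : ℕ} {f : L.Functions k}
    (h : ⟨k, f⟩ ∈ termFuncs t) : ⟨k, (Sum.inl f : (Ext L).Functions k)⟩ ∈ termFuncs (liftTerm t) := by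
  induction t with
  | var z => simp [termFuncs] at h
  | func g ts ih =>
    rcases h with h | h
    · refine .inl ?_
      obtain ⟨rfl, h⟩ := Sigma.mk.inj h
      obtain rfl := eq_of_heq h
      rfl
    · obtain ⟨i, hi⟩ := Set.mem_iUnion.1 h
      exact .inr (Set.mem_iUnion.2 ⟨i, ih i hi⟩)

theorem mem_funcs_skolemizeAux {pos : Bool} {xs : List ℕ} {A : Formula L} {k : ℕ}
    {f : L.Functions k} (h : ⟨k, f⟩ ∈ A.funcs) :
    ⟨k, (Sum.inl f : (Ext L).Functions k)⟩ ∈ (A.skolemizeAux pos xs).funcs := by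
  induction A using Formula.induct generalizing pos xs with
  | atom R ts =>
    obtain ⟨i, hi⟩ := Set.mem_iUnion.1 h
    rw [Formula.skolemizeAux]
    exact Set.mem_iUnion.2 ⟨i, termFuncs_liftTerm hi⟩
  | neg A ih =>
    rw [Formula.skolemizeAux]
    exact ih h
  | conn b A B ihA ihB =>
    rw [skolemizeAux_conn]
    simp only [Formula.funcs_conn] at h ⊢
    exact h.imp ihA ihB
  | quant b x A ih =>
    simp only [Formula.funcs_quant] at h
    rcases Formula.quant_cases b pos with rfl | rfl
    · rw [skolemizeAux_gamma]
      simpa using ih h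
    · rw [skolemizeAux_delta]
      exact Formula.funcs_subset_subst _ _ _ (ih h)

/-! ### Truth of the Skolemized form, read off from the formula itself -/

/-- The truth of the outer Skolemized form of an occurrence of polarity `pos` of a formula, where
the γ-quantifiers range over `T` and the outer γ-quantifiers have the values `as`. -/
def SkolemTruth (w : ∀ k, (Ext L).Relations k → (Fin k → ExtTerm L) → Prop)
    (T : Set (ExtTerm L)) :
    Bool → List (ExtTerm L) → (ℕ → ExtTerm L) → Formula L → Prop
  | _, _, σ, .atom R ts => w _ (Sum.inl R) fun i => (liftTerm (ts i)).subst σ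
  | pos, as, σ, .neg A => ¬ SkolemTruth w T (!pos) as σ A
  | pos, as, σ, .or A B => SkolemTruth w T pos as σ A ∨ SkolemTruth w T pos as σ B
  | pos, as, σ, .and A B => SkolemTruth w T pos as σ A ∧ SkolemTruth w T pos as σ B
  | true, as, σ, .ex x A => ∃ t ∈ T, SkolemTruth w T true (as ++ [t]) (update σ x t) A
  | false, as, σ, .all x A => ∀ t ∈ T, SkolemTruth w T false (as ++ [t]) (update σ x t) A
  | false, as, σ, .ex y A => SkolemTruth w T false as (update σ y (skolemApp y as)) A
  | true, as, σ, .all y A => SkolemTruth w T true as (update σ y (skolemApp y as)) A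

variable {w : ∀ k, (Ext L).Relations k → (Fin k → ExtTerm L) → Prop} {T : Set (ExtTerm L)}

theorem skolemTruth_conn (b pos : Bool) (as : List (ExtTerm L)) (σ : ℕ → ExtTerm L)
    (A B : Formula L) : SkolemTruth w T pos as σ (.conn b A B) ↔
      if b then SkolemTruth w T pos as σ A ∨ SkolemTruth w T pos as σ B
      else SkolemTruth w T pos as σ A ∧ SkolemTruth w T pos as σ B := by
  cases b <;> simp [Formula.conn, SkolemTruth]

theorem skolemTruth_gamma (pos : Bool) (as : List (ExtTerm L)) (σ : ℕ → ExtTerm L) (x : ℕ)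
    (A : Formula L) : SkolemTruth w T pos as σ (.quant pos x A) ↔
      if pos then ∃ t ∈ T, SkolemTruth w T pos (as ++ [t]) (update σ x t) A
      else ∀ t ∈ T, SkolemTruth w T pos (as ++ [t]) (update σ x t) A := by
  cases pos <;> simp [Formula.quant, SkolemTruth]

theorem skolemTruth_delta (pos : Bool) (as : List (ExtTerm L)) (σ : ℕ → ExtTerm L) (y : ℕ)
    (A : Formula L) : SkolemTruth w T pos as σ (.quant (!pos) y A) ↔
      SkolemTruth w T pos as (update σ y (skolemApp y as)) A := by
  cases pos <;> simp [Formula.quant, SkolemTruth]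

theorem map_update_of_notMem {α : Type*} {x : ℕ} {xs : List ℕ} (hx : x ∉ xs) (e : ℕ → α) (a : α) :
    xs.map (update e x a) = xs.map e :=
  List.map_congr_left fun z hz => update_of_ne (by rintro rfl; exact hx hz) _ _

/-- An inner bound variable differs from all variables in `xs`, so updates at inner quantifiers
preserve the values of `xs`, and the Skolem term for `y` evaluates to the Skolem function applied to
the values of the outer γ-quantifiers. This is why the bound variables must be distinct. -/
theorem truthOver_skolemizeAux {pos : Bool} {xs : List ℕ} {e : ℕ → ExtTerm L} {A : Formula L}
    (hxs : ∀ x ∈ xs, x ∉ A.boundVars) (hA : A.boundVars.Nodup) :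
    TruthOver w T e (A.skolemizeAux pos xs) ↔ SkolemTruth w T pos (xs.map e) e A := by
  induction A using Formula.induct generalizing pos xs e with
  | atom R ts => simp only [Formula.skolemizeAux, TruthOver, SkolemTruth]
  | neg A ih => simp only [Formula.skolemizeAux, TruthOver, SkolemTruth, ih hxs hA]
  | conn b A B ihA ihB =>
    simp only [Formula.boundVars_conn, List.mem_append, not_or] at hxs hA
    rw [skolemizeAux_conn, truthOver_conn, skolemTruth_conn,
      ihA (fun x hx => (hxs x hx).1) hA.of_append_left,
      ihB (fun x hx => (hxs x hx).2) hA.of_append_right]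
  | quant b x A ih =>
    simp only [Formula.boundVars_quant, List.mem_cons, not_or, List.nodup_cons] at hxs hA
    have hx : x ∉ xs := fun h => (hxs x h).1 rfl
    rcases Formula.quant_cases b pos with rfl | rfl
    · have key : ∀ t, TruthOver w T (update e x t) (A.skolemizeAux b (xs ++ [x])) ↔
          SkolemTruth w T b (xs.map e ++ [t]) (update e x t) A := by
        intro t
        rw [ih ?_ hA.2, List.map_append, map_update_of_notMem hx]
        · simp
        · intro z hz
          rw [List.mem_append, List.mem_singleton] at hz
          rcases hz with hz | rfl
          exacts [(hxs z hz).2, hA.1]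
      rw [skolemizeAux_gamma, truthOver_quant, skolemTruth_gamma]
      simp only [key]
    · rw [skolemizeAux_delta, skolemTruth_delta, truthOver_subst, ih (fun z hz => (hxs z hz).2) hA.2,
        map_update_of_notMem hx, skolemTerm_subst]
      intro z hz h
      exact (hxs z (mem_varFinset_skolemTerm.1 hz)).2 (mem_boundVars_skolemizeAux h)

/-- The bridge used in both directions: afterwards neither the expansion nor the Skolemized formula
has to be inspected, only the champ fini and `A`. The terms of the champ fini contain no bound
variables because `A` is rectified. -/
theorem skolemTruth_of_isExpansion {A : Formula L} (hA : A.Rectified) {n : ℕ}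
    {B : Formula (Ext L)}
    (h : Formula.IsExpansion (champFini n A.outerSkolemizedForm) A.outerSkolemizedForm B) :
    B.Truth w ↔ SkolemTruth w (champFini n A.outerSkolemizedForm) true [] Term.var A := by
  rw [h.quantifierFree.truth_iff w (champFini n A.outerSkolemizedForm), h.truthOver_iff,
    Formula.outerSkolemizedForm, truthOver_skolemizeAux (by simp) hA.2.2]
  · rfl
  · intro t ht z hz
    refine ⟨fun hb => ?_, rfl⟩
    refine hA.2.1 z (mem_boundVars_skolemizeAux hb) ?_
    simpa using mem_freeVars_of_skolemizeAux (ht.2.1 hz)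

/-! ### Property C from validity -/

/-- The canonical strategy: the values of δ-quantifiers are Skolem terms. -/
def skolemStrategy : Bool → List (ExtTerm L) → Formula L → Strategy (ExtTerm L)
  | _, _, .atom _ _ => fun _ => Term.var 0
  | pos, as, .neg A => skolemStrategy (!pos) as A
  | pos, as, .or A B => Strategy.glue (Term.var 0)
      (fun b => if b then skolemStrategy pos as A else skolemStrategy pos as B)
      fun _ _ => Term.var 0
  | pos, as, .and A B => Strategy.glue (Term.var 0)
      (fun b => if b then skolemStrategy pos as A else skolemStrategy pos as B)
      fun _ _ => Term.var 0
  | true, as, .ex _ A => Strategy.glue (Term.var 0) (fun _ _ => Term.var 0)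
      fun t => skolemStrategy true (as ++ [t]) A
  | false, as, .all _ A => Strategy.glue (Term.var 0) (fun _ _ => Term.var 0)
      fun t => skolemStrategy false (as ++ [t]) A
  | false, as, .ex y A => Strategy.glue (skolemApp y as) (fun _ => skolemStrategy false as A)
      fun _ _ => Term.var 0
  | true, as, .all y A => Strategy.glue (skolemApp y as) (fun _ => skolemStrategy true as A)
      fun _ _ => Term.var 0

theorem skolemStrategy_conn (b pos : Bool) (as : List (ExtTerm L)) (A B : Formula L) :
    (skolemStrategy pos as (.conn b A B)).sub true = skolemStrategy pos as A ∧
    (skolemStrategy pos as (.conn b A B)).sub false = skolemStrategy pos as B := by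
  cases b <;> simp [Formula.conn, skolemStrategy]

theorem skolemStrategy_gamma (pos : Bool) (as : List (ExtTerm L)) (x : ℕ) (A : Formula L)
    (t : ExtTerm L) :
    (skolemStrategy pos as (.quant pos x A)).inst t = skolemStrategy pos (as ++ [t]) A := by
  cases pos <;> simp [Formula.quant, skolemStrategy]

theorem skolemStrategy_delta (pos : Bool) (as : List (ExtTerm L)) (y : ℕ) (A : Formula L) :
    skolemStrategy pos as (.quant (!pos) y A) [] = skolemApp y as ∧
    (skolemStrategy pos as (.quant (!pos) y A)).sub true = skolemStrategy pos as A := by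
  cases pos <;> simp [Formula.quant, skolemStrategy]

section

variable {fn : ∀ k, L.Functions k → (Fin k → ExtTerm L) → ExtTerm L}

theorem ev_eq_subst {σ : ℕ → ExtTerm L} {t : L.Term ℕ}
    (hfn : ∀ k (f : L.Functions k), ⟨k, f⟩ ∈ termFuncs t → ∀ args,
      fn k f args = Term.func (Sum.inl f : (Ext L).Functions k) args) :
    ev fn σ t = (liftTerm t).subst σ := by
  induction t with
  | var z => rfl
  | func f ts ih =>
    simp only [ev, LHom.onTerm, Term.subst]
    rw [hfn _ f (.inl rfl)]
    refine congrArg (Term.func (L := Ext L) (Sum.inl f)) (funext fun i => ?_)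
    exact ih i fun k g hg => hfn k g (.inr (Set.mem_iUnion.2 ⟨i, hg⟩))

/-- The list `as` of the γ-choices made so far provides the arguments of the Skolem terms. Only the
symbols of `A` have to be interpreted by term formation; other symbols are free to be given values
inside the champ fini. -/
theorem holds_skolemStrategy {pos : Bool} {as : List (ExtTerm L)} {σ : ℕ → ExtTerm L}
    {A : Formula L} (hfn : ∀ k (f : L.Functions k), ⟨k, f⟩ ∈ A.funcs → ∀ args,
      fn k f args = Term.func (Sum.inl f : (Ext L).Functions k) args) :
    Holds fn (fun k R args => w k (Sum.inl R) args) T pos (skolemStrategy pos as A) σ A ↔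
      SkolemTruth w T pos as σ A := by
  induction A using Formula.induct generalizing pos as σ with
  | atom R ts =>
    simp only [Holds, SkolemTruth]
    rw [show (fun i => ev fn σ (ts i)) = fun i => (liftTerm (ts i)).subst σ from funext fun i =>
      ev_eq_subst fun k f hf => hfn k f (Set.mem_iUnion.2 ⟨i, hf⟩)]
  | neg A ih => exact not_congr (ih hfn)
  | conn b A B ihA ihB =>
    simp only [Formula.funcs_conn] at hfn
    rw [holds_conn, (skolemStrategy_conn b pos as A B).1, (skolemStrategy_conn b pos as A B).2,
      ihA fun k f hf => hfn k f (.inl hf), ihB fun k f hf => hfn k f (.inr hf), skolemTruth_conn]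
  | quant b x A ih =>
    simp only [Formula.funcs_quant] at hfn
    rcases Formula.quant_cases b pos with rfl | rfl
    · simp only [holds_gamma, skolemStrategy_gamma, ih hfn, skolemTruth_gamma]
    · simp only [holds_delta, skolemStrategy_delta, ih hfn, skolemTruth_delta]

end

/-- The arguments of a Skolem term are earlier γ-values, so they lie in the level reached, and the
Skolem term lies in the next one. As no quantifier is vacuous, the Skolem symbol really occurs in
the Skolemized form, which is what `hsk` asks for. -/
theorem respects_skolemStrategy {V : ℕ → Set (ExtTerm L)} (hV : Monotone V)
    {pos : Bool} {xs : List ℕ} {as : List (ExtTerm L)} {k : ℕ} {A : Formula L}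
    (hsk : ∀ (y : ℕ) (l : List (ExtTerm L)) (j : ℕ),
      (⟨l.length, (Sum.inr (NewSymbol.skolem y l.length) : (Ext L).Functions l.length)⟩ :
        Σ n, (Ext L).Functions n) ∈ (A.skolemizeAux pos xs).funcs →
      (∀ t ∈ l, t ∈ V j) → skolemApp y l ∈ V (j + 1))
    (hA : A.NoVacuous) (hlen : as.length = xs.length) (has : ∀ t ∈ as, t ∈ V k) :
    Respects V k pos (skolemStrategy pos as A) A := by
  induction A using Formula.induct generalizing pos xs as k with
  | atom R ts => trivial
  | neg A ih =>
    simp only [Formula.skolemizeAux] at hsk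
    exact ih hsk hA hlen has
  | conn b A B ihA ihB =>
    rw [Formula.noVacuous_conn] at hA
    simp only [skolemizeAux_conn, Formula.funcs_conn] at hsk
    rw [respects_conn, (skolemStrategy_conn b pos as A B).1, (skolemStrategy_conn b pos as A B).2]
    exact ⟨ihA (fun y l j h => hsk y l j (.inl h)) hA.1 hlen has,
      ihB (fun y l j h => hsk y l j (.inr h)) hA.2 hlen has⟩
  | quant b x A ih =>
    rw [Formula.noVacuous_quant] at hA
    rcases Formula.quant_cases b pos with rfl | rfl
    · simp only [skolemizeAux_gamma, Formula.funcs_quant] at hsk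
      rw [respects_gamma]
      intro j hj t ht
      rw [skolemStrategy_gamma]
      refine ih (xs := xs ++ [x]) hsk hA.2 (by simp [hlen]) ?_
      intro s hs
      rw [List.mem_append, List.mem_singleton] at hs
      rcases hs with hs | rfl
      exacts [hV hj (has s hs), ht]
    · simp only [skolemizeAux_delta] at hsk
      rw [respects_delta, (skolemStrategy_delta _ _ _ _).1, (skolemStrategy_delta _ _ _ _).2]
      constructor
      · refine hsk x as k ?_ has
        rw [hlen]
        exact Formula.termFuncs_subset_subst (mem_freeVars_skolemizeAux hA.1) (.inl rfl)
      · exact ih (fun y l j h => hsk y l j (Formula.funcs_subset_subst _ _ _ h)) hA.2 hlen has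

theorem champFini_mono (F : Formula (Ext L)) : Monotone fun n => champFini n F :=
  fun _ _ h _ ht => ⟨ht.1.trans_le h, ht.2⟩

/-- A free variable, a constant symbol or `•` has height one. Such a term makes the expansion
defined and also serves as the default value in the term model. -/
theorem exists_mem_champFini_two (F : Formula (Ext L)) : ∃ t, t ∈ champFini 2 F := by
  by_cases h : F.freeVars = ∅
  · by_cases h' : ∀ c : (Ext L).Functions 0, ⟨0, c⟩ ∉ F.funcs
    · refine ⟨Term.func bulletSymbol.2 Fin.elim0, ?_, ?_, ?_⟩
      · simp [termHeight, bulletSymbol]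
      · intro z hz
        obtain ⟨i, -⟩ := (mem_varFinset_func _ _ z).1 hz
        exact i.elim0
      · rintro f (hf | hf)
        · exact .inr ⟨hf, h, h'⟩
        · obtain ⟨i, -⟩ := Set.mem_iUnion.1 hf
          exact i.elim0
    · push Not at h'
      obtain ⟨c, hc⟩ := h'
      refine ⟨Term.func c Fin.elim0, ?_, ?_, ?_⟩
      · simp [termHeight]
      · intro z hz
        obtain ⟨i, -⟩ := (mem_varFinset_func _ _ z).1 hz
        exact i.elim0
      · rintro f (hf | hf)
        · exact .inl (hf ▸ hc)
        · obtain ⟨i, -⟩ := Set.mem_iUnion.1 hf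
          exact i.elim0
  · obtain ⟨z, hz⟩ := Finset.nonempty_iff_ne_empty.2 h
    refine ⟨Term.var z, ?_, ?_, ?_⟩
    · simp [termHeight]
    · simpa [Term.varFinset] using hz
    · simp [termFuncs]

theorem func_mem_champFini {F : Formula (Ext L)} {k j : ℕ} {f : (Ext L).Functions k}
    (hf : ⟨k, f⟩ ∈ F.funcs) {ts : Fin k → ExtTerm L} (h : ∀ i, ts i ∈ champFini (j + 1) F) :
    Term.func f ts ∈ champFini (j + 2) F := by
  refine ⟨?_, ?_, ?_⟩
  · have : Finset.univ.sup (fun i => termHeight (ts i)) ≤ j :=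
      Finset.sup_le fun i _ => Nat.le_of_lt_succ (h i).1
    simp only [termHeight]
    omega
  · intro z hz
    obtain ⟨i, hi⟩ := (mem_varFinset_func _ _ z).1 hz
    exact (h i).2.1 hi
  · rintro g (hg | hg)
    · exact .inl (hg ▸ hf)
    · obtain ⟨i, hi⟩ := Set.mem_iUnion.1 hg
      exact (h i).2.2 g hi

/-- Validity is applied to the terms of the extended language, with the champs finis as levels and
Skolem terms as the values of δ-quantifiers. -/
theorem ValidUpTo.hasPropertyC {N : ℕ} {A : Formula L} (hA : A.Rectified)
    (hv : ValidUpTo (N + 1) A) : A.HasPropertyC (N + 2) := by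
  classical
  set F := A.outerSkolemizedForm with hF
  obtain ⟨d, hd⟩ := exists_mem_champFini_two F
  obtain ⟨B, hB⟩ := Formula.exists_isExpansion (finite_champFini (N + 2) F)
    ⟨d, champFini_mono F (by omega) hd⟩ F
  refine ⟨B, hB, hB.quantifierFree, fun w => ?_⟩
  rw [skolemTruth_of_isExpansion hA hB]
  -- The champ fini of order `k + 1` contains terms of height at most `k`. So level one contains the
  -- free variables, and level `N + 1` is the champ fini of order `N + 2`.
  let V : ℕ → Set (ExtTerm L) := fun k => champFini (k + 1) F
  have hV : Monotone V := fun a b hab => champFini_mono F (Nat.succ_le_succ hab)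
  -- A function symbol that does not occur in `F` would lead out of the champs finis; the default
  -- value `d` saves the filtration property.
  let fn : ∀ k, L.Functions k → (Fin k → ExtTerm L) → ExtTerm L := fun k f args =>
    if (⟨k, (Sum.inl f : (Ext L).Functions k)⟩ : Σ n, (Ext L).Functions n) ∈ F.funcs then
      Term.func (Sum.inl f : (Ext L).Functions k) args else d
  have hfil : IsFiltration fn V := by
    refine ⟨hV, fun k f ms j hms => ?_⟩
    simp only [fn]
    split_ifs with hf
    · exact func_mem_champFini hf hms
    · exact champFini_mono F (by omega) hd
  have hfn : ∀ k (f : L.Functions k), ⟨k, f⟩ ∈ A.funcs → ∀ args,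
      fn k f args = Term.func (Sum.inl f : (Ext L).Functions k) args := by
    intro k f hf args
    exact if_pos (mem_funcs_skolemizeAux hf)
  -- Variables that are not free in `A` do not belong to the champ fini either. Their values are
  -- irrelevant and are changed to `d`, so that the whole environment lies in level one.
  rw [← holds_skolemStrategy hfn, Holds.congr_env
    (e' := fun z => if z ∈ A.freeVars then Term.var z else d) fun z hz => (if_pos hz).symm]
  refine hv (ExtTerm L) fn _ V hfil _ (fun z => ?_) _ ?_
  · show (if z ∈ A.freeVars then _ else d) ∈ _
    split_ifs with hz
    · refine ⟨by simp [termHeight], ?_, by simp [termFuncs]⟩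
      rw [Term.varFinset, Finset.singleton_subset_iff]
      exact mem_freeVars_skolemizeAux hz
    · exact hd
  · refine respects_skolemStrategy hV (xs := []) ?_ hA.1 rfl (by simp)
    intro y l j hf hl
    exact func_mem_champFini hf fun i => hl _ (List.get_mem l i)

end Herbrand

/-! ### From Property C to derivations: names for Skolem terms and the elimination of instances. -/

namespace Herbrand

open FirstOrder Language Function Relation

variable {L : FirstOrder.Language.{u, v}}

/-! ### Contexts for uniform connectives -/

namespace Context

/-- The context with the hole in the left argument of a connective. -/
def connLeft : Bool → Context L → Formula L → Context L
  | true => orLeft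
  | false => andLeft

/-- The context with the hole in the right argument of a connective. -/
def connRight : Bool → Formula L → Context L → Context L
  | true => orRight
  | false => andRight

section

variable (b p : Bool) (C : Context L) (B H : Formula L)

@[simp] theorem fill_connLeft : (connLeft b C B).fill H = .conn b (C.fill H) B := by
  cases b <;> rfl
@[simp] theorem fill_connRight : (connRight b B C).fill H = .conn b B (C.fill H) := by
  cases b <;> rfl
@[simp] theorem pol_connLeft : (connLeft b C B).pol p = C.pol p := by cases b <;> rfl
@[simp] theorem pol_connRight : (connRight b B C).pol p = C.pol p := by cases b <;> rfl
@[simp] theorem accessible_connLeft : (connLeft b C B).Accessible ↔ C.Accessible := by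
  cases b <;> rfl
@[simp] theorem accessible_connRight : (connRight b B C).Accessible ↔ C.Accessible := by
  cases b <;> rfl
@[simp] theorem allVars_connLeft : (connLeft b C B).allVars = C.allVars ∪ B.allVars := by
  cases b <;> rfl
@[simp] theorem allVars_connRight : (connRight b B C).allVars = B.allVars ∪ C.allVars := by
  cases b <;> rfl

end

end Context

/-! ### Derivations at accessible positions -/

/-- The steps from which the derivations are composed: contraction, γ-quantification, and
δ-quantification with a fresh variable that is renamed afterwards. -/
inductive AccessibleStep : Formula L → Formula L → Prop
  | contract (C : Context L) (H : Formula L) : C.Accessible →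
      AccessibleStep (C.fill (.conn C.positive H H)) (C.fill H)
  | gamma (C : Context L) (x : ℕ) (H : Formula L) (t : L.Term ℕ) : C.Accessible →
      x ∉ H.boundVars → (∀ z ∈ t.varFinset, z ∉ H.boundVars) →
      AccessibleStep (C.fill (H.subst x t)) (C.fill (.quant C.positive x H))
  | delta (C : Context L) (y v : ℕ) (H : Formula L) : C.Accessible → y ∉ H.boundVars →
      v ∉ C.allVars → v ∉ H.allVars →
      AccessibleStep (C.fill (H.subst y (Term.var v))) (C.fill (.quant (!C.positive) y H))

/-- Derivability in an accessible context. -/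
abbrev Context.Derives (C : Context L) (P Q : Formula L) : Prop :=
  ReflTransGen AccessibleStep (C.fill P) (C.fill Q)

theorem Context.derives_comp {C D : Context L} {P Q : Formula L} :
    (C.comp D).Derives P Q ↔ C.Derives (D.fill P) (D.fill Q) := by
  simp only [Derives, fill_comp]

theorem Context.Derives.connLeft {C : Context L} {P Q B : Formula L} {b : Bool}
    (h : (C.comp (.connLeft b .hole B)).Derives P Q) : C.Derives (.conn b P B) (.conn b Q B) := by
  simpa [derives_comp, fill] using h

theorem Context.Derives.connRight {C : Context L} {P Q B : Formula L} {b : Bool}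
    (h : (C.comp (.connRight b B .hole)).Derives P Q) : C.Derives (.conn b B P) (.conn b B Q) := by
  simpa [derives_comp, fill] using h

theorem Context.derives_contract {C : Context L} {pos : Bool} (hC : C.Accessible)
    (hpos : C.positive = pos) (H : Formula L) : C.Derives (.conn pos H H) H :=
  .single (hpos ▸ .contract C H hC)

theorem Context.derives_gamma {C : Context L} {pos : Bool} (hC : C.Accessible)
    (hpos : C.positive = pos) {x : ℕ} {H : Formula L} {t : L.Term ℕ} (hx : x ∉ H.boundVars)
    (ht : ∀ z ∈ t.varFinset, z ∉ H.boundVars) : C.Derives (H.subst x t) (.quant pos x H) :=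
  .single (hpos ▸ .gamma C x H t hC hx ht)

theorem Context.derives_delta {C : Context L} {pos : Bool} (hC : C.Accessible)
    (hpos : C.positive = pos) {y v : ℕ} {H : Formula L} (hy : y ∉ H.boundVars)
    (hv : v ∉ C.allVars) (hv' : v ∉ H.allVars) :
    C.Derives (H.subst y (Term.var v)) (.quant (!pos) y H) :=
  .single (hpos ▸ .delta C y v H hC hy hv hv')

/-! ### Names for Skolem terms -/

/-- The replacement of Skolem terms and of `•` by variables. -/
def unskolem (name : ℕ → List (ExtTerm L) → ℕ) (blt : ℕ) : ExtTerm L → L.Term ℕ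
  | .var z => .var z
  | .func (Sum.inl f) ts => .func f fun i => unskolem name blt (ts i)
  | .func (Sum.inr (NewSymbol.skolem y _)) ts => .var (name y (List.ofFn ts))
  | .func (Sum.inr NewSymbol.bullet) _ => .var blt

theorem unskolem_skolemApp (name : ℕ → List (ExtTerm L) → ℕ) (blt y : ℕ)
    (l : List (ExtTerm L)) : unskolem name blt (skolemApp y l) = .var (name y l) := by
  simp [skolemApp, unskolem]

theorem unskolem_liftTerm_subst (name : ℕ → List (ExtTerm L) → ℕ) (blt : ℕ)
    (σ : ℕ → ExtTerm L) (t : L.Term ℕ) :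
    unskolem name blt ((liftTerm t).subst σ) = t.subst fun z => unskolem name blt (σ z) := by
  induction t with
  | var z => rfl
  | func f ts ih =>
    simp only [Term.subst, ← ih]
    rfl

theorem mem_varFinset_unskolem {name : ℕ → List (ExtTerm L) → ℕ} {blt : ℕ}
    {S : Set (ExtTerm L)} (hS : ∀ {k : ℕ} (f : (Ext L).Functions k) (ts : Fin k → ExtTerm L),
      Term.func f ts ∈ S → ∀ i, ts i ∈ S) {t : ExtTerm L} (ht : t ∈ S) {v : ℕ}
    (hv : v ∈ (unskolem name blt t).varFinset) :
    v ∈ t.varFinset ∨ v = blt ∨ ∃ y l, (∀ s ∈ l, s ∈ S) ∧ v = name y l ∧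
      termHeight (skolemApp y l) ≤ termHeight t := by
  induction t with
  | var z => exact .inl hv
  | func f ts ih =>
    rcases f with f | f
    · obtain ⟨i, hi⟩ := (mem_varFinset_func _ _ _).1 hv
      rcases ih i (hS _ _ ht i) hi with h | h | ⟨y, l, h₁, h₂, h₃⟩
      · exact .inl ((mem_varFinset_func _ _ _).2 ⟨i, h⟩)
      · exact .inr (.inl h)
      · exact .inr (.inr ⟨y, l, h₁, h₂, h₃.trans (height_arg_lt _ _ _).le⟩)
    · rcases f with ⟨y, k⟩ | _
      · refine .inr (.inr ⟨y, List.ofFn ts, ?_, ?_, ?_⟩)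
        · intro s hs
          obtain ⟨i, rfl⟩ := (List.mem_ofFn' _ _).1 hs
          exact hS _ _ ht i
        · simpa [unskolem, Term.varFinset] using hv
        · rw [skolemApp_eq_func y _ List.length_ofFn]
          simp
      · refine .inr (.inl ?_)
        simpa [unskolem, Term.varFinset] using hv

/-- A choice of fresh variables as names for the Skolem terms with arguments from a set. -/
structure Naming (L : FirstOrder.Language.{u, v}) where
  /-- the set of the arguments -/
  terms : Set (ExtTerm L)
  /-- the name of a Skolem term -/
  name : ℕ → List (ExtTerm L) → ℕ
  /-- the name of `•` -/
  blt : ℕ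
  /-- the variables that occur bound -/
  bound : Set ℕ
  name_injective : ∀ {y y' : ℕ} {l l' : List (ExtTerm L)}, (∀ t ∈ l, t ∈ terms) →
    (∀ t ∈ l', t ∈ terms) → name y l = name y' l' → y = y' ∧ l = l'
  name_notMem : ∀ y l, name y l ∉ bound
  unskolem_notMem : ∀ t ∈ terms, ∀ v ∈ (unskolem name blt t).varFinset, v ∉ bound
  height_le : ∀ t ∈ terms, ∀ y l, (∀ s ∈ l, s ∈ terms) →
    name y l ∈ (unskolem name blt t).varFinset → termHeight (skolemApp y l) ≤ termHeight t

namespace Naming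

variable (N : Naming L)

/-- The replacement of Skolem terms by their names. -/
abbrev rho : ExtTerm L → L.Term ℕ := unskolem N.name N.blt

theorem rho_skolemApp (y : ℕ) (l : List (ExtTerm L)) :
    N.rho (skolemApp y l) = .var (N.name y l) := unskolem_skolemApp _ _ _ _

/-- The names of height above `h` of the δ-quantifiers of an occurrence of `G` in the scope of
γ-quantifiers with values `as`. -/
def names (h : ℕ) (G : Formula L) (as : List (ExtTerm L)) : Set ℕ :=
  {v | ∃ y ∈ G.boundVars, ∃ l, (∀ t ∈ as ++ l, t ∈ N.terms) ∧
    h < termHeight (skolemApp y (as ++ l)) ∧ v = N.name y (as ++ l)}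

/-- The formula in which the δ-quantifiers of `G` are replaced by names and the γ-quantifiers are
instantiated with the terms `ts`, but also kept. -/
def state (ts : List (ExtTerm L)) :
    Bool → List (ExtTerm L) → (ℕ → ExtTerm L) → Formula L → Formula L
  | _, _, σ, .atom R us => .atom R fun i => (us i).subst fun z => N.rho (σ z)
  | pos, as, σ, .neg A => .neg (state ts (!pos) as σ A)
  | pos, as, σ, .or A B => .or (state ts pos as σ A) (state ts pos as σ B)
  | pos, as, σ, .and A B => .and (state ts pos as σ A) (state ts pos as σ B)
  | true, as, σ, .ex x A =>
      ts.foldr (fun t acc => .or (state ts true (as ++ [t]) (update σ x t) A) acc)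
        (.ex x (A.ssubst (update (fun z => N.rho (σ z)) x (.var x))))
  | false, as, σ, .all x A =>
      ts.foldr (fun t acc => .and (state ts false (as ++ [t]) (update σ x t) A) acc)
        (.all x (A.ssubst (update (fun z => N.rho (σ z)) x (.var x))))
  | false, as, σ, .ex y A => state ts false as (update σ y (skolemApp y as)) A
  | true, as, σ, .all y A => state ts true as (update σ y (skolemApp y as)) A

section

variable (ts : List (ExtTerm L)) (b pos : Bool) (as : List (ExtTerm L)) (σ : ℕ → ExtTerm L)
  (x y : ℕ) (A B : Formula L)

theorem state_conn : N.state ts pos as σ (.conn b A B) =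
    .conn b (N.state ts pos as σ A) (N.state ts pos as σ B) := by
  cases b <;> simp [Formula.conn, state]

theorem state_gamma : N.state ts pos as σ (.quant pos x A) =
    ts.foldr (fun t acc => .conn pos (N.state ts pos (as ++ [t]) (update σ x t) A) acc)
      (.quant pos x (A.ssubst (update (fun z => N.rho (σ z)) x (.var x)))) := by
  cases pos <;> simp [Formula.quant, Formula.conn, state]

theorem state_delta : N.state ts pos as σ (.quant (!pos) y A) =
    N.state ts pos as (update σ y (skolemApp y as)) A := by
  cases pos <;> simp [Formula.quant, state]

end

/-- The general conditions on an occurrence of a subformula `G` under the substitution `σ`. -/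
structure Admissible (h : ℕ) (G : Formula L) (as : List (ExtTerm L)) (σ : ℕ → ExtTerm L) :
    Prop where
  nodup : G.boundVars.Nodup
  bound : ∀ z ∈ G.boundVars, z ∈ N.bound
  terms : ∀ t ∈ as, t ∈ N.terms
  free : ∀ z ∈ G.freeVars, ∀ v ∈ (N.rho (σ z)).varFinset, v ∉ N.bound ∧ v ∉ N.names h G as

variable {N} {h : ℕ} {ts : List (ExtTerm L)} {as : List (ExtTerm L)} {σ : ℕ → ExtTerm L}
  {A B : Formula L}

/-- Going down to a subformula or to an instance reserves fewer names, so freshness with respect to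
a context is inherited. -/
theorem names_mono {G G' : Formula L} (hG : ∀ y ∈ G'.boundVars, y ∈ G.boundVars)
    (l : List (ExtTerm L)) : N.names h G' (as ++ l) ⊆ N.names h G as := by
  rintro v ⟨y, hy, l', h₁, h₂, rfl⟩
  exact ⟨y, hG y hy, l ++ l', by rwa [← List.append_assoc], by rwa [← List.append_assoc],
    by rw [List.append_assoc]⟩

theorem names_mono' {G G' : Formula L} (hG : ∀ y ∈ G'.boundVars, y ∈ G.boundVars) :
    N.names h G' as ⊆ N.names h G as := by
  simpa using names_mono (N := N) (h := h) (as := as) hG []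

theorem Admissible.left {b : Bool} (hA : N.Admissible h (.conn b A B) as σ) :
    N.Admissible h A as σ where
  nodup := by
    have := hA.nodup
    rw [Formula.boundVars_conn] at this
    exact this.of_append_left
  bound z hz := hA.bound z (by simp [hz])
  terms := hA.terms
  free z hz v hv := (hA.free z (by simp [hz]) v hv).imp_right
    fun hn hm => hn (names_mono' (by simp +contextual) hm)

theorem Admissible.right {b : Bool} (hA : N.Admissible h (.conn b A B) as σ) :
    N.Admissible h B as σ where
  nodup := by
    have := hA.nodup
    rw [Formula.boundVars_conn] at this
    exact this.of_append_right
  bound z hz := hA.bound z (by simp [hz])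
  terms := hA.terms
  free z hz v hv := (hA.free z (by simp [hz]) v hv).imp_right
    fun hn hm => hn (names_mono' (by simp +contextual) hm)

/-- The reserved names belong to Skolem terms higher than `h`, whereas a name that occurs in the
instantiated term belongs to a Skolem term of height at most `|t| ≤ h`. -/
theorem Admissible.inst {b : Bool} {x : ℕ} (hA : N.Admissible h (.quant b x A) as σ)
    {t : ExtTerm L} (ht : t ∈ N.terms) (hth : termHeight t ≤ h) :
    N.Admissible h A (as ++ [t]) (update σ x t) where
  nodup := by
    have := hA.nodup
    rw [Formula.boundVars_quant, List.nodup_cons] at this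
    exact this.2
  bound z hz := hA.bound z (by simp [hz])
  terms s hs := by
    rw [List.mem_append, List.mem_singleton] at hs
    rcases hs with hs | rfl
    exacts [hA.terms s hs, ht]
  free z hz v hv := by
    by_cases hzx : z = x
    · subst hzx
      rw [update_self] at hv
      refine ⟨N.unskolem_notMem t ht v hv, ?_⟩
      rintro ⟨y, hy, l, h₁, h₂, rfl⟩
      have := N.height_le t ht y _ h₁ hv
      omega
    · rw [update_of_ne hzx] at hv
      exact (hA.free z (by simp [hz, hzx]) v hv).imp_right
        fun hn hm => hn (names_mono (by simp +contextual) _ hm)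

/-- The name that replaces `y` is not reserved by the scope: a name determines its variable, and `y`
is not bound a second time. -/
theorem Admissible.delta {b : Bool} {y : ℕ} (hA : N.Admissible h (.quant b y A) as σ) :
    N.Admissible h A as (update σ y (skolemApp y as)) where
  nodup := by
    have := hA.nodup
    rw [Formula.boundVars_quant, List.nodup_cons] at this
    exact this.2
  bound z hz := hA.bound z (by simp [hz])
  terms := hA.terms
  free z hz v hv := by
    by_cases hzy : z = y
    · subst hzy
      rw [update_self, N.rho_skolemApp, Term.varFinset, Finset.mem_singleton] at hv
      subst hv
      refine ⟨N.name_notMem _ _, ?_⟩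
      rintro ⟨y, hy, l, h₁, h₂, h₃⟩
      obtain ⟨rfl, -⟩ := N.name_injective hA.terms h₁ h₃
      have := hA.nodup
      rw [Formula.boundVars_quant, List.nodup_cons] at this
      exact this.1 hy
    · rw [update_of_ne hzy] at hv
      exact (hA.free z (by simp [hz, hzy]) v hv).imp_right
        fun hn hm => hn (names_mono' (by simp +contextual) hm)

theorem mem_allVars_foldr_conn {α : Type*} {b : Bool} {f : α → Formula L} {B : Formula L}
    {l : List α} {v : ℕ} (hv : v ∈ (l.foldr (fun t acc => .conn b (f t) acc) B).allVars) :
    (∃ t ∈ l, v ∈ (f t).allVars) ∨ v ∈ B.allVars := by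
  induction l with
  | nil => exact .inr hv
  | cons t l ih =>
    simp only [List.foldr_cons, Formula.allVars_conn, Finset.mem_union] at hv
    rcases hv with hv | hv
    · exact .inl ⟨t, by simp, hv⟩
    · exact (ih hv).imp (fun ⟨s, hs, h⟩ => ⟨s, by simp [hs], h⟩) id

theorem name_notMem_ssubst {y : ℕ} {l : List (ExtTerm L)} {G : Formula L}
    {τ : ℕ → L.Term ℕ} (hG : ∀ z ∈ G.boundVars, z ∈ N.bound)
    (hfree : ∀ z ∈ G.freeVars, N.name y l ∉ (τ z).varFinset) :
    N.name y l ∉ (G.ssubst τ).allVars := by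
  intro hm
  rcases Formula.mem_allVars_ssubst hm with hm | ⟨z, hz, hm⟩
  exacts [N.name_notMem _ _ (hG _ hm), hfree z hz hm]

theorem name_notMem_quant_ssubst {b : Bool} {x y : ℕ} {l : List (ExtTerm L)} {G : Formula L}
    {τ : ℕ → L.Term ℕ} (hG : ∀ z ∈ (Formula.quant b x G).boundVars, z ∈ N.bound)
    (hfree : ∀ z ∈ (Formula.quant b x G).freeVars, N.name y l ∉ (τ z).varFinset) :
    N.name y l ∉ (Formula.quant b x (G.ssubst (update τ x (.var x)))).allVars := by
  rw [← Formula.ssubst_quant]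
  exact name_notMem_ssubst hG hfree

/-- A name does not occur in a state of another subformula or of another instance. -/
theorem name_notMem_state {pos : Bool} {y : ℕ} {l : List (ExtTerm L)}
    (hl : ∀ t ∈ l, t ∈ N.terms) (hh : h < termHeight (skolemApp y l))
    (hts : ∀ t ∈ ts, t ∈ N.terms ∧ termHeight t ≤ h) {G : Formula L}
    (has : ∀ t ∈ as, t ∈ N.terms) (hG : ∀ z ∈ G.boundVars, z ∈ N.bound)
    (hfree : ∀ z ∈ G.freeVars, N.name y l ∉ (N.rho (σ z)).varFinset)
    (hne : y ∈ G.boundVars → ¬ as <+: l) : N.name y l ∉ (N.state ts pos as σ G).allVars := by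
  induction G using Formula.induct generalizing pos as σ with
  | atom R us =>
    simp only [state, Formula.allVars, Finset.mem_biUnion, Finset.mem_univ, true_and,
      mem_varFinset_subst]
    rintro ⟨i, z, hz, hm⟩
    exact hfree z (by simpa [Formula.freeVars] using ⟨i, hz⟩) hm
  | neg A ih => exact ih has hG hfree hne
  | conn b A B ihA ihB =>
    simp only [Formula.boundVars_conn, List.mem_append, Formula.freeVars_conn,
      Finset.mem_union] at hG hfree hne
    simp only [state_conn, Formula.allVars_conn, Finset.mem_union, not_or]
    exact ⟨ihA has (fun z hz => hG z (.inl hz)) (fun z hz => hfree z (.inl hz))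
        (fun hy => hne (.inl hy)),
      ihB has (fun z hz => hG z (.inr hz)) (fun z hz => hfree z (.inr hz))
        (fun hy => hne (.inr hy))⟩
  | quant b x A ih =>
    have hA : ∀ z ∈ A.boundVars, z ∈ N.bound := fun z hz => hG z (by simp [hz])
    rcases Formula.quant_cases b pos with rfl | rfl
    · rw [state_gamma]
      intro hm
      rcases mem_allVars_foldr_conn hm with ⟨t, ht, hm⟩ | hm
      · refine ih (as := as ++ [t]) (σ := update σ x t) ?_ hA ?_ ?_ hm
        · intro s hs
          rw [List.mem_append, List.mem_singleton] at hs
          rcases hs with hs | rfl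
          exacts [has s hs, (hts _ ht).1]
        · intro z hz hm
          by_cases hzx : z = x
          · subst hzx
            rw [update_self] at hm
            have := N.height_le t (hts t ht).1 y l hl hm
            have := (hts t ht).2
            omega
          · rw [update_of_ne hzx] at hm
            exact hfree z (by simp [hz, hzx]) hm
        · exact fun hy hp => hne (by simp [hy]) ((List.prefix_append _ _).trans hp)
      · exact name_notMem_quant_ssubst hG hfree hm
    · rw [state_delta]
      refine ih has hA ?_ fun hy => hne (by simp [hy])
      intro z hz hm
      by_cases hzx : z = x
      · subst hzx
        rw [update_self, N.rho_skolemApp, Term.varFinset, Finset.mem_singleton] at hm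
        -- The name introduced here equals the given one only if this is its own δ-quantifier with
        -- its own arguments, which `hne` excludes.
        obtain ⟨rfl, rfl⟩ := N.name_injective hl has hm
        exact hne (by simp) (List.prefix_refl _)
      · rw [update_of_ne hzx] at hm
        exact hfree z (by simp [hz, hzx]) hm

/-- The last instance of a γ-quantifier is generalized. -/
theorem derives_gamma {C : Context L} {pos : Bool} (hC : C.Accessible) (hpos : C.positive = pos)
    {x : ℕ} (hA : N.Admissible h (.quant pos x A) as σ) {t : ExtTerm L} (ht : t ∈ N.terms) :
    C.Derives (A.ssubst fun z => N.rho (update σ x t z))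
      (.quant pos x (A.ssubst (update (fun z => N.rho (σ z)) x (.var x)))) := by
  have hx := hA.nodup
  rw [Formula.boundVars_quant, List.nodup_cons] at hx
  have hxb : x ∈ N.bound := hA.bound x (by simp)
  have e : (fun z => N.rho (update σ x t z)) = update (fun z => N.rho (σ z)) x (N.rho t) :=
    comp_update N.rho σ x t
  rw [e, ← Formula.subst_ssubst_update hx.1]
  · refine Context.derives_gamma hC hpos ?_ ?_
    · rw [Formula.boundVars_ssubst]
      exact hx.1
    · intro z hz hzb
      rw [Formula.boundVars_ssubst] at hzb
      exact N.unskolem_notMem t ht z hz (hA.bound z (by simp [hzb]))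
  · intro z hz hzx hm
    exact (hA.free z (by simp [hz, hzx]) x hm).1 hxb

variable {pos : Bool}

/-- A name determines the variable of its δ-quantifier, and this variable is bound in only one of
the two arguments. The lemma provides fresh eigenvariables for the work on `A` next to the state of
`B`. -/
theorem Admissible.notMem_state_right {b : Bool} (hA : N.Admissible h (.conn b A B) as σ)
    (hts : ∀ t ∈ ts, t ∈ N.terms ∧ termHeight t ≤ h) :
    ∀ v ∈ N.names h A as, v ∉ (N.state ts pos as σ B).allVars := by
  rintro v ⟨y, hy, l, h₁, h₂, rfl⟩
  refine name_notMem_state h₁ h₂ hts hA.terms hA.right.bound ?_ fun hy' => ?_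
  · intro z hz hm
    exact (hA.free z (by simp [hz]) _ hm).2 ⟨y, by simp [hy], l, h₁, h₂, rfl⟩
  · have := hA.nodup
    rw [Formula.boundVars_conn] at this
    exact absurd hy' (List.disjoint_of_nodup_append this hy)

theorem Admissible.notMem_state_left {b : Bool} (hA : N.Admissible h (.conn b A B) as σ)
    (hts : ∀ t ∈ ts, t ∈ N.terms ∧ termHeight t ≤ h) :
    ∀ v ∈ N.names h B as, v ∉ (N.state ts pos as σ A).allVars := by
  rintro v ⟨y, hy, l, h₁, h₂, rfl⟩
  refine name_notMem_state h₁ h₂ hts hA.terms hA.left.bound ?_ fun hy' => ?_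
  · intro z hz hm
    exact (hA.free z (by simp [hz]) _ hm).2 ⟨y, by simp [hy], l, h₁, h₂, rfl⟩
  · have := hA.nodup
    rw [Formula.boundVars_conn] at this
    exact absurd hy (List.disjoint_of_nodup_append this hy')

/-- For the work on `B` after `A` has been collapsed: the collapsed formula contains only its bound
variables and the values of its free variables, and no reserved name is among these. -/
theorem Admissible.notMem_ssubst_left {b : Bool} (hA : N.Admissible h (.conn b A B) as σ) :
    ∀ v ∈ N.names h B as, v ∉ (A.ssubst fun z => N.rho (σ z)).allVars := by
  rintro v ⟨y, hy, l, h₁, h₂, rfl⟩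
  refine name_notMem_ssubst hA.left.bound ?_
  intro z hz hm
  exact (hA.free z (by simp [hz]) _ hm).2 ⟨y, by simp [hy], l, h₁, h₂, rfl⟩

/-- The kept quantified formula introduces no names; those in the values of its free variables are
not reserved by admissibility. -/
theorem Admissible.notMem_quant {b : Bool} {x : ℕ} (hA : N.Admissible h (.quant b x A) as σ)
    (l : List (ExtTerm L)) : ∀ v ∈ N.names h A (as ++ l),
      v ∉ (Formula.quant b x (A.ssubst (update (fun z => N.rho (σ z)) x (.var x)))).allVars := by
  rintro v hv
  have hv' := hv
  obtain ⟨y, hy, l', h₁, h₂, rfl⟩ := hv'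
  refine name_notMem_quant_ssubst hA.bound ?_
  intro z hz hm
  exact (hA.free z hz _ hm).2 (names_mono (by simp +contextual) _ hv)

/-- Names tell instances apart by their arguments: a name reserved by the instance for `t` has
arguments that begin with `as ++ [t]`, which a name introduced in the instance for `t'` cannot have.
The names inside `t'` itself are too low to be reserved. -/
theorem Admissible.notMem_state_inst {b : Bool} {x : ℕ}
    (hA : N.Admissible h (.quant b x A) as σ)
    (hts : ∀ t ∈ ts, t ∈ N.terms ∧ termHeight t ≤ h) {t t' : ExtTerm L} (htt : t ≠ t')
    (ht' : t' ∈ N.terms ∧ termHeight t' ≤ h) : ∀ v ∈ N.names h A (as ++ [t]),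
      v ∉ (N.state ts pos (as ++ [t']) (update σ x t') A).allVars := by
  rintro v hv
  have hv' := hv
  obtain ⟨y, hy, l, h₁, h₂, rfl⟩ := hv'
  have hA' := hA.inst ht'.1 ht'.2
  refine name_notMem_state h₁ h₂ hts hA'.terms hA'.bound ?_ ?_
  · intro z hz hm
    by_cases hzx : z = x
    · subst hzx
      rw [update_self] at hm
      have := N.height_le t' ht'.1 y _ h₁ hm
      have := ht'.2
      omega
    · rw [update_of_ne hzx] at hm
      exact (hA.free z (by simp [hz, hzx]) _ hm).2 (names_mono (by simp +contextual) _ hv)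
  · rintro - hp
    rw [List.append_assoc, List.prefix_append_right_inj, List.singleton_append,
      List.cons_prefix_cons] at hp
    exact htt hp.1.symm

/-- From the state of a subformula that is deep enough, the subformula itself is derivable. -/
theorem derives_collapse (hts : ∀ t ∈ ts, t ∈ N.terms ∧ termHeight t ≤ h) (hnd : ts.Nodup)
    {C : Context L} (hC : C.Accessible) (hpos : C.positive = pos) {G : Formula L}
    (hG : N.Admissible h G as σ) (hdeep : ∀ y l, h < termHeight (skolemApp y (as ++ l)))
    (hnew : ∀ v ∈ N.names h G as, v ∉ C.allVars) :
    C.Derives (N.state ts pos as σ G) (G.ssubst fun z => N.rho (σ z)) := by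
  induction G using Formula.induct generalizing C pos as σ with
  | atom R us => exact .refl
  | neg A ih =>
    have := ih (C := C.comp (.neg .hole)) (pos := !pos) (hC.comp trivial)
      (by simp [Context.positive_comp, Context.pol, hpos]) ⟨hG.1, hG.2, hG.3, hG.4⟩ hdeep
      (by rw [Context.allVars_comp, Context.allVars, Context.allVars, Finset.union_empty]; exact hnew)
    rwa [Context.derives_comp] at this
  | conn b A B ihA ihB =>
    rw [state_conn, Formula.ssubst_conn]
    refine ReflTransGen.trans (Context.Derives.connLeft (ihA (hC.comp ?_) ?_ hG.left hdeep ?_))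
      (Context.Derives.connRight (ihB (hC.comp ?_) ?_ hG.right hdeep ?_))
    · simp [Context.Accessible]
    · simp [Context.positive_comp, Context.pol, hpos]
    · intro v hv
      simp only [Context.allVars_comp, Context.allVars_connLeft, Context.allVars,
        Finset.empty_union, Finset.mem_union, not_or]
      exact ⟨hnew v (names_mono' (by simp +contextual) hv), hG.notMem_state_right hts v hv⟩
    · simp [Context.Accessible]
    · simp [Context.positive_comp, Context.pol, hpos]
    · intro v hv
      simp only [Context.allVars_comp, Context.allVars_connRight, Context.allVars,
        Finset.union_empty, Finset.mem_union, not_or]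
      exact ⟨hnew v (names_mono' (by simp +contextual) hv), hG.notMem_ssubst_left v hv⟩
  | quant b x A ih =>
    rcases Formula.quant_cases b pos with rfl | rfl
    · rw [state_gamma, Formula.ssubst_quant]
      -- The first instance is collapsed and generalized, the remaining instances are reduced to the
      -- kept quantified formula, and the two equal copies are contracted.
      have key : ∀ l : List (ExtTerm L), l.Nodup → (∀ t ∈ l, t ∈ ts) → ∀ C : Context L,
          C.Accessible → C.positive = b →
          (∀ t ∈ l, ∀ v ∈ N.names h A (as ++ [t]), v ∉ C.allVars) →
          C.Derives (l.foldr (fun t acc => .conn b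
              (N.state ts b (as ++ [t]) (update σ x t) A) acc)
              (.quant b x (A.ssubst (update (fun z => N.rho (σ z)) x (.var x)))))
            (.quant b x (A.ssubst (update (fun z => N.rho (σ z)) x (.var x)))) := by
        intro l
        induction l with
        | nil => exact fun _ _ _ _ _ _ => .refl
        | cons t l ihl =>
          intro hl hlts C hC hpos hnew
          rw [List.nodup_cons] at hl
          obtain ⟨htt, hth⟩ := hts t (hlts t (by simp))
          rw [List.foldr_cons]
          have acc : ∀ B, (C.comp (.connLeft b .hole B)).Accessible := fun B =>
            hC.comp (by simp [Context.Accessible])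
          have pol : ∀ B, (C.comp (.connLeft b .hole B)).positive = b := by
            simp [Context.positive_comp, Context.pol, hpos]
          refine ReflTransGen.trans (Context.Derives.connLeft
            ((ih (acc _) (pol _) (hG.inst htt hth) ?_ ?_).trans
              (derives_gamma (acc _) (pol _) hG htt)))
            (ReflTransGen.trans (Context.Derives.connRight (ihl hl.2
              (fun s hs => hlts s (by simp [hs])) _ (hC.comp ?_) ?_ ?_))
              (Context.derives_contract hC hpos _))
          · intro y l'
            rw [List.append_assoc]
            exact hdeep y _
          · intro v hv
            simp only [Context.allVars_comp, Context.allVars_connLeft, Context.allVars,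
              Finset.empty_union, Finset.mem_union, not_or]
            refine ⟨hnew t (by simp) v hv, fun hm => ?_⟩
            rcases mem_allVars_foldr_conn hm with ⟨t', ht', hm⟩ | hm
            · exact hG.notMem_state_inst hts (by rintro rfl; exact hl.1 ht')
                (hts t' (hlts t' (by simp [ht']))) v hv hm
            · exact hG.notMem_quant _ v hv hm
          · simp [Context.Accessible]
          · simp [Context.positive_comp, Context.pol, hpos]
          · intro t' ht' v hv
            simp only [Context.allVars_comp, Context.allVars_connRight, Context.allVars,
              Finset.union_empty, Finset.mem_union, not_or]
            exact ⟨hnew t' (by simp [ht']) v hv, hG.notMem_quant _ v hv⟩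
      exact key ts hnd (fun _ h => h) C hC hpos
        fun t _ v hv => hnew v (names_mono (by simp +contextual) _ hv)
    · rw [state_delta, Formula.ssubst_quant]
      -- The eigenvariable is the name given to this very δ-quantifier. By `hdeep`, with no further
      -- arguments, it is reserved and therefore absent from the context.
      have hv : N.name x as ∈ N.names h (.quant (!pos) x A) as :=
        ⟨x, by simp, [], by simpa using hG.terms, by simpa using hdeep x [], by simp⟩
      have hx := hG.nodup
      rw [Formula.boundVars_quant, List.nodup_cons] at hx
      have hxb : x ∈ N.bound := hG.bound x (by simp)
      refine ReflTransGen.trans (ih hC hpos hG.delta hdeep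
        fun v hv => hnew v (names_mono' (by simp +contextual) hv)) ?_
      have e : (fun z => N.rho (update σ x (skolemApp x as) z)) =
          update (fun z => N.rho (σ z)) x (.var (N.name x as)) := by
        rw [← N.rho_skolemApp]
        exact comp_update N.rho σ x _
      rw [e, ← Formula.subst_ssubst_update hx.1]
      · refine Context.derives_delta hC hpos ?_ (hnew _ hv) ?_
        · rw [Formula.boundVars_ssubst]
          exact hx.1
        · refine name_notMem_ssubst (fun z hz => hG.bound z (by simp [hz])) ?_
          intro z hz hm
          by_cases hzx : z = x
          · subst hzx
            rw [update_self, Term.varFinset, Finset.mem_singleton] at hm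
            exact N.name_notMem _ _ (hm ▸ hxb)
          · rw [update_of_ne hzx] at hm
            exact (hG.free z (by simp [hz, hzx]) _ hm).2 hv
      · intro z hz hzx hm
        exact (hG.free z (by simp [hz, hzx]) x hm).1 hxb

/-- A state with one more term as instance derives the state without it. -/
theorem derives_advance {t : ExtTerm L} (hts : ∀ s ∈ ts ++ [t], s ∈ N.terms ∧ termHeight s ≤ h)
    (hnd : (ts ++ [t]).Nodup) (hth : h ≤ termHeight t)
    {C : Context L} (hC : C.Accessible) (hpos : C.positive = pos) {G : Formula L}
    (hG : N.Admissible h G as σ) (hnew : ∀ v ∈ N.names h G as, v ∉ C.allVars) :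
    C.Derives (N.state (ts ++ [t]) pos as σ G) (N.state ts pos as σ G) := by
  have hts' : ∀ s ∈ ts, s ∈ N.terms ∧ termHeight s ≤ h := fun s hs => hts s (by simp [hs])
  induction G using Formula.induct generalizing C pos as σ with
  | atom R us => exact .refl
  | neg A ih =>
    have := ih (C := C.comp (.neg .hole)) (pos := !pos) (hC.comp trivial)
      (by simp [Context.positive_comp, Context.pol, hpos]) ⟨hG.1, hG.2, hG.3, hG.4⟩
      (by rw [Context.allVars_comp, Context.allVars, Context.allVars, Finset.union_empty]; exact hnew)
    rwa [Context.derives_comp] at this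
  | conn b A B ihA ihB =>
    rw [state_conn, state_conn]
    refine ReflTransGen.trans (Context.Derives.connLeft (ihA (hC.comp ?_) ?_ hG.left ?_))
      (Context.Derives.connRight (ihB (hC.comp ?_) ?_ hG.right ?_))
    · simp [Context.Accessible]
    · simp [Context.positive_comp, Context.pol, hpos]
    · intro v hv
      simp only [Context.allVars_comp, Context.allVars_connLeft, Context.allVars,
        Finset.empty_union, Finset.mem_union, not_or]
      exact ⟨hnew v (names_mono' (by simp +contextual) hv), hG.notMem_state_right hts v hv⟩
    · simp [Context.Accessible]
    · simp [Context.positive_comp, Context.pol, hpos]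
    · intro v hv
      simp only [Context.allVars_comp, Context.allVars_connRight, Context.allVars,
        Finset.union_empty, Finset.mem_union, not_or]
      exact ⟨hnew v (names_mono' (by simp +contextual) hv), hG.notMem_state_left hts' v hv⟩
  | quant b x A ih =>
    rcases Formula.quant_cases b pos with rfl | rfl
    · rw [state_gamma, state_gamma, List.foldr_append, List.foldr_cons, List.foldr_nil]
      -- Only the instance for `t`, which comes last, is eliminated as a whole. The earlier
      -- instances stay, and `t` is removed inside them by the induction hypothesis for the scope.
      have key : ∀ l : List (ExtTerm L), (l ++ [t]).Nodup → (∀ s ∈ l, s ∈ ts) → ∀ C : Context L,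
          C.Accessible → C.positive = b →
          (∀ s ∈ l ++ [t], ∀ v ∈ N.names h A (as ++ [s]), v ∉ C.allVars) →
          C.Derives (l.foldr (fun s acc => .conn b
              (N.state (ts ++ [t]) b (as ++ [s]) (update σ x s) A) acc)
              (.conn b (N.state (ts ++ [t]) b (as ++ [t]) (update σ x t) A)
                (.quant b x (A.ssubst (update (fun z => N.rho (σ z)) x (.var x))))))
            (l.foldr (fun s acc => .conn b
              (N.state ts b (as ++ [s]) (update σ x s) A) acc)
              (.quant b x (A.ssubst (update (fun z => N.rho (σ z)) x (.var x))))) := by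
        intro l
        induction l with
        | nil =>
          intro _ _ C hC hpos hnew
          obtain ⟨htt, hth'⟩ := hts t (by simp)
          have acc : ∀ B, (C.comp (.connLeft b .hole B)).Accessible := fun B =>
            hC.comp (by simp [Context.Accessible])
          have pol : ∀ B, (C.comp (.connLeft b .hole B)).positive = b := by
            simp [Context.positive_comp, Context.pol, hpos]
          refine ReflTransGen.trans (Context.Derives.connLeft
            ((derives_collapse hts hnd (acc _) (pol _) (hG.inst htt hth') ?_ ?_).trans
              (derives_gamma (acc _) (pol _) hG htt))) (Context.derives_contract hC hpos _)
          · intro y l'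
            -- Here the order of elimination matters: a Skolem term with `t` among its arguments is
            -- higher than `t`, and so higher than `h`, the bound for all listed terms.
            exact hth.trans_lt (mem_termHeight_skolemApp (by simp))
          · intro v hv
            simp only [Context.allVars_comp, Context.allVars_connLeft, Context.allVars,
              Finset.empty_union, Finset.mem_union, not_or]
            exact ⟨hnew t (by simp) v hv, hG.notMem_quant _ v hv⟩
        | cons s l ihl =>
          intro hl hlts C hC hpos hnew
          rw [List.cons_append, List.nodup_cons] at hl
          have hs := hts' s (hlts s (by simp))
          rw [List.foldr_cons, List.foldr_cons]
          refine ReflTransGen.trans (Context.Derives.connLeft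
            (ih (hC.comp ?_) ?_ (hG.inst hs.1 hs.2) ?_))
            (Context.Derives.connRight (ihl hl.2
              (fun s hs => hlts s (by simp [hs])) _ (hC.comp ?_) ?_ ?_))
          · simp [Context.Accessible]
          · simp [Context.positive_comp, Context.pol, hpos]
          · intro v hv
            simp only [Context.allVars_comp, Context.allVars_connLeft, Context.allVars,
              Finset.empty_union, Finset.mem_union, not_or]
            refine ⟨hnew s (by simp) v hv, fun hm => ?_⟩
            rcases mem_allVars_foldr_conn hm with ⟨t', ht', hm⟩ | hm
            · exact hG.notMem_state_inst hts (by rintro rfl; exact hl.1 (by simp [ht']))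
                (hts' t' (hlts t' (by simp [ht']))) v hv hm
            · simp only [Formula.allVars_conn, Finset.mem_union] at hm
              rcases hm with hm | hm
              · exact hG.notMem_state_inst hts (by rintro rfl; exact hl.1 (by simp))
                  (hts t (by simp)) v hv hm
              · exact hG.notMem_quant _ v hv hm
          · simp [Context.Accessible]
          · simp [Context.positive_comp, Context.pol, hpos]
          · intro t' ht' v hv
            simp only [Context.allVars_comp, Context.allVars_connRight, Context.allVars,
              Finset.union_empty, Finset.mem_union, not_or]
            exact ⟨hnew t' (by simp at ht' ⊢; tauto) v hv,
              hG.notMem_state_inst hts' (by rintro rfl; exact hl.1 ht') hs v hv⟩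
      exact key ts hnd (fun _ h => h) C hC hpos
        fun t _ v hv => hnew v (names_mono (by simp +contextual) _ hv)
    · rw [state_delta, state_delta]
      exact ih hC hpos hG.delta fun v hv => hnew v (names_mono' (by simp +contextual) hv)

end Naming

end Herbrand

/-! ### The quantifier-free premise and its validity. -/

namespace Herbrand

open FirstOrder Language Function Relation

variable {L : FirstOrder.Language.{u, v}}

/-! ### Removal of the remaining quantifiers -/

namespace Formula

/-- No variable is bound by two quantifiers one of which is in the scope of the other. -/
def Unnested : Formula L → Prop
  | atom _ _ => True
  | neg A => A.Unnested
  | or A B => A.Unnested ∧ B.Unnested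
  | and A B => A.Unnested ∧ B.Unnested
  | ex x A => x ∉ A.boundVars ∧ A.Unnested
  | all x A => x ∉ A.boundVars ∧ A.Unnested

@[simp] theorem unnested_conn (b : Bool) (A B : Formula L) :
    (conn b A B).Unnested ↔ A.Unnested ∧ B.Unnested := by cases b <;> rfl

@[simp] theorem unnested_quant (b : Bool) (x : ℕ) (A : Formula L) :
    (quant b x A).Unnested ↔ x ∉ A.boundVars ∧ A.Unnested := by cases b <;> rfl

theorem unnested_of_nodup {A : Formula L} (h : A.boundVars.Nodup) : A.Unnested := by
  induction A using Formula.induct with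
  | atom R ts => trivial
  | neg A ih => exact ih h
  | conn b A B ihA ihB =>
    rw [boundVars_conn] at h
    exact (unnested_conn _ _ _).2 ⟨ihA h.of_append_left, ihB h.of_append_right⟩
  | quant b x A ih =>
    rw [boundVars_quant, List.nodup_cons] at h
    exact (unnested_quant _ _ _).2 ⟨h.1, ih h.2⟩

theorem Unnested.subst {A : Formula L} (h : A.Unnested) (x : ℕ) (t : L.Term ℕ) :
    (A.subst x t).Unnested := by
  induction A using Formula.induct with
  | atom R ts => trivial
  | neg A ih => exact ih h
  | conn b A B ihA ihB =>
    rw [unnested_conn] at h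
    simp [ihA h.1, ihB h.2]
  | quant b y A ih =>
    rw [subst_quant]
    split_ifs
    · exact h
    · rw [unnested_quant] at h
      simp [boundVars_subst, h.1, ih h.2]

theorem Unnested.ssubst {A : Formula L} (h : A.Unnested) (τ : ℕ → L.Term ℕ) :
    (A.ssubst τ).Unnested := by
  induction A using Formula.induct generalizing τ with
  | atom R ts => trivial
  | neg A ih => exact ih h τ
  | conn b A B ihA ihB =>
    rw [unnested_conn] at h
    simp [ihA h.1, ihB h.2]
  | quant b y A ih =>
    rw [unnested_quant] at h
    simp [boundVars_ssubst, h.1, ih h.2]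

/-- The truth of an occurrence of polarity `pos`, where quantified formulas count as false at
positive and as true at negative positions. -/
def LowerTruth (w : ∀ k, L.Relations k → (Fin k → L.Term ℕ) → Prop) : Bool → Formula L → Prop
  | _, atom R ts => w _ R ts
  | pos, neg A => ¬ A.LowerTruth w (!pos)
  | pos, or A B => A.LowerTruth w pos ∨ B.LowerTruth w pos
  | pos, and A B => A.LowerTruth w pos ∧ B.LowerTruth w pos
  | pos, ex _ _ => pos = false
  | pos, all _ _ => pos = false

theorem lowerTruth_conn (w : ∀ k, L.Relations k → (Fin k → L.Term ℕ) → Prop) (b pos : Bool)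
    (A B : Formula L) : (conn b A B).LowerTruth w pos ↔
      if b then A.LowerTruth w pos ∨ B.LowerTruth w pos
      else A.LowerTruth w pos ∧ B.LowerTruth w pos := by
  cases b <;> simp [conn, LowerTruth]

theorem lowerTruth_quant (w : ∀ k, L.Relations k → (Fin k → L.Term ℕ) → Prop) (b pos : Bool)
    (x : ℕ) (A : Formula L) : (quant b x A).LowerTruth w pos ↔ pos = false := by
  cases b <;> simp [quant, LowerTruth]

end Formula

/-- Every formula is derivable from a quantifier-free formula that is true where it is. -/
theorem exists_quantifierFree_derives (P : Formula L) (hP : P.Unnested) (pos : Bool)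
    (Z : Finset ℕ) : ∃ P' : Formula L, P'.QuantifierFree ∧
      (∀ C : Context L, C.Accessible → C.positive = pos → C.allVars ⊆ Z → C.Derives P' P) ∧
      ∀ w, Below pos (P.LowerTruth w pos) (P'.Truth w) := by
  -- The induction is on the size, because the scope of a quantifier is replaced by an instance of
  -- it.
  induction hn : P.size using Nat.strong_induction_on generalizing P pos Z with
  | _ n ih =>
    induction P using Formula.induct with
    | atom R ts => exact ⟨.atom R ts, trivial, fun _ _ _ _ => .refl, fun w => .of_iff _ Iff.rfl⟩
    | neg A _ =>
      obtain ⟨A', h₁, h₂, h₃⟩ := ih A.size (by simp only [Formula.size] at hn; omega) A hP (!pos) Z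
        rfl
      refine ⟨.neg A', h₁, fun C hC hpos hZ => ?_, fun w => (h₃ w).not⟩
      have := h₂ (C.comp (.neg .hole)) (hC.comp trivial)
        (by simp [Context.positive_comp, Context.pol, hpos])
        (by simpa [Context.allVars_comp, Context.allVars] using hZ)
      rwa [Context.derives_comp] at this
    | conn b A B _ _ =>
      rw [Formula.size_conn] at hn
      rw [Formula.unnested_conn] at hP
      -- The passage from `B'` to `B` takes place next to `A'`, and afterwards the passage from `A'`
      -- to `A` takes place next to `B`. This fixes the variables that each of them must avoid.
      obtain ⟨A', hA₁, hA₂, hA₃⟩ := ih A.size (by omega) A hP.1 pos (Z ∪ B.allVars) rfl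
      obtain ⟨B', hB₁, hB₂, hB₃⟩ := ih B.size (by omega) B hP.2 pos (Z ∪ A'.allVars) rfl
      refine ⟨.conn b A' B', by simp [hA₁, hB₁], fun C hC hpos hZ => ?_, fun w => ?_⟩
      · refine ReflTransGen.trans (Context.Derives.connRight (hB₂ _ (hC.comp ?_) ?_ ?_))
          (Context.Derives.connLeft (hA₂ _ (hC.comp ?_) ?_ ?_))
        · simp [Context.Accessible]
        · simp [Context.positive_comp, Context.pol, hpos]
        · simpa [Context.allVars_comp, Context.allVars] using Finset.union_subset_union_left hZ
        · simp [Context.Accessible]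
        · simp [Context.positive_comp, Context.pol, hpos]
        · simpa [Context.allVars_comp, Context.allVars] using Finset.union_subset_union_left hZ
      · cases b
        exacts [(hA₃ w).and (hB₃ w), (hA₃ w).or (hB₃ w)]
    | quant b x A _ =>
      rw [Formula.size_quant] at hn
      rw [Formula.unnested_quant] at hP
      -- One fresh variable serves for both kinds of quantifiers: as the term for a γ-quantifier and
      -- as the eigenvariable of a δ-quantifier.
      obtain ⟨v, hv⟩ := Infinite.exists_notMem_finset (Z ∪ A.allVars)
      rw [Finset.mem_union, not_or] at hv
      obtain ⟨A', h₁, h₂, h₃⟩ := ih A.size (by omega) (A.subst x (.var v)) (hP.2.subst _ _) pos Z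
        (Formula.size_subst _ _ _)
      refine ⟨A', h₁, fun C hC hpos hZ => (h₂ C hC hpos hZ).trans ?_, fun w => ?_⟩
      · rcases Formula.quant_cases b pos with rfl | rfl
        · refine Context.derives_gamma hC hpos hP.1 fun z hz hzA => ?_
          rw [Term.varFinset, Finset.mem_singleton] at hz
          exact hv.2 (hz ▸ A.boundVars_subset_allVars z hzA)
        · exact Context.derives_delta hC hpos hP.1 (fun h => hv.1 (hZ h)) hv.2
      -- Nothing is claimed about the truth of the instance: a quantified formula counts as false at
      -- positive and as true at negative positions.
      · rw [Formula.lowerTruth_quant]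
        cases pos
        exacts [fun _ => rfl, fun h => absurd h (by simp)]

namespace Naming

variable (N : Naming L)

theorem unnested_state (ts : List (ExtTerm L)) (pos : Bool) (as : List (ExtTerm L))
    (σ : ℕ → ExtTerm L) {A : Formula L} (hA : A.Unnested) : (N.state ts pos as σ A).Unnested := by
  induction A using Formula.induct generalizing pos as σ with
  | atom R us => trivial
  | neg A ih => exact ih (!pos) as σ hA
  | conn b A B ihA ihB =>
    rw [Formula.unnested_conn] at hA
    simp [state_conn, ihA _ _ _ hA.1, ihB _ _ _ hA.2]
  | quant b x A ih =>
    rw [Formula.unnested_quant] at hA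
    rcases Formula.quant_cases b pos with rfl | rfl
    · rw [state_gamma]
      have : ∀ l' : List (ExtTerm L), (l'.foldr (fun t acc => Formula.conn b
          (N.state ts b (as ++ [t]) (update σ x t) A) acc)
          (.quant b x (A.ssubst (update (fun z => N.rho (σ z)) x (.var x))))).Unnested := by
        intro l'
        induction l' with
        | nil => simp [Formula.boundVars_ssubst, hA.1, hA.2.ssubst]
        | cons t l' ih' => simp [ih _ _ _ hA.2, ih']
      exact this ts
    · rw [state_delta]
      exact ih _ _ _ hA.2

/-- The valuation of the extended language that reads Skolem terms as their names. -/
def valuation (w : ∀ k, L.Relations k → (Fin k → L.Term ℕ) → Prop) :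
    ∀ k, (Ext L).Relations k → (Fin k → ExtTerm L) → Prop
  | k, Sum.inl R, ts => w k R fun i => N.rho (ts i)
  | _, Sum.inr e, _ => Empty.elim e

/-- A kept γ-formula is the false last member of a positive disjunction or the true last member of a
negative conjunction, so it is neutral. What remains is the expansion over `ts`, with Skolem terms
read as their names. -/
theorem lowerTruth_state (w : ∀ k, L.Relations k → (Fin k → L.Term ℕ) → Prop)
    (ts : List (ExtTerm L)) (pos : Bool) (as : List (ExtTerm L)) (σ : ℕ → ExtTerm L)
    (A : Formula L) : (N.state ts pos as σ A).LowerTruth w pos ↔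
      SkolemTruth (N.valuation w) {t | t ∈ ts} pos as σ A := by
  induction A using Formula.induct generalizing pos as σ with
  | atom R us =>
    simp only [state, Formula.LowerTruth, SkolemTruth, valuation]
    rw [show (fun i => (us i).subst fun z => N.rho (σ z)) =
      fun i => N.rho ((liftTerm (us i)).subst σ) from funext fun i =>
        (unskolem_liftTerm_subst _ _ _ _).symm]
  | neg A ih => exact not_congr (ih _ _ _)
  | conn b A B ihA ihB => rw [state_conn, Formula.lowerTruth_conn, ihA, ihB, skolemTruth_conn]
  | quant b x A ih =>
    rcases Formula.quant_cases b pos with rfl | rfl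
    · rw [state_gamma, skolemTruth_gamma]
      have : ∀ l : List (ExtTerm L), (l.foldr (fun t acc => Formula.conn b
          (N.state ts b (as ++ [t]) (update σ x t) A) acc)
          (.quant b x (A.ssubst (update (fun z => N.rho (σ z)) x (.var x))))).LowerTruth w b ↔
          if b then ∃ t ∈ l, SkolemTruth (N.valuation w) {t | t ∈ ts} b (as ++ [t]) (update σ x t) A
          else ∀ t ∈ l, SkolemTruth (N.valuation w) {t | t ∈ ts} b (as ++ [t]) (update σ x t) A := by
        intro l
        induction l with
        | nil => cases b <;> simp [Formula.lowerTruth_quant]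
        | cons t l ihl =>
          rw [List.foldr_cons, Formula.lowerTruth_conn, ihl, ih]
          cases b <;> simp
      exact this ts
    · rw [state_delta, skolemTruth_delta, ih]

/-- If the terms are ordered by height, the state with all terms derives the formula. -/
theorem derives_of_sorted {A : Formula L} (hA : ∀ h, N.Admissible h A [] .var)
    (ts : List (ExtTerm L)) (hts : ∀ t ∈ ts, t ∈ N.terms) (hnd : ts.Nodup)
    (hsort : ts.Pairwise fun s t => termHeight s ≤ termHeight t) :
    Context.hole.Derives (N.state ts true [] .var A) A := by
  induction ts using List.reverseRecOn with
  | nil =>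
    -- With no instances left, the bound zero suffices, since every Skolem term is higher; so the
    -- whole state collapses to `A`.
    have := derives_collapse (N := N) (h := 0) (ts := []) (by simp) (by simp) (C := .hole) trivial
      rfl (hA 0) (fun y l => Nat.lt_of_lt_of_le Nat.zero_lt_one (one_le_termHeight _))
      (by simp [Context.allVars])
    have e : (fun z => N.rho (Term.var z : ExtTerm L)) = Term.var := by
      funext z
      rfl
    rwa [e, Formula.ssubst_var] at this
  | append_singleton ts t ih =>
    rw [List.pairwise_append] at hsort
    -- The last term in the order by height bounds the heights of all listed terms.
    refine (derives_advance (h := termHeight t) (C := .hole) ?_ hnd le_rfl trivial rfl (hA _)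
      (by simp [Context.allVars])).trans
      (ih (fun s hs => hts s (by simp [hs])) hnd.of_append_left hsort.1)
    intro s hs
    refine ⟨hts s hs, ?_⟩
    rw [List.mem_append, List.mem_singleton] at hs
    rcases hs with hs | rfl
    exacts [hsort.2.2 s hs t (by simp), le_rfl]

end Naming

/-- There are names for the Skolem terms over the champ fini. -/
theorem exists_naming {A : Formula L} (hA : A.Rectified) (n : ℕ) : ∃ N : Naming L,
    N.terms = champFini n A.outerSkolemizedForm ∧ ∀ h, N.Admissible h A [] .var := by
  set S := champFini n A.outerSkolemizedForm with hS
  have hcount : {p : ℕ × List (ExtTerm L) | ∀ t ∈ p.2, t ∈ S}.Countable := by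
    have : Countable S := (finite_champFini n _).countable.to_subtype
    refine (Set.countable_range fun p : ℕ × List S =>
      (p.1, p.2.map (Subtype.val : S → ExtTerm L))).mono ?_
    rintro ⟨y, l⟩ hl
    refine ⟨(y, l.attachWith _ hl), ?_⟩
    simp
  -- The champ fini is finite, so only countably many Skolem terms need distinct names, even if the
  -- language is uncountable. With `b` above all variables of `A`, the name of `•` is `b`, and the
  -- other names start at `b + 1`.
  obtain ⟨g, hg⟩ := Set.countable_iff_exists_injOn.1 hcount
  set b := A.allVars.sup id + 1 with hb
  have hlt : ∀ z ∈ A.allVars, z < b := fun z hz =>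
    Nat.lt_succ_of_le (Finset.le_sup (f := id) hz)
  let name : ℕ → List (ExtTerm L) → ℕ := fun y l => b + 1 + g (y, l)
  have inj : ∀ {y y' : ℕ} {l l' : List (ExtTerm L)}, (∀ t ∈ l, t ∈ S) → (∀ t ∈ l', t ∈ S) →
      name y l = name y' l' → y = y' ∧ l = l' := by
    intro y y' l l' hl hl' h
    have := hg (x₁ := (y, l)) (x₂ := (y', l')) hl hl' (Nat.add_left_cancel h)
    exact Prod.mk.inj this
  have hbound : ∀ z ∈ A.boundVars, z < b := fun z hz => hlt z (A.boundVars_subset_allVars z hz)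
  have hclosed : ∀ {k : ℕ} (f : (Ext L).Functions k) (ts : Fin k → ExtTerm L),
      Term.func f ts ∈ S → ∀ i, ts i ∈ S := fun f ts h i =>
    ⟨(height_arg_lt f ts i).trans h.1,
      fun z hz => h.2.1 ((mem_varFinset_func _ _ _).2 ⟨i, hz⟩),
      fun φ hφ => h.2.2 φ (.inr (Set.mem_iUnion.2 ⟨i, hφ⟩))⟩
  have hfree : ∀ t ∈ S, ∀ z ∈ t.varFinset, z ∈ A.freeVars := fun t ht z hz => by
    simpa using mem_freeVars_of_skolemizeAux (ht.2.1 hz)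
  refine ⟨⟨S, name, b, {z | z ∈ A.boundVars}, inj, ?_, ?_, ?_⟩, rfl, fun h => ?_⟩
  · intro y l hm
    have := hbound _ hm
    simp only [name] at this
    omega
  · intro t ht v hv hm
    have := hbound _ hm
    rcases mem_varFinset_unskolem hclosed ht hv with h | rfl | ⟨y, l, -, rfl, -⟩
    · exact hA.2.1 v hm (hfree t ht v h)
    · omega
    · simp only [name] at this
      omega
  · intro t ht y l hl hv
    rcases mem_varFinset_unskolem hclosed ht hv with h | h | ⟨y', l', hl', h, hh⟩
    · have := hlt _ (A.freeVars_subset_allVars (hfree t ht _ h))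
      simp only [name] at this
      omega
    · simp only [name] at h
      omega
    · obtain ⟨rfl, rfl⟩ := inj hl hl' h
      exact hh
  · refine ⟨hA.2.2, fun z hz => hz, by simp, fun z hz v hv => ?_⟩
    obtain rfl : v = z := by simpa [unskolem, Term.varFinset] using hv
    refine ⟨fun hm => hA.2.1 v hm hz, ?_⟩
    rintro ⟨y, -, l, -, -, h⟩
    have := hlt v (A.freeVars_subset_allVars hz)
    simp only [name] at h
    omega

/-- The state for the whole champ fini, listed by height, derives `A` and is itself derived from a
quantifier-free formula. The latter is true under every valuation of the original language, because
the expansion is true under the valuation that reads Skolem terms as names. -/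
theorem Formula.HasPropertyC.derives {A : Formula L} (hA : A.Rectified) {n : ℕ}
    (h : A.HasPropertyC n) :
    ∃ B : Formula L, B.IsSententialTautology ∧ ReflTransGen AccessibleStep B A := by
  obtain ⟨E, hE, hE'⟩ := h
  obtain ⟨N, hN, hadm⟩ := exists_naming hA n
  set F := A.outerSkolemizedForm with hF
  classical
  let ts := (finite_champFini n F).toFinset.toList.mergeSort fun s t => termHeight s ≤ termHeight t
  have hperm := List.mergeSort_perm (finite_champFini n F).toFinset.toList
    fun s t => decide (termHeight s ≤ termHeight t)
  have hmem : ∀ t, t ∈ ts ↔ t ∈ champFini n F := fun t => by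
    rw [hperm.mem_iff]
    simp
  have hd := N.derives_of_sorted hadm ts (fun t ht => hN ▸ (hmem t).1 ht)
    (hperm.nodup_iff.2 (Finset.nodup_toList _)) (by
      have := List.pairwise_mergeSort (le := fun s t : ExtTerm L =>
        decide (termHeight s ≤ termHeight t)) (by simpa using fun a b c => le_trans)
        (by simpa using fun a b => le_total _ _) (finite_champFini n F).toFinset.toList
      simpa using this)
  obtain ⟨B, h₁, h₂, h₃⟩ := exists_quantifierFree_derives (N.state ts true [] .var A)
    (N.unnested_state _ _ _ _ (Formula.unnested_of_nodup hA.2.2)) true ∅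
  refine ⟨B, ⟨h₁, fun w => h₃ w ?_⟩, (h₂ .hole trivial rfl (by simp [Context.allVars])).trans hd⟩
  rw [N.lowerTruth_state, show {t | t ∈ ts} = champFini n F from Set.ext hmem,
    ← skolemTruth_of_isExpansion hA hE]
  exact hE'.2 _

end Herbrand

/-! ### Derivations as lists of strings, unique readability, and rule systems on strings. -/

namespace Herbrand

open FirstOrder Language Function Relation

variable {L : FirstOrder.Language.{u, v}}

/-! ### Derivations in reverse order -/

/-- A derivation from a sentential tautology, listed from the conclusion to the tautology. -/
inductive ReverseProof : List (Formula L) → Prop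
  | tautology {B : Formula L} : B.IsSententialTautology → ReverseProof [B]
  | step {P Q : Formula L} {D : List (Formula L)} : ReverseProof (P :: D) → Step P Q →
      ReverseProof (Q :: P :: D)

theorem ReverseProof.isProof {D : List (Formula L)} (h : ReverseProof D) :
    ∀ A, D.head? = some A → IsProof D.reverse A := by
  have key : D.IsChain (fun P Q => Step Q P) ∧
      ∃ B, D.getLast? = some B ∧ B.IsSententialTautology := by
    induction h with
    | tautology hB => exact ⟨.singleton _, _, rfl, hB⟩
    | step _ hs ih =>
      obtain ⟨h₁, B, h₂, h₃⟩ := ih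
      exact ⟨List.isChain_cons_cons.2 ⟨hs, h₁⟩, B, by simpa using h₂, h₃⟩
  intro A hA
  obtain ⟨h₁, B, h₂, h₃⟩ := key
  exact ⟨B, h₃, by simpa using h₂, by simpa using hA, List.isChain_reverse.2 h₁⟩

theorem Formula.Variant.fill {A B : Formula L} (h : A.Variant B) (C : Context L) :
    (C.fill A).Variant (C.fill B) := by
  induction C with
  | hole => exact h
  | neg C ih => exact .neg ih
  | orLeft C B ih => exact .or ih (.refl _)
  | orRight B C ih => exact .or (.refl _) ih
  | andLeft C B ih => exact .and ih (.refl _)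
  | andRight B C ih => exact .and (.refl _) ih
  | ex x C ih => exact .ex x ih
  | all x C ih => exact .all x ih

theorem Step.contract {C : Context L} {b : Bool} (hC : C.positive = b) (H : Formula L) :
    Step (C.fill (.conn b H H)) (C.fill H) := by
  cases b
  exacts [.simplificationAnd C H H hC (.refl _), .simplificationOr C H H hC (.refl _)]

theorem Step.gamma {C : Context L} {b : Bool} (hC : C.Accessible) (hb : C.positive = b) {x : ℕ}
    {H : Formula L} {t : L.Term ℕ} (ht : ∀ z ∈ t.varFinset, z ∉ H.boundVars) :
    Step (C.fill (H.subst x t)) (C.fill (.quant b x H)) := by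
  cases b
  exacts [.gammaAll C x H t hC hb ht, .gammaEx C x H t hC hb ht]

theorem Step.delta {C : Context L} {b : Bool} (hC : C.Accessible) (hb : C.positive = b) {y : ℕ}
    {H : Formula L} (hy : y ∉ C.freeVars) : Step (C.fill H) (C.fill (.quant (!b) y H)) := by
  cases b
  exacts [.deltaEx C y H hC hb hy, .deltaAll C y H hC hb hy]

/-- After δ⁻-quantification over a fresh eigenvariable, this renaming restores the bound variable of
the formula to be derived. -/
theorem Step.unrename {C : Context L} {b : Bool} {x y : ℕ} {H : Formula L}
    (hf : y ∉ H.freeVars) (hb : y ∉ H.boundVars) :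
    Step (C.fill (.quant b y (H.subst x (.var y)))) (C.fill (.quant b x H)) := by
  refine .rename (Formula.Variant.fill (.symm ?_) C)
  cases b
  exacts [.renameAll hf hb, .renameEx hf hb]

/-! ### Unique readability -/

/-- A variable as a symbol. -/
abbrev Token.var (z : ℕ) : Token L := Sum.inl (Sum.inl z)

/-- A function symbol as a symbol. -/
abbrev Token.func (f : Σ n, L.Functions n) : Token L := Sum.inl (Sum.inr f)

/-- A predicate symbol as a symbol. -/
abbrev Token.rel (R : Σ n, L.Relations n) : Token L := Sum.inr (Sum.inl R)

/-- The symbol of a binary connective. -/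
def Token.conn (b : Bool) : Token L := Sum.inr (Sum.inr (if b then 1 else 2))

/-- The symbol of a quantifier. -/
def Token.quant (b : Bool) : Token L := Sum.inr (Sum.inr (if b then 3 else 4))

/-- The symbol of negation. -/
abbrev Token.neg : Token L := Sum.inr (Sum.inr 0)

/-- Strings of symbols. -/
abbrev Str (L : FirstOrder.Language.{u, v}) := List (Token L)

/-- A term as a string. -/
def termCode (t : L.Term ℕ) : Str L := t.listEncode.map Sum.inl

/-- A list of terms as a string. -/
def termsCode (l : List (L.Term ℕ)) : Str L := l.flatMap termCode

theorem termCode_var (z : ℕ) : termCode (.var z : L.Term ℕ) = [Token.var z] := rfl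

theorem termCode_func {k : ℕ} (f : L.Functions k) (ts : Fin k → L.Term ℕ) :
    termCode (.func f ts) = Token.func ⟨k, f⟩ :: termsCode (List.ofFn ts) := by
  simp [termCode, termsCode, Term.listEncode, List.map_flatMap, List.ofFn_eq_map,
    List.flatMap_map]

namespace Formula

theorem code_atom {k : ℕ} (R : L.Relations k) (ts : Fin k → L.Term ℕ) :
    (atom R ts).code = Token.rel ⟨k, R⟩ :: termsCode (List.ofFn ts) := by
  simp [code, termsCode, termCode, List.ofFn_eq_map, List.flatMap_map]

theorem code_neg (A : Formula L) : (neg A).code = Token.neg :: A.code := rfl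

theorem code_conn (b : Bool) (A B : Formula L) :
    (conn b A B).code = Token.conn b :: (A.code ++ B.code) := by
  cases b <;> rfl

theorem code_quant (b : Bool) (x : ℕ) (A : Formula L) :
    (quant b x A).code = Token.quant b :: Token.var x :: A.code := by
  cases b <;> rfl

end Formula

/-- Polish notation is readable from the left without brackets. Arbitrary remainders `s` and `s'`
are admitted so that the induction can pass through a list of arguments. -/
theorem termCode_append_injective {t t' : L.Term ℕ} {s s' : Str L}
    (h : termCode t ++ s = termCode t' ++ s') : t = t' ∧ s = s' := by
  induction t generalizing t' s s' with
  | var z =>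
    cases t' with
    | var z' => simpa [termCode_var] using h
    | func f' ts' => simp [termCode_var, termCode_func] at h
  | @func k f ts ih =>
    cases t' with
    | var z' => simp [termCode_var, termCode_func] at h
    | @func k' f' ts' =>
      simp only [termCode_func, List.cons_append, List.cons.injEq, Sum.inl.injEq,
        Sum.inr.injEq] at h
      obtain ⟨h₁, h₂⟩ := h
      obtain ⟨rfl, h₁⟩ := Sigma.mk.inj h₁
      obtain rfl := eq_of_heq h₁
      have key : ∀ (is : List (Fin k)) (s s' : Str L),
          termsCode (is.map ts) ++ s = termsCode (is.map ts') ++ s' →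
          (∀ i ∈ is, ts i = ts' i) ∧ s = s' := by
        intro is
        induction is with
        | nil => simp [termsCode]
        | cons i is ih' =>
          intro s s' h
          simp only [termsCode, List.map_cons, List.flatMap_cons, List.append_assoc] at h ih'
          obtain ⟨h₁, h₂⟩ := ih i h
          obtain ⟨h₃, h₄⟩ := ih' _ _ h₂
          exact ⟨by simpa [h₁] using h₃, h₄⟩
      rw [List.ofFn_eq_map, List.ofFn_eq_map] at h₂
      obtain ⟨h₃, h₄⟩ := key _ _ _ h₂
      exact ⟨congrArg _ (funext fun i => h₃ i (List.mem_finRange i)), h₄⟩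

theorem termsCode_append_injective {l l' : List (L.Term ℕ)} (hl : l.length = l'.length)
    {s s' : Str L} (h : termsCode l ++ s = termsCode l' ++ s') : l = l' ∧ s = s' := by
  induction l generalizing l' with
  | nil =>
    obtain rfl := List.length_eq_zero_iff.1 hl.symm
    exact ⟨rfl, h⟩
  | cons t l ih =>
    cases l' with
    | nil => simp at hl
    | cons t' l' =>
      simp only [termsCode, List.flatMap_cons, List.append_assoc] at h ih
      obtain ⟨rfl, h₁⟩ := termCode_append_injective h
      obtain ⟨rfl, h₂⟩ := ih (by simpa using hl) h₁
      exact ⟨rfl, h₂⟩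

theorem Formula.code_append_injective {A B : Formula L} {s s' : Str L}
    (h : A.code ++ s = B.code ++ s') : A = B ∧ s = s' := by
  induction A generalizing B s s' with
  | @atom k R ts =>
    cases B with
    | @atom k' R' ts' =>
      rw [code_atom, code_atom] at h
      simp only [List.cons_append, List.cons.injEq, Sum.inr.injEq, Sum.inl.injEq] at h
      obtain ⟨h₁, h₂⟩ := h
      obtain ⟨rfl, h₁⟩ := Sigma.mk.inj h₁
      obtain rfl := eq_of_heq h₁
      obtain ⟨h₃, h₄⟩ := termsCode_append_injective (by simp) h₂
      exact ⟨congrArg _ (List.ofFn_injective h₃), h₄⟩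
    | _ => simp [code] at h
  | neg A ih =>
    cases B with
    | neg B =>
      obtain ⟨rfl, h₁⟩ := ih (List.cons.inj h).2
      exact ⟨rfl, h₁⟩
    | _ => simp [code] at h
  | or A₁ A₂ ih₁ ih₂ =>
    cases B with
    | or B₁ B₂ =>
      simp only [code, List.cons_append, List.append_assoc, List.cons.injEq, true_and] at h
      obtain ⟨rfl, h₁⟩ := ih₁ h
      obtain ⟨rfl, h₂⟩ := ih₂ h₁
      exact ⟨rfl, h₂⟩
    | _ => simp [code] at h
  | and A₁ A₂ ih₁ ih₂ =>
    cases B with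
    | and B₁ B₂ =>
      simp only [code, List.cons_append, List.append_assoc, List.cons.injEq, true_and] at h
      obtain ⟨rfl, h₁⟩ := ih₁ h
      obtain ⟨rfl, h₂⟩ := ih₂ h₁
      exact ⟨rfl, h₂⟩
    | _ => simp [code] at h
  | ex x A ih =>
    cases B with
    | ex y B =>
      simp only [code, List.cons_append, List.cons.injEq, true_and, Sum.inl.injEq] at h
      obtain ⟨rfl, h₁⟩ := h
      obtain ⟨rfl, h₂⟩ := ih h₁
      exact ⟨rfl, h₂⟩
    | _ => simp [code] at h
  | all x A ih =>
    cases B with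
    | all y B =>
      simp only [code, List.cons_append, List.cons.injEq, true_and, Sum.inl.injEq] at h
      obtain ⟨rfl, h₁⟩ := h
      obtain ⟨rfl, h₂⟩ := ih h₁
      exact ⟨rfl, h₂⟩
    | _ => simp [code] at h

theorem Formula.code_injective : Injective (Formula.code : Formula L → Str L) := fun A B h =>
  (code_append_injective (s := []) (s' := []) (by rw [h])).1

theorem var_mem_termCode {z : ℕ} {t : L.Term ℕ} :
    Token.var z ∈ termCode t ↔ z ∈ t.varFinset := by
  induction t with
  | var y => simp [termCode_var, Term.varFinset]
  | func f ts ih => simp [termCode_func, termsCode, List.mem_ofFn', ih]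

/-- A string also shows the bound variables, so disjointness of strings expresses freshness with
respect to all variables of a formula. -/
theorem Formula.var_mem_code {z : ℕ} {A : Formula L} :
    Token.var z ∈ A.code ↔ z ∈ A.allVars := by
  induction A using Formula.induct with
  | atom R ts => simp [code_atom, allVars, termsCode, List.mem_ofFn', var_mem_termCode]
  | neg A ih => simp [code_neg, allVars, ih]
  | conn b A B ihA ihB => simp [code_conn, ihA, ihB, Token.conn]
  | quant b x A ih => simp [code_quant, ih, Token.quant]

/-! ### Systems of rules on strings -/

/-- The parts of string patterns: a parameter, a fixed symbol, or the arity of the first symbol of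
a parameter (as a unary number). -/
inductive Piece (L : FirstOrder.Language.{u, v}) : Type (max u v)
  | par (i : ℕ) : Piece L
  | tok (a : Token L) : Piece L
  | ar (i : ℕ) : Piece L

/-- Patterns of strings. -/
abbrev Pattern (L : FirstOrder.Language.{u, v}) := List (Piece L)

/-- A natural number in unary notation. -/
def unary (n : ℕ) : Str L := (List.range n).map fun _ => Token.var 0

theorem unary_succ (n : ℕ) : (unary (n + 1) : Str L) = Token.var 0 :: unary n := by
  simp [unary, List.replicate_succ]

/-- The arity of a symbol. -/
def tokenArity : Token L → ℕ
  | Sum.inl (Sum.inl _) => 0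
  | Sum.inl (Sum.inr f) => f.1
  | Sum.inr (Sum.inl R) => R.1
  | Sum.inr (Sum.inr _) => 0

/-- The kind of a symbol. -/
def tokenKind : Token L → ℕ
  | Sum.inl (Sum.inl _) => 1
  | Sum.inl (Sum.inr _) => 2
  | Sum.inr (Sum.inl _) => 3
  | Sum.inr (Sum.inr _) => 4

/-- The kind of a string: the kind of its symbol if there is exactly one. -/
def strKind (s : Str L) : ℕ := if s.length = 1 then (s.head?.map tokenKind).getD 0 else 0

/-- The arity of the first symbol of a string. -/
def strArity (s : Str L) : ℕ := (s.head?.map tokenArity).getD 0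

theorem strKind_eq_one {s : Str L} (h : strKind s = 1) : ∃ z, s = [Token.var z] := by
  rcases s with _ | ⟨a, _ | ⟨b, s⟩⟩
  · simp [strKind] at h
  · rcases a with (z | f) | (R | i) <;> simp [strKind, tokenKind] at h ⊢
  · simp [strKind] at h

theorem strKind_eq_two {s : Str L} (h : strKind s = 2) :
    ∃ (k : ℕ) (f : L.Functions k), s = [Token.func ⟨k, f⟩] := by
  rcases s with _ | ⟨a, _ | ⟨b, s⟩⟩
  · simp [strKind] at h
  · rcases a with (z | ⟨k, f⟩) | (R | i) <;> simp [strKind, tokenKind] at h ⊢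
  · simp [strKind] at h

theorem strKind_eq_three {s : Str L} (h : strKind s = 3) :
    ∃ (k : ℕ) (R : L.Relations k), s = [Token.rel ⟨k, R⟩] := by
  rcases s with _ | ⟨a, _ | ⟨b, s⟩⟩
  · simp [strKind] at h
  · rcases a with (z | f) | (⟨k, R⟩ | i) <;> simp [strKind, tokenKind] at h ⊢
  · simp [strKind] at h

/-- The string that is denoted by a part of a pattern. -/
def Piece.eval (P : ℕ → Str L) : Piece L → Str L
  | .par i => P i
  | .tok a => [a]
  | .ar i => unary (strArity (P i))

/-- The string that is denoted by a pattern. -/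
def Pattern.eval (P : ℕ → Str L) : Pattern L → Str L
  | [] => []
  | a :: e => a.eval P ++ Pattern.eval P e

/-- Facts: a tag, a list of arguments, and an environment. -/
abbrev Fact (L : FirstOrder.Language.{u, v}) := ℕ × List (Str L) × List (Str L)

/-- Patterns of facts; if `keep` holds, then the environment ends with a parameter. -/
structure FactPattern (L : FirstOrder.Language.{u, v}) where
  /-- the tag -/
  tag : ℕ
  /-- the patterns of the arguments -/
  args : List (Pattern L)
  /-- the patterns of the first elements of the environment -/
  env : List (Pattern L) := []
  /-- whether the environment ends with the environment parameter -/
  keep : Bool := false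

/-- The fact that is denoted by a pattern. -/
def FactPattern.eval (P : ℕ → Str L) (σ : List (Str L)) (f : FactPattern L) : Fact L :=
  (f.tag, f.args.map (Pattern.eval P), f.env.map (Pattern.eval P) ++ if f.keep then σ else [])

/-- Rules: premises, a conclusion, pairs of parameters that may have no symbol in common, and
kinds of parameters. -/
structure Rule (L : FirstOrder.Language.{u, v}) where
  /-- the premises -/
  prems : List (FactPattern L)
  /-- the conclusion -/
  concl : FactPattern L
  /-- the parameters that may have no symbol in common -/
  disj : List (ℕ × ℕ) := []
  /-- the parameters of given kinds -/
  kinds : List (ℕ × ℕ) := []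

/-- The side conditions of a rule. -/
def Rule.Side (r : Rule L) (P : ℕ → Str L) : Prop :=
  (∀ d ∈ r.disj, ∀ a ∈ P d.1, a ∉ P d.2) ∧ ∀ d ∈ r.kinds, strKind (P d.1) = d.2

/-- The parameters that are given by a list. -/
def params (p : List (Str L)) (i : ℕ) : Str L := p.getD i []

/-- Derivability by means of a list of rules. -/
inductive Derivable (rules : List (Rule L)) : Fact L → Prop
  | mk {r : Rule L} (hr : r ∈ rules) (p σ : List (Str L)) (hside : r.Side (params p))
      (hprems : ∀ f ∈ r.prems, Derivable rules (f.eval (params p) σ)) :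
      Derivable rules (r.concl.eval (params p) σ)

end Herbrand

/-! ### The rules for terms, substitution, tautologies and derivations, and their soundness. -/

namespace Herbrand

open FirstOrder.Language (Term)
open Function Relation

variable {L : FirstOrder.Language.{u, v}}

/-! ### The rules for derivations -/

/-- Truth values as symbols. -/
def Token.bool (b : Bool) : Token L := Token.var (if b then 1 else 0)

theorem Token.bool_injective : Injective (Token.bool : Bool → Token L) := by
  intro b b' h
  cases b <;> cases b' <;> simp_all [Token.bool]

namespace FactPattern

variable (u x t s s' h h' : Pattern L) (b : Bool) (e : List (Pattern L))

/-- `s` is a list of terms of length `u`. -/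
abbrev terms : FactPattern L := { tag := 0, args := [u, s] }

/-- `h` is a formula. -/
abbrev formula : FactPattern L := { tag := 1, args := [h] }

/-- `s` and `s'` are the parts of an accessible context before and after the hole; `b` tells whether
the hole is positive. -/
abbrev context : FactPattern L := { tag := 2, args := [[.tok (Token.bool b)], s, s'] }

/-- `s'` results from the list `s` of terms of length `u` by replacing `x` with `t`. -/
abbrev substTerms : FactPattern L := { tag := 3, args := [u, x, t, s, s'] }

/-- `h'` results from the formula `h` by replacing `x` with `t`, without captures. -/
abbrev substFormula : FactPattern L := { tag := 4, args := [x, t, h, h'] }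

/-- `h` is a quantifier-free formula with value `b` in the environment. -/
abbrev value : FactPattern L :=
  { tag := 5, args := [[.tok (Token.bool b)], h], env := e, keep := true }

/-- `h` is a quantifier-free formula that is true under all extensions of the environment. -/
abbrev tautology : FactPattern L := { tag := 6, args := [h], env := e, keep := true }

/-- The environment is a derivation in reverse order. -/
abbrev derivation : FactPattern L := { tag := 7, args := [], env := e, keep := true }

end FactPattern

namespace Rule

open FactPattern

variable (L) (b c d : Bool)

/-- The empty list of terms. -/
def termsNil : Rule L := { prems := [], concl := terms [] [] }

/-- A list of terms that starts with a variable. -/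
def termsVar : Rule L :=
  { prems := [terms [.par 0] [.par 1]]
    concl := terms [.tok (Token.var 0), .par 0] [.par 2, .par 1]
    kinds := [(2, 1)] }

/-- A list of terms that starts with a compound term. -/
def termsFunc : Rule L :=
  { prems := [terms [.ar 0] [.par 1], terms [.par 2] [.par 3]]
    concl := terms [.tok (Token.var 0), .par 2] [.par 0, .par 1, .par 3]
    kinds := [(0, 2)] }

/-- Atomic formulas. -/
def formulaAtom : Rule L :=
  { prems := [terms [.ar 0] [.par 1]]
    concl := formula [.par 0, .par 1]
    kinds := [(0, 3)] }

/-- Negations. -/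
def formulaNeg : Rule L :=
  { prems := [formula [.par 0]]
    concl := formula [.tok Token.neg, .par 0] }

/-- Disjunctions and conjunctions. -/
def formulaConn : Rule L :=
  { prems := [formula [.par 0], formula [.par 1]]
    concl := formula [.tok (Token.conn b), .par 0, .par 1] }

/-- Quantified formulas. -/
def formulaQuant : Rule L :=
  { prems := [formula [.par 0]]
    concl := formula [.tok (Token.quant b), .par 1, .par 0]
    kinds := [(1, 1)] }

/-- The empty context. -/
def contextHole : Rule L := { prems := [], concl := context [] [] true }

/-- Contexts for negations. -/
def contextNeg : Rule L :=
  { prems := [context [.par 0] [.par 1] b]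
    concl := context [.tok Token.neg, .par 0] [.par 1] (!b) }

/-- Contexts with the hole in a left argument. -/
def contextLeft : Rule L :=
  { prems := [context [.par 0] [.par 1] b, formula [.par 2]]
    concl := context [.tok (Token.conn c), .par 0] [.par 1, .par 2] b }

/-- Contexts with the hole in a right argument. -/
def contextRight : Rule L :=
  { prems := [context [.par 0] [.par 1] b, formula [.par 2]]
    concl := context [.tok (Token.conn c), .par 2, .par 0] [.par 1] b }

/-- Substitution in the empty list of terms. -/
def substNil : Rule L :=
  { prems := [terms [.tok (Token.var 0)] [.par 1]]
    concl := substTerms [] [.par 0] [.par 1] [] []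
    kinds := [(0, 1)] }

/-- Substitution in a list of terms that starts with the variable to be replaced. -/
def substEq : Rule L :=
  { prems := [substTerms [.par 0] [.par 1] [.par 2] [.par 3] [.par 4]]
    concl := substTerms [.tok (Token.var 0), .par 0] [.par 1] [.par 2] [.par 1, .par 3]
      [.par 2, .par 4] }

/-- Substitution in a list of terms that starts with another variable. -/
def substNe : Rule L :=
  { prems := [substTerms [.par 0] [.par 1] [.par 2] [.par 3] [.par 4]]
    concl := substTerms [.tok (Token.var 0), .par 0] [.par 1] [.par 2] [.par 5, .par 3]
      [.par 5, .par 4]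
    disj := [(5, 1)]
    kinds := [(5, 1)] }

/-- Substitution in a list of terms that starts with a compound term. -/
def substFunc : Rule L :=
  { prems := [substTerms [.ar 5] [.par 1] [.par 2] [.par 3] [.par 4],
      substTerms [.par 0] [.par 1] [.par 2] [.par 6] [.par 7]]
    concl := substTerms [.tok (Token.var 0), .par 0] [.par 1] [.par 2] [.par 5, .par 3, .par 6]
      [.par 5, .par 4, .par 7]
    kinds := [(5, 2)] }

/-- Substitution in an atomic formula. -/
def substAtom : Rule L :=
  { prems := [substTerms [.ar 0] [.par 1] [.par 2] [.par 3] [.par 4]]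
    concl := substFormula [.par 1] [.par 2] [.par 0, .par 3] [.par 0, .par 4]
    kinds := [(0, 3)] }

/-- Substitution in a negation. -/
def substNeg : Rule L :=
  { prems := [substFormula [.par 0] [.par 1] [.par 2] [.par 3]]
    concl := substFormula [.par 0] [.par 1] [.tok Token.neg, .par 2] [.tok Token.neg, .par 3] }

/-- Substitution in a disjunction or conjunction. -/
def substConn : Rule L :=
  { prems := [substFormula [.par 0] [.par 1] [.par 2] [.par 3],
      substFormula [.par 0] [.par 1] [.par 4] [.par 5]]
    concl := substFormula [.par 0] [.par 1] [.tok (Token.conn b), .par 2, .par 4]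
      [.tok (Token.conn b), .par 3, .par 5] }

/-- Substitution in a quantified formula. -/
def substQuant : Rule L :=
  { prems := [substFormula [.par 0] [.par 1] [.par 2] [.par 3]]
    concl := substFormula [.par 0] [.par 1] [.tok (Token.quant b), .par 4, .par 2]
      [.tok (Token.quant b), .par 4, .par 3]
    disj := [(4, 0), (4, 1)]
    kinds := [(4, 1)] }

/-- The value of an atomic formula. -/
def valueAtom : Rule L :=
  { prems := [terms [.ar 0] [.par 1]]
    concl := value [.par 0, .par 1] b [[.tok (Token.bool b), .par 0, .par 1]]
    kinds := [(0, 3)] }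

/-- Weakening of the environment. -/
def valueWeaken : Rule L :=
  { prems := [value [.par 0] b []]
    concl := value [.par 0] b [[.par 1]] }

/-- The value of a negation. -/
def valueNeg : Rule L :=
  { prems := [value [.par 0] b []]
    concl := value [.tok Token.neg, .par 0] (!b) [] }

/-- The value of a disjunction or conjunction. -/
def valueConn : Rule L :=
  { prems := [value [.par 0] b [], value [.par 1] c []]
    concl := value [.tok (Token.conn d), .par 0, .par 1] (if d then b || c else b && c) [] }

/-- True formulas. -/
def tautologyValue : Rule L :=
  { prems := [value [.par 0] true []]
    concl := tautology [.par 0] [] }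

/-- Distinction of two cases. -/
def tautologySplit : Rule L :=
  { prems := [tautology [.par 0] [[.tok (Token.bool true), .par 1]],
      tautology [.par 0] [[.tok (Token.bool false), .par 1]]]
    concl := tautology [.par 0] [] }

/-- The first formula of a derivation. -/
def derivationInit : Rule L :=
  { prems := [{ tag := 6, args := [[.par 0]] }]
    concl := { tag := 7, args := [], env := [[.par 0]] } }

/-- Contraction. -/
def derivationContract : Rule L :=
  { prems := [derivation [[.par 0, .tok (Token.conn b), .par 1, .par 1, .par 2]],
      context [.par 0] [.par 2] b, formula [.par 1]]
    concl := derivation [[.par 0, .par 1, .par 2],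
      [.par 0, .tok (Token.conn b), .par 1, .par 1, .par 2]] }

/-- γ-quantification. -/
def derivationGamma : Rule L :=
  { prems := [derivation [[.par 0, .par 2, .par 5]], context [.par 0] [.par 5] b,
      substFormula [.par 3] [.par 4] [.par 1] [.par 2]]
    concl := derivation [[.par 0, .tok (Token.quant b), .par 3, .par 1, .par 5],
      [.par 0, .par 2, .par 5]] }

/-- δ-quantification, followed by a renaming of the bound variable. -/
def derivationDelta : Rule L :=
  { prems := [derivation [[.par 0, .par 2, .par 5]], context [.par 0] [.par 5] b,
      substFormula [.par 3] [.par 4] [.par 1] [.par 2]]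
    concl := derivation [[.par 0, .tok (Token.quant (!b)), .par 3, .par 1, .par 5],
      [.par 0, .tok (Token.quant (!b)), .par 4, .par 2, .par 5], [.par 0, .par 2, .par 5]]
    disj := [(4, 0), (4, 1), (4, 5)]
    kinds := [(4, 1)] }

/-- All rules, for given truth values. -/
def instances : List (Rule L) :=
  [termsNil L, termsVar L, termsFunc L, formulaAtom L, formulaNeg L, formulaConn L b,
    formulaQuant L b, contextHole L, contextNeg L b, contextLeft L b c, contextRight L b c,
    substNil L, substEq L, substNe L, substFunc L, substAtom L, substNeg L, substConn L b,
    substQuant L b, valueAtom L b, valueWeaken L b, valueNeg L b, valueConn L b c d,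
    tautologyValue L, tautologySplit L, derivationInit L, derivationContract L b,
    derivationGamma L b, derivationDelta L b]

/-- All rules. -/
def all : List (Rule L) :=
  [true, false].flatMap fun b => [true, false].flatMap fun c => [true, false].flatMap fun d =>
    instances L b c d

theorem mem_all {r : Rule L} : r ∈ all L ↔ ∃ b c d, r ∈ instances L b c d := by
  simp only [all, List.mem_flatMap]
  constructor
  · rintro ⟨b, -, c, -, d, -, h⟩
    exact ⟨b, c, d, h⟩
  · rintro ⟨b, c, d, h⟩
    exact ⟨b, by simp, c, by simp, d, by simp, h⟩

end Rule

/-! ### Soundness of the rules -/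

/-- A valuation of strings that agrees with an environment. -/
def Agrees (w : Str L → Prop) (σ : List (Str L)) : Prop :=
  ∀ b a, (Token.bool b :: a) ∈ σ → (w a ↔ b = true)

/-- The valuation of atomic formulas that is given by a valuation of strings. -/
def atomValue (w : Str L → Prop) (k : ℕ) (R : L.Relations k) (ts : Fin k → L.Term ℕ) : Prop :=
  w (Formula.atom R ts).code

/-- The meaning of facts. -/
def Fact.Holds : Fact L → Prop
  | (0, [u, s], _) => ∃ l : List (L.Term ℕ), u = unary l.length ∧ s = termsCode l
  | (1, [h], _) => ∃ H : Formula L, h = H.code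
  | (2, [b, s, s'], _) => ∃ C : Context L, C.Accessible ∧ b = [Token.bool C.positive] ∧
      (∀ H, (C.fill H).code = s ++ (H.code ++ s')) ∧
      ∀ z ∈ C.allVars, Token.var z ∈ s ∨ Token.var z ∈ s'
  | (3, [u, x, t, s, s'], _) => ∃ (z : ℕ) (r : L.Term ℕ) (l : List (L.Term ℕ)),
      x = [Token.var z] ∧ t = termCode r ∧ u = unary l.length ∧ s = termsCode l ∧
      s' = termsCode (l.map (termSubst z r))
  | (4, [x, t, h, h'], _) => ∃ (z : ℕ) (r : L.Term ℕ) (H : Formula L),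
      x = [Token.var z] ∧ t = termCode r ∧ h = H.code ∧ h' = (H.subst z r).code ∧
      ∀ y ∈ r.varFinset, y ∉ H.boundVars
  | (5, [b, h], σ) => ∃ (H : Formula L) (c : Bool), h = H.code ∧ H.QuantifierFree ∧
      b = [Token.bool c] ∧ ∀ w, Agrees w σ → (H.Truth (atomValue w) ↔ c = true)
  | (6, [h], σ) => ∃ H : Formula L, h = H.code ∧ H.QuantifierFree ∧
      ∀ w, Agrees w σ → H.Truth (atomValue w)
  | (7, [], σ) => ∃ D : List (Formula L), σ = D.map Formula.code ∧ ReverseProof D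
  | _ => False

/-- A rule is sound if it preserves truth of facts. -/
def Rule.Sound (r : Rule L) : Prop :=
  ∀ (P : ℕ → Str L) (σ : List (Str L)), r.Side P →
    (∀ f ∈ r.prems, (f.eval P σ).Holds) → (r.concl.eval P σ).Holds

theorem length_unary (n : ℕ) : (unary n : Str L).length = n := by simp [unary]

theorem unary_injective : Injective (unary : ℕ → Str L) := fun m n h => by
  simpa [length_unary] using congrArg List.length h

theorem termCode_injective : Injective (termCode : L.Term ℕ → Str L) := fun t t' h =>
  (termCode_append_injective (s := []) (s' := []) (by rw [h])).1

theorem termsCode_nil : termsCode ([] : List (L.Term ℕ)) = [] := rfl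

theorem termsCode_cons (t : L.Term ℕ) (l : List (L.Term ℕ)) :
    termsCode (t :: l) = termCode t ++ termsCode l := rfl

theorem exists_eq_ofFn {α : Type*} {l : List α} {k : ℕ} (h : unary k = (unary l.length : Str L)) :
    ∃ ts : Fin k → α, l = List.ofFn ts := by
  obtain rfl := unary_injective h
  exact ⟨l.get, (List.ofFn_get l).symm⟩

theorem termSubst_func {x : ℕ} {t : L.Term ℕ} {k : ℕ} (f : L.Functions k) (ts : Fin k → L.Term ℕ) :
    termSubst x t (.func f ts) = .func f fun i => termSubst x t (ts i) := rfl

theorem termSubst_var_self (x : ℕ) (t : L.Term ℕ) : termSubst x t (.var x) = t := by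
  simp [termSubst, Term.subst]

theorem termSubst_var_ne {x z : ℕ} (t : L.Term ℕ) (h : z ≠ x) :
    termSubst x t (.var z) = .var z := by
  simp [termSubst, Term.subst, h]

theorem exists_eq_singleton {t : Str L} {l : List (L.Term ℕ)}
    (h : [Token.var 0] = (unary l.length : Str L)) (ht : t = termsCode l) :
    ∃ r : L.Term ℕ, t = termCode r := by
  have hl : l.length = 1 := by simpa [length_unary] using (congrArg List.length h).symm
  obtain ⟨r, rfl⟩ := List.length_eq_one_iff.1 hl
  exact ⟨r, by simp [ht, termsCode]⟩

theorem strArity_func {k : ℕ} (f : L.Functions k) : strArity [Token.func ⟨k, f⟩] = k := rfl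

theorem strArity_rel {k : ℕ} (R : L.Relations k) : strArity [Token.rel ⟨k, R⟩] = k := rfl

namespace Formula

theorem truth_conn (w : ∀ k, L.Relations k → (Fin k → L.Term ℕ) → Prop) (b : Bool)
    (A B : Formula L) : (conn b A B).Truth w ↔
      if b then A.Truth w ∨ B.Truth w else A.Truth w ∧ B.Truth w := by
  cases b <;> simp [conn, Truth]

end Formula

namespace Rule

variable (b c d : Bool)

theorem termsNil_sound : (termsNil L).Sound := fun _ _ _ _ => ⟨[], rfl, rfl⟩

theorem termsVar_sound : (termsVar L).Sound := by
  intro P σ hs hp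
  simp only [termsVar, Side, List.forall_mem_cons, FactPattern.eval, List.map_cons, List.map_nil,
    Pattern.eval, Piece.eval, List.append_nil, List.cons_append, List.nil_append,
    Bool.false_eq_true, if_false, Fact.Holds] at hs hp ⊢
  obtain ⟨z, hz⟩ := strKind_eq_one hs.2.1
  obtain ⟨l, h₁, h₂⟩ := hp.1
  exact ⟨.var z :: l, by simp [h₁, unary_succ], by simp [hz, h₂, termsCode_cons, termCode_var]⟩

theorem termsFunc_sound : (termsFunc L).Sound := by
  intro P σ hs hp
  simp only [termsFunc, Side, List.forall_mem_cons, FactPattern.eval, List.map_cons, List.map_nil,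
    Pattern.eval, Piece.eval, List.append_nil, List.cons_append, List.nil_append,
    Bool.false_eq_true, if_false, Fact.Holds] at hs hp ⊢
  obtain ⟨k, f, hf⟩ := strKind_eq_two hs.2.1
  obtain ⟨⟨l₁, h₁, h₂⟩, ⟨l₂, h₃, h₄⟩, -⟩ := hp
  rw [hf, strArity_func] at h₁
  obtain ⟨ts, rfl⟩ := exists_eq_ofFn h₁
  exact ⟨.func f ts :: l₂, by simp [h₃, unary_succ],
    by simp [hf, h₂, h₄, termsCode_cons, termCode_func]⟩

theorem formulaAtom_sound : (formulaAtom L).Sound := by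
  intro P σ hs hp
  simp only [formulaAtom, Side, List.forall_mem_cons, FactPattern.eval, List.map_cons,
    List.map_nil, Pattern.eval, Piece.eval, List.append_nil, Bool.false_eq_true, if_false,
    Fact.Holds] at hs hp ⊢
  obtain ⟨k, R, hR⟩ := strKind_eq_three hs.2.1
  obtain ⟨⟨l, h₁, h₂⟩, -⟩ := hp
  rw [hR, strArity_rel] at h₁
  obtain ⟨ts, rfl⟩ := exists_eq_ofFn h₁
  exact ⟨.atom R ts, by simp [hR, h₂, Formula.code_atom]⟩

theorem formulaNeg_sound : (formulaNeg L).Sound := by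
  intro P σ hs hp
  simp only [formulaNeg, Side, List.forall_mem_cons, FactPattern.eval, List.map_cons,
    List.map_nil, Pattern.eval, Piece.eval, List.append_nil, List.cons_append, List.nil_append,
    Bool.false_eq_true, if_false, Fact.Holds] at hs hp ⊢
  obtain ⟨⟨H, h⟩, -⟩ := hp
  exact ⟨.neg H, by rw [h, Formula.code_neg]⟩

theorem formulaConn_sound : (formulaConn L b).Sound := by
  intro P σ hs hp
  simp only [formulaConn, Side, List.forall_mem_cons, FactPattern.eval, List.map_cons,
    List.map_nil, Pattern.eval, Piece.eval, List.append_nil, List.cons_append, List.nil_append,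
    Bool.false_eq_true, if_false, Fact.Holds] at hs hp ⊢
  obtain ⟨⟨H, h⟩, ⟨H', h'⟩, -⟩ := hp
  exact ⟨.conn b H H', by rw [h, h', Formula.code_conn]⟩

theorem formulaQuant_sound : (formulaQuant L b).Sound := by
  intro P σ hs hp
  simp only [formulaQuant, Side, List.forall_mem_cons, FactPattern.eval, List.map_cons,
    List.map_nil, Pattern.eval, Piece.eval, List.append_nil, List.cons_append, List.nil_append,
    Bool.false_eq_true, if_false, Fact.Holds] at hs hp ⊢
  obtain ⟨z, hz⟩ := strKind_eq_one hs.2.1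
  obtain ⟨⟨H, h⟩, -⟩ := hp
  exact ⟨.quant b z H, by simp [hz, h, Formula.code_quant]⟩

theorem contextHole_sound : (contextHole L).Sound := fun _ _ _ _ =>
  ⟨.hole, trivial, rfl, fun H => by simp [Context.fill, Pattern.eval], by simp [Context.allVars]⟩

theorem contextNeg_sound : (contextNeg L b).Sound := by
  intro P σ hs hp
  simp only [contextNeg, Side, List.forall_mem_cons, FactPattern.eval, List.map_cons,
    List.map_nil, Pattern.eval, Piece.eval, List.append_nil, List.cons_append, List.nil_append,
    Bool.false_eq_true, if_false, Fact.Holds] at hs hp ⊢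
  obtain ⟨⟨C, hC, hb, hf, hv⟩, -⟩ := hp
  refine ⟨.neg C, hC, ?_, fun H => ?_, fun z hz => ?_⟩
  · rw [Token.bool_injective (List.singleton_inj.1 hb), Context.positive]
  · rw [Context.fill, Formula.code_neg, hf]
  · simpa using hv z hz

theorem contextLeft_sound : (contextLeft L b c).Sound := by
  intro P σ hs hp
  simp only [contextLeft, Side, List.forall_mem_cons, FactPattern.eval, List.map_cons,
    List.map_nil, Pattern.eval, Piece.eval, List.append_nil, List.cons_append, List.nil_append,
    Bool.false_eq_true, if_false, Fact.Holds] at hs hp ⊢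
  obtain ⟨⟨C, hC, hb, hf, hv⟩, ⟨B, hB⟩, -⟩ := hp
  refine ⟨.connLeft c C B, by simpa using hC, ?_, fun H => ?_, fun z hz => ?_⟩
  · rw [hb, ← Context.pol_true, ← Context.pol_true, Context.pol_connLeft]
  · simp [Formula.code_conn, hf, hB]
  · rw [Context.allVars_connLeft, Finset.mem_union, ← Formula.var_mem_code, ← hB] at hz
    rcases hz with hz | hz
    · rcases hv z hz with h | h <;> simp [h]
    · simp [hz]

theorem contextRight_sound : (contextRight L b c).Sound := by
  intro P σ hs hp
  simp only [contextRight, Side, List.forall_mem_cons, FactPattern.eval, List.map_cons,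
    List.map_nil, Pattern.eval, Piece.eval, List.append_nil, List.cons_append, List.nil_append,
    Bool.false_eq_true, if_false, Fact.Holds] at hs hp ⊢
  obtain ⟨⟨C, hC, hb, hf, hv⟩, ⟨B, hB⟩, -⟩ := hp
  refine ⟨.connRight c B C, by simpa using hC, ?_, fun H => ?_, fun z hz => ?_⟩
  · rw [hb, ← Context.pol_true, ← Context.pol_true, Context.pol_connRight]
  · simp [Formula.code_conn, hf, hB]
  · rw [Context.allVars_connRight, Finset.mem_union, ← Formula.var_mem_code, ← hB] at hz
    rcases hz with hz | hz
    · simp [hz]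
    · rcases hv z hz with h | h <;> simp [h]

theorem substNil_sound : (substNil L).Sound := by
  intro P σ hs hp
  simp only [substNil, Side, List.forall_mem_cons, FactPattern.eval, List.map_cons, List.map_nil,
    Pattern.eval, Piece.eval, List.append_nil, Bool.false_eq_true, if_false,
    Fact.Holds] at hs hp ⊢
  obtain ⟨z, hz⟩ := strKind_eq_one hs.2.1
  obtain ⟨⟨l, h₁, h₂⟩, -⟩ := hp
  obtain ⟨r, hr⟩ := exists_eq_singleton h₁ h₂
  exact ⟨z, r, [], hz, hr, rfl, rfl, rfl⟩

theorem substEq_sound : (substEq L).Sound := by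
  intro P σ hs hp
  simp only [substEq, Side, List.forall_mem_cons, FactPattern.eval, List.map_cons, List.map_nil,
    Pattern.eval, Piece.eval, List.append_nil, List.cons_append, List.nil_append,
    Bool.false_eq_true, if_false, Fact.Holds] at hs hp ⊢
  obtain ⟨⟨z, r, l, hz, hr, hu, h, h'⟩, -⟩ := hp
  exact ⟨z, r, .var z :: l, hz, hr, by simp [hu, unary_succ],
    by simp [hz, h, termsCode_cons, termCode_var],
    by simp [hr, h', termsCode_cons, termSubst_var_self]⟩

theorem substNe_sound : (substNe L).Sound := by
  intro P σ hs hp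
  simp only [substNe, Side, List.forall_mem_cons, FactPattern.eval, List.map_cons, List.map_nil,
    Pattern.eval, Piece.eval, List.append_nil, List.cons_append, List.nil_append,
    Bool.false_eq_true, if_false, Fact.Holds] at hs hp ⊢
  obtain ⟨⟨z, r, l, hz, hr, hu, h, h'⟩, -⟩ := hp
  obtain ⟨y, hy⟩ := strKind_eq_one hs.2.1
  have hyz : y ≠ z := by
    rintro rfl
    exact hs.1.1 (Token.var y) (by simp [hy]) (by simp [hz])
  exact ⟨z, r, .var y :: l, hz, hr, by simp [hu, unary_succ],
    by simp [hy, h, termsCode_cons, termCode_var],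
    by simp [hy, h', termsCode_cons, termSubst_var_ne r hyz, termCode_var]⟩

theorem substFunc_sound : (substFunc L).Sound := by
  intro P σ hs hp
  simp only [substFunc, Side, List.forall_mem_cons, FactPattern.eval, List.map_cons, List.map_nil,
    Pattern.eval, Piece.eval, List.append_nil, List.cons_append, List.nil_append,
    Bool.false_eq_true, if_false, Fact.Holds] at hs hp ⊢
  obtain ⟨⟨z, r, l, hz, hr, hu, h, h'⟩, ⟨z₂, r₂, l₂, hz₂, hr₂, hu₂, h₂, h₂'⟩, -⟩ := hp
  obtain ⟨k, f, hf⟩ := strKind_eq_two hs.2.1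
  rw [hf, strArity_func] at hu
  obtain ⟨ts, rfl⟩ := exists_eq_ofFn hu
  obtain rfl : z = z₂ := by simpa [hz] using hz₂
  obtain rfl := termCode_injective (hr.symm.trans hr₂)
  refine ⟨z, r, .func f ts :: l₂, hz, hr, by simp [hu₂, unary_succ],
    by simp [hf, h, h₂, termsCode_cons, termCode_func], ?_⟩
  simp [hf, h', h₂', termsCode_cons, termSubst_func, termCode_func, List.map_ofFn,
    Function.comp_def]

theorem substAtom_sound : (substAtom L).Sound := by
  intro P σ hs hp
  simp only [substAtom, Side, List.forall_mem_cons, FactPattern.eval, List.map_cons, List.map_nil,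
    Pattern.eval, Piece.eval, List.append_nil, Bool.false_eq_true, if_false,
    Fact.Holds] at hs hp ⊢
  obtain ⟨⟨z, r, l, hz, hr, hu, h, h'⟩, -⟩ := hp
  obtain ⟨k, R, hR⟩ := strKind_eq_three hs.2.1
  rw [hR, strArity_rel] at hu
  obtain ⟨ts, rfl⟩ := exists_eq_ofFn hu
  refine ⟨z, r, .atom R ts, hz, hr, by simp [hR, h, Formula.code_atom], ?_,
    by simp [Formula.boundVars]⟩
  simp [hR, h', Formula.subst, Formula.code_atom, List.map_ofFn, Function.comp_def]

theorem substNeg_sound : (substNeg L).Sound := by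
  intro P σ hs hp
  simp only [substNeg, Side, List.forall_mem_cons, FactPattern.eval, List.map_cons, List.map_nil,
    Pattern.eval, Piece.eval, List.append_nil, List.cons_append, List.nil_append,
    Bool.false_eq_true, if_false, Fact.Holds] at hs hp ⊢
  obtain ⟨⟨z, r, H, hz, hr, h, h', hb⟩, -⟩ := hp
  exact ⟨z, r, .neg H, hz, hr, by rw [h, Formula.code_neg],
    by rw [h', Formula.subst, Formula.code_neg], hb⟩

theorem substConn_sound : (substConn L b).Sound := by
  intro P σ hs hp
  simp only [substConn, Side, List.forall_mem_cons, FactPattern.eval, List.map_cons, List.map_nil,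
    Pattern.eval, Piece.eval, List.append_nil, List.cons_append, List.nil_append,
    Bool.false_eq_true, if_false, Fact.Holds] at hs hp ⊢
  obtain ⟨⟨z, r, H, hz, hr, h, h', hb⟩, ⟨z₂, r₂, H₂, hz₂, hr₂, h₂, h₂', hb₂⟩, -⟩ := hp
  obtain rfl : z = z₂ := by simpa [hz] using hz₂
  obtain rfl := termCode_injective (hr.symm.trans hr₂)
  refine ⟨z, r, .conn b H H₂, hz, hr, by rw [h, h₂, Formula.code_conn],
    by rw [h', h₂', Formula.subst_conn, Formula.code_conn], fun y hy => ?_⟩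
  simp [hb y hy, hb₂ y hy]

theorem substQuant_sound : (substQuant L b).Sound := by
  intro P σ hs hp
  simp only [substQuant, Side, List.forall_mem_cons, FactPattern.eval, List.map_cons,
    List.map_nil, Pattern.eval, Piece.eval, List.append_nil, List.cons_append, List.nil_append,
    Bool.false_eq_true, if_false, Fact.Holds] at hs hp ⊢
  obtain ⟨⟨z, r, H, hz, hr, h, h', hb⟩, -⟩ := hp
  obtain ⟨y, hy⟩ := strKind_eq_one hs.2.1
  have hyz : y ≠ z := by
    rintro rfl
    exact hs.1.1 (Token.var y) (by simp [hy]) (by simp [hz])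
  have hyr : y ∉ r.varFinset := fun hm =>
    hs.1.2.1 (Token.var y) (by simp [hy]) (by rw [hr]; exact var_mem_termCode.2 hm)
  refine ⟨z, r, .quant b y H, hz, hr, by simp [hy, h, Formula.code_quant],
    by simp [hy, h', hyz, Formula.code_quant], fun v hv => ?_⟩
  have hvy : v ≠ y := by
    rintro rfl
    exact hyr hv
  simp [hvy, hb v hv]

theorem valueAtom_sound : (valueAtom L b).Sound := by
  intro P σ hs hp
  simp only [valueAtom, Side, List.forall_mem_cons, FactPattern.eval, List.map_cons, List.map_nil,
    Pattern.eval, Piece.eval, List.append_nil, List.cons_append, List.nil_append,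
    Bool.false_eq_true, if_true, if_false, Fact.Holds] at hs hp ⊢
  obtain ⟨k, R, hR⟩ := strKind_eq_three hs.2.1
  obtain ⟨⟨l, h₁, h₂⟩, -⟩ := hp
  rw [hR, strArity_rel] at h₁
  obtain ⟨ts, rfl⟩ := exists_eq_ofFn h₁
  have hcode : P 0 ++ P 1 = (Formula.atom R ts).code := by simp [hR, h₂, Formula.code_atom]
  exact ⟨.atom R ts, b, hcode, trivial, rfl, fun w hw => hw _ _ (by simp [hcode])⟩

theorem valueWeaken_sound : (valueWeaken L b).Sound := by
  intro P σ hs hp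
  simp only [valueWeaken, Side, List.forall_mem_cons, FactPattern.eval, List.map_cons,
    List.map_nil, Pattern.eval, Piece.eval, List.append_nil, List.cons_append, List.nil_append,
    if_true, Fact.Holds] at hs hp ⊢
  obtain ⟨⟨H, c, h, hq, hb, hw⟩, -⟩ := hp
  exact ⟨H, c, h, hq, hb, fun w hσ => hw w fun b a ha => hσ b a (by simp [ha])⟩

theorem valueNeg_sound : (valueNeg L b).Sound := by
  intro P σ hs hp
  simp only [valueNeg, Side, List.forall_mem_cons, FactPattern.eval, List.map_cons, List.map_nil,
    Pattern.eval, Piece.eval, List.append_nil, List.cons_append, List.nil_append, if_true,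
    Fact.Holds] at hs hp ⊢
  obtain ⟨⟨H, c, h, hq, hb, hw⟩, -⟩ := hp
  obtain rfl := Token.bool_injective (List.singleton_inj.1 hb)
  exact ⟨.neg H, !b, by rw [h, Formula.code_neg], hq, rfl, fun w hσ => by
    simp [Formula.Truth, hw w hσ]⟩

theorem valueConn_sound : (valueConn L b c d).Sound := by
  intro P σ hs hp
  simp only [valueConn, Side, List.forall_mem_cons, FactPattern.eval, List.map_cons, List.map_nil,
    Pattern.eval, Piece.eval, List.append_nil, List.cons_append, List.nil_append, if_true,
    Fact.Holds] at hs hp ⊢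
  obtain ⟨⟨H, b', h, hq, hb, hw⟩, ⟨H', c', h', hq', hc, hw'⟩, -⟩ := hp
  obtain rfl := Token.bool_injective (List.singleton_inj.1 hb)
  obtain rfl := Token.bool_injective (List.singleton_inj.1 hc)
  refine ⟨.conn d H H', _, by rw [h, h', Formula.code_conn], by simp [hq, hq'], rfl,
    fun w hσ => ?_⟩
  rw [Formula.truth_conn, hw w hσ, hw' w hσ]
  cases d <;> simp

theorem tautologyValue_sound : (tautologyValue L).Sound := by
  intro P σ hs hp
  simp only [tautologyValue, Side, List.forall_mem_cons, FactPattern.eval, List.map_cons,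
    List.map_nil, Pattern.eval, Piece.eval, List.append_nil, List.nil_append, if_true, Fact.Holds]
    at hs hp ⊢
  obtain ⟨⟨H, c, h, hq, hb, hw⟩, -⟩ := hp
  obtain rfl := Token.bool_injective (List.singleton_inj.1 hb)
  exact ⟨H, h, hq, fun w hσ => (hw w hσ).2 rfl⟩

theorem tautologySplit_sound : (tautologySplit L).Sound := by
  intro P σ hs hp
  simp only [tautologySplit, Side, List.forall_mem_cons, FactPattern.eval, List.map_cons,
    List.map_nil, Pattern.eval, Piece.eval, List.append_nil, List.cons_append, List.nil_append,
    if_true, Fact.Holds] at hs hp ⊢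
  obtain ⟨⟨H, h, hq, hw⟩, ⟨H', h', -, hw'⟩, -⟩ := hp
  obtain rfl := Formula.code_injective (h.symm.trans h')
  refine ⟨H, h, hq, fun w hσ => ?_⟩
  -- The value of the chosen string under `w` decides which premise applies: `w` still agrees with
  -- the environment extended by this value.
  by_cases ha : w (P 1)
  · refine hw w fun b a hm => ?_
    rcases List.mem_cons.1 hm with hm | hm
    · obtain ⟨h₁, rfl⟩ := List.cons.inj hm
      simp [ha, Token.bool_injective h₁]
    · exact hσ b a hm
  · refine hw' w fun b a hm => ?_
    rcases List.mem_cons.1 hm with hm | hm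
    · obtain ⟨h₁, rfl⟩ := List.cons.inj hm
      simp [ha, Token.bool_injective h₁]
    · exact hσ b a hm

theorem derivationInit_sound : (derivationInit L).Sound := by
  intro P σ hs hp
  simp only [derivationInit, Side, List.forall_mem_cons, FactPattern.eval, List.map_cons,
    List.map_nil, Pattern.eval, Piece.eval, List.append_nil, Bool.false_eq_true, if_false,
    Fact.Holds] at hs hp ⊢
  obtain ⟨⟨H, h, hq, hw⟩, -⟩ := hp
  refine ⟨[H], by simp [h], .tautology ⟨hq, fun w => ?_⟩⟩
  -- It suffices to consider valuations of strings: by injectivity of codes, every valuation of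
  -- atomic formulas is induced by one of them.
  have hval : atomValue (fun a => ∃ (k : ℕ) (R : L.Relations k) (ts : Fin k → L.Term ℕ),
      (Formula.atom R ts).code = a ∧ w k R ts) = w := by
    funext k R ts
    refine propext ⟨?_, fun h => ⟨k, R, ts, rfl, h⟩⟩
    rintro ⟨k', R', ts', hc, h⟩
    cases Formula.code_injective hc
    exact h
  rw [← hval]
  exact hw _ (by simp [Agrees])

theorem derivationContract_sound : (derivationContract L b).Sound := by
  intro P σ hs hp
  simp only [derivationContract, Side, List.forall_mem_cons, FactPattern.eval, List.map_cons,
    List.map_nil, Pattern.eval, Piece.eval, List.append_nil, List.cons_append, List.nil_append,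
    Bool.false_eq_true, if_true, if_false, Fact.Holds] at hs hp ⊢
  obtain ⟨⟨D, hD, hR⟩, ⟨C, hC, hb, hf, -⟩, ⟨H, h⟩, -⟩ := hp
  obtain ⟨Q, D, rfl, hQ, rfl⟩ := List.map_eq_cons_iff.1 hD.symm
  have hb := (Token.bool_injective (List.singleton_inj.1 hb)).symm
  obtain rfl : Q = C.fill (.conn b H H) := Formula.code_injective (by
    rw [hQ, hf, Formula.code_conn, h]; simp)
  exact ⟨C.fill H :: C.fill (.conn b H H) :: D, by simp [hf, h, Formula.code_conn],
    hR.step (.contract hb H)⟩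

theorem derivationGamma_sound : (derivationGamma L b).Sound := by
  intro P σ hs hp
  simp only [derivationGamma, Side, List.forall_mem_cons, FactPattern.eval, List.map_cons,
    List.map_nil, Pattern.eval, Piece.eval, List.append_nil, List.cons_append, List.nil_append,
    Bool.false_eq_true, if_true, if_false, Fact.Holds] at hs hp ⊢
  obtain ⟨⟨D, hD, hR⟩, ⟨C, hC, hb, hf, -⟩, ⟨z, r, H, hz, hr, h, h', hz'⟩, -⟩ := hp
  obtain ⟨Q, D, rfl, hQ, rfl⟩ := List.map_eq_cons_iff.1 hD.symm
  have hb := (Token.bool_injective (List.singleton_inj.1 hb)).symm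
  obtain rfl : Q = C.fill (H.subst z r) := Formula.code_injective (by rw [hQ, hf, h'])
  exact ⟨C.fill (.quant b z H) :: C.fill (H.subst z r) :: D,
    by simp [hf, h, hz, h', Formula.code_quant], hR.step (.gamma hC hb hz')⟩

theorem derivationDelta_sound : (derivationDelta L b).Sound := by
  intro P σ hs hp
  simp only [derivationDelta, Side, List.forall_mem_cons, FactPattern.eval, List.map_cons,
    List.map_nil, Pattern.eval, Piece.eval, List.append_nil, List.cons_append, List.nil_append,
    Bool.false_eq_true, if_true, if_false, Fact.Holds] at hs hp ⊢
  obtain ⟨⟨D, hD, hR⟩, ⟨C, hC, hb, hf, hv⟩, ⟨z, r, H, hz, hr, h, h', hz'⟩, -⟩ := hp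
  obtain ⟨Q, D, rfl, hQ, rfl⟩ := List.map_eq_cons_iff.1 hD.symm
  have hb := (Token.bool_injective (List.singleton_inj.1 hb)).symm
  obtain rfl : Q = C.fill (H.subst z r) := Formula.code_injective (by rw [hQ, hf, h'])
  obtain ⟨y, hy⟩ := strKind_eq_one hs.2.1
  -- The kind of this parameter forces the substituted term to be a variable, the eigenvariable; the
  -- disjointness conditions make it fresh for the context and for `H`.
  obtain rfl : r = .var y := termCode_injective (by rw [← hr, hy, termCode_var])
  have hyP : Token.var y ∈ P 4 := by simp [hy]
  have hyC : y ∉ C.freeVars := fun hm =>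
    (hv y (C.freeVars_subset_allVars hm)).elim (hs.1.1 _ hyP) (hs.1.2.2.1 _ hyP)
  have hyH : y ∉ H.allVars := fun hm =>
    hs.1.2.1 _ hyP (by rw [h]; exact Formula.var_mem_code.2 hm)
  exact ⟨C.fill (.quant (!b) z H) :: C.fill (.quant (!b) y (H.subst z (.var y))) ::
      C.fill (H.subst z (.var y)) :: D,
    by simp [hf, h, hz, h', hy, Formula.code_quant],
    (hR.step (.delta hC hb hyC)).step (.unrename (fun hm => hyH (H.freeVars_subset_allVars hm))
      fun hm => hyH (H.boundVars_subset_allVars y hm))⟩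

theorem sound_of_mem_all {r : Rule L} (hr : r ∈ all L) : r.Sound := by
  obtain ⟨b, c, d, hr⟩ := (mem_all L).1 hr
  have key : ∀ r ∈ instances L b c d, r.Sound := by
    simp only [instances, List.forall_mem_cons]
    exact ⟨termsNil_sound, termsVar_sound, termsFunc_sound, formulaAtom_sound, formulaNeg_sound,
      formulaConn_sound b, formulaQuant_sound b, contextHole_sound, contextNeg_sound b,
      contextLeft_sound b c, contextRight_sound b c, substNil_sound, substEq_sound, substNe_sound,
      substFunc_sound, substAtom_sound, substNeg_sound, substConn_sound b, substQuant_sound b,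
      valueAtom_sound b, valueWeaken_sound b, valueNeg_sound b, valueConn_sound b c d,
      tautologyValue_sound, tautologySplit_sound, derivationInit_sound, derivationContract_sound b,
      derivationGamma_sound b, derivationDelta_sound b, by simp⟩
  exact key r hr

end Rule

theorem Derivable.holds {f : Fact L} (h : Derivable (Rule.all L) f) : f.Holds := by
  induction h with
  | mk hr p σ hside _ ih => exact Rule.sound_of_mem_all hr _ σ hside ih

end Herbrand

/-! ### Completeness of the rules on strings. -/

namespace Herbrand

open FirstOrder.Language (Term)
open Function Relation

variable {L : FirstOrder.Language.{u, v}}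

/-! ### Completeness of the rules -/

attribute [local simp] Rule.Side FactPattern.eval Pattern.eval Piece.eval params

theorem Derivable.of_mem {rules : List (Rule L)} {r : Rule L} (hr : r ∈ rules)
    (p σ : List (Str L)) {F : Fact L} (hF : F = r.concl.eval (params p) σ)
    (hside : r.Side (params p)) (hprems : ∀ f ∈ r.prems, Derivable rules (f.eval (params p) σ)) :
    Derivable rules F :=
  hF ▸ .mk hr p σ hside hprems

/-- Derivability by means of all rules. -/
abbrev Provable (F : Fact L) : Prop := Derivable (Rule.all L) F

theorem strKind_var (z : ℕ) : strKind ([Token.var z] : Str L) = 1 := rfl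

theorem strKind_func (f : Σ n, L.Functions n) : strKind [Token.func f] = 2 := rfl

theorem strKind_rel (R : Σ n, L.Relations n) : strKind [Token.rel R] = 3 := rfl

/-- The step for a single term is a hypothesis, so that the lemma is available within the induction
on terms, for the arguments of a compound term. -/
theorem provable_terms_of_forall {l : List (L.Term ℕ)} (h : ∀ t ∈ l, ∀ u s,
    Provable (0, [u, s], []) → Provable (0, [Token.var 0 :: u, termCode t ++ s], [])) :
    Provable (0, [unary l.length, termsCode l], []) := by
  induction l with
  | nil =>
    exact .of_mem (r := .termsNil L)
      ((Rule.mem_all L).2 ⟨true, true, true, by simp [Rule.instances]⟩)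
      [] [] rfl (by simp [Rule.termsNil]) (by simp [Rule.termsNil])
  | cons t l ih =>
    rw [List.length_cons, unary_succ, termsCode_cons]
    exact h t (by simp) _ _ (ih fun t' ht' => h t' (by simp [ht']))

theorem provable_terms_cons (t : L.Term ℕ) : ∀ u s, Provable (0, [u, s], []) →
    Provable (0, [Token.var 0 :: u, termCode t ++ s], []) := by
  induction t with
  | var z =>
    intro u s h
    exact .of_mem (r := .termsVar L)
      ((Rule.mem_all L).2 ⟨true, true, true, by simp [Rule.instances]⟩)
      [u, s, [Token.var z]] []
      (by simp [Rule.termsVar, termCode_var]) (by simp [Rule.termsVar, strKind_var])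
      (by simpa [Rule.termsVar] using h)
  | @func k f ts ih =>
    intro u s h
    have hts : Provable (0, [unary (List.ofFn ts).length, termsCode (List.ofFn ts)], []) :=
      provable_terms_of_forall (List.forall_mem_ofFn_iff.2 ih)
    rw [List.length_ofFn] at hts
    exact .of_mem (r := .termsFunc L)
      ((Rule.mem_all L).2 ⟨true, true, true, by simp [Rule.instances]⟩)
      [[Token.func ⟨k, f⟩], termsCode (List.ofFn ts), u, s] []
      (by simp [Rule.termsFunc, termCode_func]) (by simp [Rule.termsFunc, strKind_func])
      (by simpa [Rule.termsFunc, strArity_func] using ⟨hts, h⟩)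

theorem provable_terms (l : List (L.Term ℕ)) :
    Provable (0, [unary l.length, termsCode l], []) :=
  provable_terms_of_forall fun t _ => provable_terms_cons t

theorem provable_terms_ofFn {k : ℕ} (ts : Fin k → L.Term ℕ) :
    Provable (0, [unary k, termsCode (List.ofFn ts)], []) := by
  simpa using provable_terms (List.ofFn ts)

theorem provable_formula (H : Formula L) : Provable (1, [H.code], []) := by
  induction H using Formula.induct with
  | @atom k R ts =>
    exact .of_mem (r := .formulaAtom L)
      ((Rule.mem_all L).2 ⟨true, true, true, by simp [Rule.instances]⟩)
      [[Token.rel ⟨k, R⟩], termsCode (List.ofFn ts)] []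
      (by simp [Rule.formulaAtom, Formula.code_atom]) (by simp [Rule.formulaAtom, strKind_rel])
      (by simpa [Rule.formulaAtom, strArity_rel] using provable_terms_ofFn ts)
  | neg A ih =>
    exact .of_mem (r := .formulaNeg L)
      ((Rule.mem_all L).2 ⟨true, true, true, by simp [Rule.instances]⟩)
      [A.code] []
      (by simp [Rule.formulaNeg, Formula.code_neg]) (by simp [Rule.formulaNeg])
      (by simpa [Rule.formulaNeg] using ih)
  | conn b A B ihA ihB =>
    exact .of_mem (r := .formulaConn L b) ((Rule.mem_all L).2 ⟨b, b, b, by simp [Rule.instances]⟩)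
      [A.code, B.code] []
      (by simp [Rule.formulaConn, Formula.code_conn]) (by simp [Rule.formulaConn])
      (by simpa [Rule.formulaConn] using ⟨ihA, ihB⟩)
  | quant b x A ih =>
    exact .of_mem (r := .formulaQuant L b) ((Rule.mem_all L).2 ⟨b, b, b, by simp [Rule.instances]⟩)
      [A.code, [Token.var x]] []
      (by simp [Rule.formulaQuant, Formula.code_quant]) (by simp [Rule.formulaQuant, strKind_var])
      (by simpa [Rule.formulaQuant] using ih)

/-- `s` and `s'` are the parts of an accessible context before and after the hole. -/
structure Context.Parts (C : Context L) (s s' : Str L) : Prop where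
  code_fill : ∀ H, (C.fill H).code = s ++ (H.code ++ s')
  var_notMem : ∀ z ∉ C.allVars, Token.var z ∉ s ∧ Token.var z ∉ s'
  provable : Provable (2, [[Token.bool C.positive], s, s'], [])

theorem Context.Parts.connLeft {C : Context L} {s s' : Str L} (h : C.Parts s s') (b : Bool)
    (B : Formula L) : (C.connLeft b B).Parts (Token.conn b :: s) (s' ++ B.code) where
  code_fill H := by simp [Formula.code_conn, h.code_fill]
  var_notMem z hz := by
    rw [allVars_connLeft, Finset.mem_union, not_or] at hz
    simpa [h.var_notMem z hz.1, Formula.var_mem_code, hz.2] using by simp [Token.conn]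
  provable := by
    rw [← pol_true, pol_connLeft, pol_true]
    exact .of_mem (r := .contextLeft L C.positive b)
      ((Rule.mem_all L).2 ⟨C.positive, b, b, by simp [Rule.instances]⟩) [s, s', B.code] []
      (by simp [Rule.contextLeft]) (by simp [Rule.contextLeft])
      (by simpa [Rule.contextLeft] using ⟨h.provable, provable_formula B⟩)

theorem Context.Parts.connRight {C : Context L} {s s' : Str L} (h : C.Parts s s') (b : Bool)
    (B : Formula L) : (connRight b B C).Parts (Token.conn b :: (B.code ++ s)) s' where
  code_fill H := by simp [Formula.code_conn, h.code_fill]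
  var_notMem z hz := by
    rw [allVars_connRight, Finset.mem_union, not_or] at hz
    simpa [h.var_notMem z hz.2, Formula.var_mem_code, hz.1] using by simp [Token.conn]
  provable := by
    rw [← pol_true, pol_connRight, pol_true]
    exact .of_mem (r := .contextRight L C.positive b)
      ((Rule.mem_all L).2 ⟨C.positive, b, b, by simp [Rule.instances]⟩) [s, s', B.code] []
      (by simp [Rule.contextRight]) (by simp [Rule.contextRight])
      (by simpa [Rule.contextRight] using ⟨h.provable, provable_formula B⟩)

theorem Context.Accessible.exists_parts {C : Context L} (hC : C.Accessible) :
    ∃ s s', C.Parts s s' := by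
  induction C with
  | hole =>
    exact ⟨[], [], by simp [fill], by simp,
      .of_mem (r := .contextHole L)
      ((Rule.mem_all L).2 ⟨true, true, true, by simp [Rule.instances]⟩)
      [] []
      (by simp [Rule.contextHole, positive]) (by simp [Rule.contextHole])
      (by simp [Rule.contextHole])⟩
  | neg C ih =>
    obtain ⟨s, s', h⟩ := ih hC
    refine ⟨Token.neg :: s, s', fun H => ?_, fun z hz => ?_, ?_⟩
    · simp [fill, Formula.code_neg, h.code_fill]
    · simpa using h.var_notMem z hz
    · exact .of_mem (r := .contextNeg L C.positive)
        ((Rule.mem_all L).2 ⟨C.positive, true, true, by simp [Rule.instances]⟩) [s, s'] []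
        (by simp [Rule.contextNeg, positive]) (by simp [Rule.contextNeg])
        (by simpa [Rule.contextNeg] using h.provable)
  | orLeft C B ih =>
    obtain ⟨s, s', h⟩ := ih hC
    exact ⟨_, _, h.connLeft true B⟩
  | orRight B C ih =>
    obtain ⟨s, s', h⟩ := ih hC
    exact ⟨_, _, h.connRight true B⟩
  | andLeft C B ih =>
    obtain ⟨s, s', h⟩ := ih hC
    exact ⟨_, _, h.connLeft false B⟩
  | andRight B C ih =>
    obtain ⟨s, s', h⟩ := ih hC
    exact ⟨_, _, h.connRight false B⟩
  | ex | all => exact hC.elim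

section Subst

variable (z : ℕ) (r : L.Term ℕ)

/-- Again the step for a single term is a hypothesis, to be used both within the induction on terms
and for atomic formulas. -/
theorem provable_substTerms_of_forall {l : List (L.Term ℕ)} (h : ∀ t ∈ l, ∀ u s s',
    Provable (3, [u, [Token.var z], termCode r, s, s'], []) →
    Provable (3, [Token.var 0 :: u, [Token.var z], termCode r, termCode t ++ s,
      termCode (termSubst z r t) ++ s'], [])) :
    Provable (3, [unary l.length, [Token.var z], termCode r, termsCode l,
      termsCode (l.map (termSubst z r))], []) := by
  induction l with
  | nil =>
    exact .of_mem (r := .substNil L)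
      ((Rule.mem_all L).2 ⟨true, true, true, by simp [Rule.instances]⟩)
      [[Token.var z], termCode r] []
      (by simp [Rule.substNil, termsCode_nil, unary]) (by simp [Rule.substNil, strKind_var])
      (by simpa [Rule.substNil, unary, termsCode] using provable_terms [r])
  | cons t l ih =>
    rw [List.length_cons, unary_succ, termsCode_cons, List.map_cons, termsCode_cons]
    exact h t (by simp) _ _ _ (ih fun t' ht' => h t' (by simp [ht']))

theorem provable_substTerms_cons (t : L.Term ℕ) : ∀ u s s',
    Provable (3, [u, [Token.var z], termCode r, s, s'], []) →
    Provable (3, [Token.var 0 :: u, [Token.var z], termCode r, termCode t ++ s,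
      termCode (termSubst z r t) ++ s'], []) := by
  induction t with
  | var y =>
    intro u s s' h
    by_cases hy : y = z
    · subst hy
      rw [termSubst_var_self]
      exact .of_mem (r := .substEq L)
        ((Rule.mem_all L).2 ⟨true, true, true, by simp [Rule.instances]⟩)
        [u, [Token.var y], termCode r, s, s'] []
        (by simp [Rule.substEq, termCode_var]) (by simp [Rule.substEq])
        (by simpa [Rule.substEq] using h)
    · rw [termSubst_var_ne r hy]
      exact .of_mem (r := .substNe L)
        ((Rule.mem_all L).2 ⟨true, true, true, by simp [Rule.instances]⟩)
        [u, [Token.var z], termCode r, s, s', [Token.var y]] []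
        (by simp [Rule.substNe, termCode_var]) (by simp [Rule.substNe, strKind_var, hy])
        (by simpa [Rule.substNe] using h)
  | @func k f ts ih =>
    intro u s s' h
    have hts := provable_substTerms_of_forall z r (List.forall_mem_ofFn_iff.2 ih)
    rw [List.length_ofFn, List.map_ofFn] at hts
    exact .of_mem (r := .substFunc L)
      ((Rule.mem_all L).2 ⟨true, true, true, by simp [Rule.instances]⟩)
      [u, [Token.var z], termCode r, termsCode (List.ofFn ts),
      termsCode (List.ofFn (termSubst z r ∘ ts)), [Token.func ⟨k, f⟩], s, s'] []
      (by simp [Rule.substFunc, termCode_func, termSubst_func, Function.comp_def])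
      (by simp [Rule.substFunc, strKind_func])
      (by simpa [Rule.substFunc, strArity_func] using ⟨hts, h⟩)

theorem provable_substFormula (H : Formula L) (hz : z ∉ H.boundVars)
    (hr : ∀ y ∈ r.varFinset, y ∉ H.boundVars) :
    Provable (4, [[Token.var z], termCode r, H.code, (H.subst z r).code], []) := by
  induction H using Formula.induct with
  | @atom k R ts =>
    have hts := provable_substTerms_of_forall z r
      (l := List.ofFn ts) fun t _ => provable_substTerms_cons z r t
    rw [List.length_ofFn] at hts
    exact .of_mem (r := .substAtom L)
      ((Rule.mem_all L).2 ⟨true, true, true, by simp [Rule.instances]⟩)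
      [[Token.rel ⟨k, R⟩], [Token.var z], termCode r,
      termsCode (List.ofFn ts), termsCode ((List.ofFn ts).map (termSubst z r))] []
      (by simp [Rule.substAtom, Formula.code_atom, Formula.subst, List.map_ofFn,
        Function.comp_def])
      (by simp [Rule.substAtom, strKind_rel])
      (by simpa [Rule.substAtom, strArity_rel] using hts)
  | neg A ih =>
    exact .of_mem (r := .substNeg L)
      ((Rule.mem_all L).2 ⟨true, true, true, by simp [Rule.instances]⟩)
      [[Token.var z], termCode r, A.code, (A.subst z r).code] []
      (by simp [Rule.substNeg, Formula.code_neg, Formula.subst]) (by simp [Rule.substNeg])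
      (by simpa [Rule.substNeg] using ih hz hr)
  | conn b A B ihA ihB =>
    simp only [Formula.boundVars_conn, List.mem_append, not_or] at hz hr
    exact .of_mem (r := .substConn L b) ((Rule.mem_all L).2 ⟨b, b, b, by simp [Rule.instances]⟩)
      [[Token.var z], termCode r, A.code, (A.subst z r).code, B.code, (B.subst z r).code] []
      (by simp [Rule.substConn, Formula.code_conn]) (by simp [Rule.substConn])
      (by simpa [Rule.substConn] using
        ⟨ihA hz.1 fun y hy => (hr y hy).1, ihB hz.2 fun y hy => (hr y hy).2⟩)
  | quant b x A ih =>
    simp only [Formula.boundVars_quant, List.mem_cons, not_or] at hz hr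
    have hxr : Token.var x ∉ termCode r := fun hm => (hr x (var_mem_termCode.1 hm)).1 rfl
    exact .of_mem (r := .substQuant L b) ((Rule.mem_all L).2 ⟨b, b, b, by simp [Rule.instances]⟩)
      [[Token.var z], termCode r, A.code, (A.subst z r).code, [Token.var x]] []
      (by simp [Rule.substQuant, Formula.code_quant, Ne.symm hz.1])
      (by simpa [Rule.substQuant, strKind_var, Ne.symm hz.1] using hxr)
      (by simpa [Rule.substQuant] using ih hz.2 fun y hy => (hr y hy).2)

end Subst

namespace Formula

/-- The atomic subformulas as strings. -/
def atomCodes : Formula L → List (Str L)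
  | atom R ts => [(atom R ts).code]
  | neg A => A.atomCodes
  | or A B => A.atomCodes ++ B.atomCodes
  | and A B => A.atomCodes ++ B.atomCodes
  | ex _ _ => []
  | all _ _ => []

theorem atomCodes_conn (b : Bool) (A B : Formula L) :
    (conn b A B).atomCodes = A.atomCodes ++ B.atomCodes := by
  cases b <;> rfl

end Formula

open Classical in
theorem provable_value {w : Str L → Prop} {σ : List (Str L)} {H : Formula L}
    (hq : H.QuantifierFree)
    (hw : ∀ a ∈ H.atomCodes, (Token.bool (decide (w a)) :: a) ∈ σ) :
    Provable (5, [[Token.bool (decide (H.Truth (atomValue w)))], H.code], σ) := by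
  induction H using Formula.induct with
  | @atom k R ts =>
    have hmem := hw (Formula.atom R ts).code (by simp [Formula.atomCodes])
    have htruth : (Formula.atom R ts).Truth (atomValue w) = w (Formula.atom R ts).code := rfl
    rw [htruth]
    -- With the value fixed, there remains an induction on the environment: weakening passes over
    -- entries until the one for this atomic formula is at the front.
    generalize decide (w (Formula.atom R ts).code) = b at hmem
    clear hw htruth
    induction σ with
    | nil => simp at hmem
    | cons a σ ih =>
      by_cases ha : (Token.bool b :: (Formula.atom R ts).code) = a
      · subst ha
        exact .of_mem (r := .valueAtom L b)
          ((Rule.mem_all L).2 ⟨b, b, b, by simp [Rule.instances]⟩)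
          [[Token.rel ⟨k, R⟩], termsCode (List.ofFn ts)] σ
          (by simp [Rule.valueAtom, Formula.code_atom]) (by simp [Rule.valueAtom, strKind_rel])
          (by simpa [Rule.valueAtom, strArity_rel] using provable_terms_ofFn ts)
      · exact .of_mem (r := .valueWeaken L b)
          ((Rule.mem_all L).2 ⟨b, b, b, by simp [Rule.instances]⟩)
          [(Formula.atom R ts).code, a] σ (by simp [Rule.valueWeaken]) (by simp [Rule.valueWeaken])
          (by simpa [Rule.valueWeaken] using ih ((List.mem_cons.1 hmem).resolve_left ha))
  | neg A ih =>
    exact .of_mem (r := .valueNeg L (decide (A.Truth (atomValue w))))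
      ((Rule.mem_all L).2 ⟨decide (A.Truth (atomValue w)), true, true, by simp [Rule.instances]⟩)
      [A.code] σ
      (by by_cases hA : A.Truth (atomValue w) <;>
        simp [hA, Rule.valueNeg, Formula.code_neg, Formula.Truth])
      (by simp [Rule.valueNeg])
      (by simpa [Rule.valueNeg] using ih hq hw)
  | conn b A B ihA ihB =>
    rw [Formula.quantifierFree_conn] at hq
    rw [Formula.atomCodes_conn] at hw
    have hA := ihA hq.1 fun a ha => hw a (by simp [ha])
    have hB := ihB hq.2 fun a ha => hw a (by simp [ha])
    exact .of_mem
      (r := .valueConn L (decide (A.Truth (atomValue w))) (decide (B.Truth (atomValue w))) b)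
      ((Rule.mem_all L).2 ⟨decide (A.Truth (atomValue w)), decide (B.Truth (atomValue w)), b,
        by simp [Rule.instances]⟩) [A.code, B.code] σ
      (by cases b <;> simp [Rule.valueConn, Formula.code_conn, Formula.truth_conn])
      (by simp [Rule.valueConn]) (by simpa [Rule.valueConn] using ⟨hA, hB⟩)
  | quant b x A ih => simp at hq

/-- A semantic case distinction on the strings in `l`. When `l` is exhausted, the environment
contains a value for every atomic subformula, and evaluation finishes the proof. -/
theorem provable_tautology {H : Formula L} (hH : H.IsSententialTautology) (l : List (Str L)) :
    ∀ σ : List (Str L), (∀ a ∈ H.atomCodes, a ∈ l ∨ ∃ b, (Token.bool b :: a) ∈ σ) →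
    Provable (6, [H.code], σ) := by
  classical
  induction l with
  | nil =>
    intro σ h
    -- If an atomic formula is listed with both values, then `true` is taken. Any choice would do,
    -- as `H` is true under all valuations.
    have hv := provable_value (w := fun a => (Token.bool true :: a) ∈ σ) (σ := σ) hH.1
      fun a ha => by
        obtain ⟨b, hb⟩ := (h a ha).resolve_left (by simp)
        by_cases ht : (Token.bool true :: a) ∈ σ
        · simp [ht]
        · cases b
          · simpa [ht] using hb
          · exact absurd hb ht
    rw [decide_eq_true (hH.2 _)] at hv
    exact .of_mem (r := .tautologyValue L)
      ((Rule.mem_all L).2 ⟨true, true, true, by simp [Rule.instances]⟩)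
      [H.code] σ
      (by simp [Rule.tautologyValue]) (by simp [Rule.tautologyValue])
      (by simpa [Rule.tautologyValue] using hv)
  | cons a l ih =>
    intro σ h
    have key : ∀ b, Provable (6, [H.code], (Token.bool b :: a) :: σ) := fun b =>
      ih _ fun a' ha' => by
        rcases h a' ha' with hm | ⟨b', hb'⟩
        · rcases List.mem_cons.1 hm with rfl | hm
          · exact .inr ⟨b, by simp⟩
          · exact .inl hm
        · exact .inr ⟨b', by simp [hb']⟩
    exact .of_mem (r := .tautologySplit L)
      ((Rule.mem_all L).2 ⟨true, true, true, by simp [Rule.instances]⟩)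
      [H.code, a] σ
      (by simp [Rule.tautologySplit]) (by simp [Rule.tautologySplit])
      (by simpa [Rule.tautologySplit] using ⟨key true, key false⟩)

/-- An accessible context splits the string of a formula into parts before and after the hole, so
each step becomes a single instance of a rule for derivations; in the δ-case this rule adds two
formulas. -/
theorem AccessibleStep.provable {P Q : Formula L} (h : AccessibleStep P Q) {σ : List (Str L)}
    (hP : Provable (7, [], P.code :: σ)) : ∃ σ', Provable (7, [], Q.code :: σ') := by
  cases h with
  | contract C H hC =>
    obtain ⟨s, s', h⟩ := hC.exists_parts
    rw [h.code_fill, Formula.code_conn] at hP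
    simp only [List.cons_append, List.append_assoc] at hP
    rw [h.code_fill]
    exact ⟨_, .of_mem (r := .derivationContract L C.positive)
      ((Rule.mem_all L).2 ⟨C.positive, true, true, by simp [Rule.instances]⟩) [s, H.code, s'] σ
      (by simp [Rule.derivationContract]; rfl) (by simp [Rule.derivationContract])
      (by simpa [Rule.derivationContract] using ⟨hP, h.provable, provable_formula H⟩)⟩
  | gamma C x H t hC hx ht =>
    obtain ⟨s, s', h⟩ := hC.exists_parts
    rw [h.code_fill] at hP
    rw [h.code_fill, Formula.code_quant]
    exact ⟨_, .of_mem (r := .derivationGamma L C.positive)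
      ((Rule.mem_all L).2 ⟨C.positive, true, true, by simp [Rule.instances]⟩)
      [s, H.code, (H.subst x t).code, [Token.var x], termCode t, s'] σ
      (by simp [Rule.derivationGamma]; rfl) (by simp [Rule.derivationGamma])
      (by simpa [Rule.derivationGamma] using ⟨hP, h.provable, provable_substFormula x t H hx ht⟩)⟩
  | delta C y v H hC hy hvC hvH =>
    obtain ⟨s, s', h⟩ := hC.exists_parts
    rw [h.code_fill] at hP
    rw [h.code_fill, Formula.code_quant]
    have hsub := provable_substFormula y (.var v) H hy fun u hu hm => by
      rw [Term.varFinset, Finset.mem_singleton] at hu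
      exact hvH (H.boundVars_subset_allVars v (hu ▸ hm))
    have hv := h.var_notMem v hvC
    have hv' : Token.var v ∉ H.code := fun hm => hvH (Formula.var_mem_code.1 hm)
    exact ⟨_, .of_mem (r := .derivationDelta L C.positive)
      ((Rule.mem_all L).2 ⟨C.positive, true, true, by simp [Rule.instances]⟩)
      [s, H.code, (H.subst y (.var v)).code, [Token.var y], [Token.var v], s'] σ
      (by simp [Rule.derivationDelta]; rfl)
      (by simpa [Rule.derivationDelta, strKind_var] using ⟨hv.1, hv', hv.2⟩)
      (by simpa [Rule.derivationDelta, termCode_var] using ⟨hP, h.provable, hsub⟩)⟩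

theorem provable_derivation {B A : Formula L} (hB : B.IsSententialTautology)
    (h : ReflTransGen AccessibleStep B A) : ∃ σ, Provable (7, [], A.code :: σ) := by
  induction h with
  | refl =>
    exact ⟨[], .of_mem (r := .derivationInit L)
      ((Rule.mem_all L).2 ⟨true, true, true, by simp [Rule.instances]⟩)
      [B.code] []
      (by simp [Rule.derivationInit]) (by simp [Rule.derivationInit])
      (by simpa [Rule.derivationInit] using
        provable_tautology hB B.atomCodes [] fun a ha => .inl ha)⟩
  | tail _ hs ih =>
    obtain ⟨σ, hσ⟩ := ih
    exact hs.provable hσ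

end Herbrand

/-! ### Computability: certificates as lists of rule instances, the search for a derivation, and the
conclusion. -/

namespace Herbrand

open FirstOrder.Language (Term)
open Function Relation

variable {L : FirstOrder.Language.{u, v}}

/-! ### Computability of the rules -/

theorem primrec_list_foldr {α β : Type*} [Primcodable α] [Primcodable β] {g : α → β → β}
    (hg : Primrec₂ g) (b : β) : Primrec fun l : List α => l.foldr g b :=
  Primrec.list_foldr Primrec.id (Primrec.const b)
    (hg.comp (Primrec.fst.comp Primrec.snd) (Primrec.snd.comp Primrec.snd)).to₂

/-- Primitive recursion on the number of elements treated so far, with access to the list by index;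
the accumulator is the image of an initial segment. -/
theorem computable_list_map {α β : Type*} [Primcodable α] [Primcodable β] {f : α → β}
    (hf : Computable f) : Computable fun l : List α => l.map f := by
  have hstep : Computable₂ fun (l : List α) (q : ℕ × List β) =>
      ((l[q.1]?).map fun a => q.2 ++ [f a]).getD q.2 := by
    refine Computable.option_getD (Computable.option_map
      (Computable.list_getElem?.comp .fst (Computable.fst.comp .snd)) ?_)
      (Computable.snd.comp .snd)
    exact Computable.list_concat.comp (Computable.snd.comp (Computable.snd.comp .fst))
      (hf.comp .snd)
  refine (Computable.nat_rec (Computable.list_length (α := α)) (Computable.const []) hstep).of_eq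
    fun l => ?_
  have key : ∀ n, Nat.rec (motive := fun _ => List β) [] (fun n acc =>
      ((l[n]?).map fun a => acc ++ [f a]).getD acc) n = (l.take n).map f := by
    intro n
    induction n with
    | zero => rfl
    | succ n ih =>
      simp only [ih, List.take_add_one]
      cases l[n]? <;> simp
  simpa using key l.length

open Classical in
/-- The premises and the conclusion of an instance of a rule. -/
noncomputable def Rule.apply (r : Rule L) (q : List (Str L) × List (Str L)) :
    Option (List (Fact L) × Fact L) :=
  if r.Side (params q.1) then
    some (r.prems.map fun f => f.eval (params q.1) q.2, r.concl.eval (params q.1) q.2)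
  else none

/-- Instances of rules, given by the number of a rule, parameters, and an environment. -/
abbrev RuleInstance (L : FirstOrder.Language.{u, v}) := ℕ × List (Str L) × List (Str L)

/-- The premises and the conclusion of an instance of a rule from a list of rules. -/
noncomputable def RuleInstance.apply : List (Rule L) → RuleInstance L →
    Option (List (Fact L) × Fact L)
  | [], _ => none
  | r :: _, (0, q) => r.apply q
  | _ :: rules, (i + 1, q) => RuleInstance.apply rules (i, q)

theorem RuleInstance.exists_apply {rules : List (Rule L)} {r : Rule L} (hr : r ∈ rules) :
    ∃ i, ∀ q, RuleInstance.apply rules (i, q) = r.apply q := by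
  induction rules with
  | nil => simp at hr
  | cons r' rules ih =>
    rcases List.mem_cons.1 hr with rfl | hr
    · exact ⟨0, fun _ => rfl⟩
    · obtain ⟨i, hi⟩ := ih hr
      exact ⟨i + 1, hi⟩

theorem RuleInstance.apply_eq_some {rules : List (Rule L)} {i : RuleInstance L}
    {F : List (Fact L) × Fact L} (h : RuleInstance.apply rules i = some F) :
    (∀ f ∈ F.1, Derivable rules f) → Derivable rules F.2 := by
  suffices ∃ r ∈ rules, r.apply i.2 = some F by
    obtain ⟨r, hr, hF⟩ := this
    intro hp
    rw [Rule.apply] at hF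
    split_ifs at hF with hs
    obtain rfl := Option.some.inj hF
    exact .mk hr _ _ hs fun f hf => hp _ (List.mem_map.2 ⟨f, hf, rfl⟩)
  induction rules generalizing i with
  | nil => simp [apply] at h
  | cons r rules ih =>
    obtain ⟨_ | n, q⟩ := i
    · exact ⟨r, by simp, h⟩
    · obtain ⟨r', hr', hF⟩ := ih h
      exact ⟨r', by simp [hr'], hF⟩

open Classical in
/-- The addition of a conclusion to a list of facts that contains its premises. -/
noncomputable def addConclusion (i : Option (List (Fact L) × Fact L)) (l : List (Fact L)) :
    List (Fact L) :=
  i.elim l fun F => if ∀ f ∈ F.1, f ∈ l then F.2 :: l else l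

/-- The facts that are derived by a list of instances of rules, from the last to the first. -/
noncomputable def derivedFacts (rules : List (Rule L)) (c : List (RuleInstance L)) :
    List (Fact L) :=
  (c.map (RuleInstance.apply rules)).foldr addConclusion []

theorem addConclusion_mono {i : Option (List (Fact L) × Fact L)} {l l' : List (Fact L)}
    (h : l ⊆ l') : addConclusion i l ⊆ addConclusion i l' := by
  cases i with
  | none => exact h
  | some F =>
    simp only [addConclusion, Option.elim_some]
    split_ifs with h₁ h₂ h₂
    · exact List.cons_subset_cons _ h
    · exact absurd (fun f hf => h (h₁ f hf)) h₂
    · exact fun f hf => List.mem_cons_of_mem _ (h hf)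
    · exact h

theorem subset_addConclusion (i : Option (List (Fact L) × Fact L)) (l : List (Fact L)) :
    l ⊆ addConclusion i l := by
  cases i with
  | none => exact List.Subset.refl _
  | some F =>
    simp only [addConclusion, Option.elim_some]
    split_ifs
    · exact List.subset_cons_self _ _
    · exact List.Subset.refl _

theorem derivedFacts_subset_append_left (rules : List (Rule L)) (c c' : List (RuleInstance L)) :
    derivedFacts rules c ⊆ derivedFacts rules (c ++ c') := by
  induction c with
  | nil => exact List.nil_subset _
  | cons i c ih => exact addConclusion_mono ih

theorem derivedFacts_subset_append_right (rules : List (Rule L)) (c c' : List (RuleInstance L)) :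
    derivedFacts rules c' ⊆ derivedFacts rules (c ++ c') := by
  induction c with
  | nil => exact List.Subset.refl _
  | cons i c ih => exact List.Subset.trans ih (subset_addConclusion _ _)

theorem derivable_of_mem_derivedFacts {rules : List (Rule L)} {c : List (RuleInstance L)} :
    ∀ f ∈ derivedFacts rules c, Derivable rules f := by
  induction c with
  | nil => simp [derivedFacts]
  | cons i c ih =>
    intro f hf
    change f ∈ addConclusion (RuleInstance.apply rules i) (derivedFacts rules c) at hf
    cases hi : RuleInstance.apply rules i with
    | none =>
      rw [hi] at hf
      exact ih f hf
    | some F =>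
      rw [hi] at hf
      simp only [addConclusion, Option.elim_some] at hf
      split_ifs at hf with h
      · rcases List.mem_cons.1 hf with rfl | hf
        · exact RuleInstance.apply_eq_some hi fun f hf => ih f (h f hf)
        · exact ih f hf
      · exact ih f hf

/-- Certificates of the premises can be concatenated, since additional instances never remove facts.
The final instance then puts its conclusion in front, which is the place where the search looks. -/
theorem Derivable.exists_head?_derivedFacts {rules : List (Rule L)} {f : Fact L}
    (h : Derivable rules f) : ∃ c, (derivedFacts rules c).head? = some f := by
  induction h with
  | @mk r hr p σ hside _ ih =>
    have key : ∀ l : List (FactPattern L),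
        (∀ f ∈ l, ∃ c, (derivedFacts rules c).head? = some (f.eval (params p) σ)) →
        ∃ c, ∀ f ∈ l, f.eval (params p) σ ∈ derivedFacts rules c := by
      intro l hl
      induction l with
      | nil => exact ⟨[], by simp⟩
      | cons f l ihl =>
        obtain ⟨c, hc⟩ := hl f (by simp)
        obtain ⟨c', hc'⟩ := ihl fun f' hf' => hl f' (by simp [hf'])
        refine ⟨c ++ c', List.forall_mem_cons.2 ⟨?_, fun f' hf' => ?_⟩⟩
        · exact derivedFacts_subset_append_left rules c c' (List.mem_of_mem_head? hc)
        · exact derivedFacts_subset_append_right rules c c' (hc' f' hf')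
    obtain ⟨c, hc⟩ := key r.prems ih
    obtain ⟨i, hi⟩ := RuleInstance.exists_apply hr
    refine ⟨(i, p, σ) :: c, ?_⟩
    change (addConclusion (RuleInstance.apply rules (i, p, σ)) (derivedFacts rules c)).head? = _
    rw [hi, Rule.apply, if_pos hside]
    simp only [addConclusion, Option.elim_some]
    rw [if_pos (by simpa using hc), List.head?_cons]

open Classical in
/-- The derivation that is given by a fact, if its last formula is the given string. -/
noncomputable def derivationOf (a : Str L) (f : Fact L) : Option (List (Str L)) :=
  if f.1 = 7 ∧ f.2.1 = [] ∧ f.2.2.head? = some a then some f.2.2.reverse else none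

section Computable

variable [Primcodable (Σ n, L.Functions n)] [Primcodable (Σ n, L.Relations n)]

/-- The computability of the arities enters the proof here; everywhere else strings are handled
without regard to the nature of their symbols beyond their kinds. -/
theorem computable_strArity (hf : Computable fun f : Σ n, L.Functions n => f.1)
    (hr : Computable fun R : Σ n, L.Relations n => R.1) :
    Computable (strArity : Str L → ℕ) := by
  have h : Computable (tokenArity : Token L → ℕ) := by
    refine (Computable.sumCasesOn Computable.id
      (g := fun _ a => Sum.casesOn a (fun _ => 0) fun f => f.1)
      (h := fun _ a => Sum.casesOn a (fun R => R.1) fun _ => 0) ?_ ?_).of_eq ?_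
    · exact Computable.sumCasesOn Computable.snd (Computable.const 0) (hf.comp Computable.snd)
    · exact Computable.sumCasesOn Computable.snd (hr.comp Computable.snd) (Computable.const 0)
    · rintro ((_ | _) | (_ | _)) <;> rfl
  exact Computable.option_getD (Computable.option_map Primrec.list_head?.to_comp
    (h.comp Computable.snd)) (Computable.const 0)

theorem primrec_tokenKind : Primrec (tokenKind : Token L → ℕ) := by
  refine (Primrec.sumCasesOn Primrec.id
    (g := fun _ a => Sum.casesOn a (fun _ => 1) fun _ => 2)
    (h := fun _ a => Sum.casesOn a (fun _ => 3) fun _ => 4) ?_ ?_).of_eq ?_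
  · exact Primrec.sumCasesOn Primrec.snd (Primrec.const 1) (Primrec.const 2)
  · exact Primrec.sumCasesOn Primrec.snd (Primrec.const 3) (Primrec.const 4)
  · rintro ((_ | _) | (_ | _)) <;> rfl

theorem primrec_strKind : Primrec (strKind : Str L → ℕ) :=
  Primrec.ite (Primrec.eq.comp Primrec.list_length (Primrec.const 1))
    (Primrec.option_getD.comp (Primrec.option_map Primrec.list_head?
      (primrec_tokenKind.comp Primrec.snd)) (Primrec.const 0)) (Primrec.const 0)

theorem primrec_unary : Primrec (unary : ℕ → Str L) :=
  Primrec.list_map Primrec.list_range (Primrec.const _)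

theorem primrec_params (i : ℕ) : Primrec fun p : List (Str L) => params p i :=
  (Primrec.list_getD []).comp Primrec.id (Primrec.const i)

theorem Pattern.computable_eval (h : Computable (strArity : Str L → ℕ)) (e : Pattern L) :
    Computable fun p => e.eval (params p) := by
  induction e with
  | nil => exact Computable.const []
  | cons a e ih =>
    refine Computable.list_append.comp ?_ ih
    cases a with
    | par i => exact (primrec_params i).to_comp
    | tok a => exact Computable.const [a]
    | ar i => exact primrec_unary.to_comp.comp (h.comp (primrec_params i).to_comp)

theorem Pattern.computable_map_eval (h : Computable (strArity : Str L → ℕ))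
    (l : List (Pattern L)) : Computable fun p => l.map (Pattern.eval (params p)) := by
  induction l with
  | nil => exact Computable.const []
  | cons e l ih => exact Computable.list_cons.comp (e.computable_eval h) ih

theorem FactPattern.computable_eval (h : Computable (strArity : Str L → ℕ)) (f : FactPattern L) :
    Computable fun q : List (Str L) × List (Str L) => f.eval (params q.1) q.2 := by
  refine (Computable.const f.tag).pair (((Pattern.computable_map_eval h f.args).comp .fst).pair
    (Computable.list_append.comp ((Pattern.computable_map_eval h f.env).comp .fst) ?_))
  cases f.keep
  · exact Computable.const []
  · exact Computable.snd

theorem FactPattern.computable_map_eval (h : Computable (strArity : Str L → ℕ))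
    (l : List (FactPattern L)) : Computable fun q : List (Str L) × List (Str L) =>
      l.map fun f => f.eval (params q.1) q.2 := by
  induction l with
  | nil => exact Computable.const []
  | cons f l ih => exact Computable.list_cons.comp (f.computable_eval h) ih

theorem primrecPred_forall_mem {α β : Type*} [Primcodable α] {R : β → α → Prop} (l : List β)
    (h : ∀ b ∈ l, PrimrecPred (R b)) : PrimrecPred fun a => ∀ b ∈ l, R b a := by
  induction l with
  | nil => exact PrimrecPred.of_eq ⟨fun _ => .isTrue trivial, Primrec.const true⟩ (by simp)
  | cons b l ih =>
    exact ((h b (by simp)).and (ih fun b' hb' => h b' (by simp [hb']))).of_eq (by simp)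

theorem Rule.primrecPred_side (r : Rule L) : PrimrecPred fun p => r.Side (params p) := by
  classical
  refine PrimrecPred.and (primrecPred_forall_mem _ fun d _ => ?_)
    (primrecPred_forall_mem _ fun d _ => Primrec.eq.comp
      (primrec_strKind.comp (primrec_params d.1)) (Primrec.const d.2))
  have hmem : PrimrecRel fun (a : Token L) (s : Str L) => a ∉ s :=
    ((PrimrecRel.exists_mem_list Primrec.eq).comp Primrec.snd Primrec.fst).not.of_eq (by simp)
  exact (PrimrecRel.forall_mem_list hmem).comp (primrec_params d.1) (primrec_params d.2)

theorem Rule.computable_apply (h : Computable (strArity : Str L → ℕ)) (r : Rule L) :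
    Computable r.apply := by
  classical
  have hs : Primrec fun p => decide (r.Side (params p)) := by
    obtain ⟨_, hs⟩ := r.primrecPred_side
    exact hs.of_eq fun p => by congr
  refine (Computable.cond (hs.to_comp.comp .fst) (Computable.option_some.comp
    ((FactPattern.computable_map_eval h r.prems).pair (r.concl.computable_eval h)))
    (Computable.const none)).of_eq fun q => ?_
  by_cases hq : r.Side (params q.1) <;> simp [Rule.apply, hq]

theorem RuleInstance.computable_apply (h : Computable (strArity : Str L → ℕ))
    (rules : List (Rule L)) : Computable (RuleInstance.apply rules) := by
  induction rules with
  | nil => exact Computable.const none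
  | cons r rules ih =>
    refine (Computable.nat_casesOn (f := fun i : RuleInstance L => i.1) .fst
      ((r.computable_apply h).comp Computable.snd)
      (h := fun i n => RuleInstance.apply rules (n, i.2))
      (ih.comp (Computable.snd.pair (Computable.snd.comp .fst)))).of_eq ?_
    rintro ⟨_ | i, q⟩ <;> rfl

theorem primrec_addConclusion : Primrec₂ (addConclusion (L := L)) := by
  classical
  have hmem : PrimrecRel fun (f : Fact L) (l : List (Fact L)) => f ∈ l :=
    ((PrimrecRel.exists_mem_list Primrec.eq).comp Primrec.snd Primrec.fst).of_eq (by simp)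
  refine (Primrec.option_casesOn Primrec.fst Primrec.snd (Primrec.ite
    ((PrimrecRel.forall_mem_list hmem).comp (Primrec.fst.comp Primrec.snd)
      (Primrec.snd.comp Primrec.fst))
    (Primrec.list_cons.comp (Primrec.snd.comp Primrec.snd) (Primrec.snd.comp Primrec.fst))
    (Primrec.snd.comp Primrec.fst)).to₂).of_eq ?_
  rintro ⟨_ | F, l⟩
  · rfl
  · simp only [addConclusion, Option.elim_some]

theorem computable_derivedFacts (h : Computable (strArity : Str L → ℕ)) (rules : List (Rule L)) :
    Computable (derivedFacts rules) :=
  (primrec_list_foldr primrec_addConclusion []).to_comp.comp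
    (computable_list_map (RuleInstance.computable_apply h rules))

theorem primrec_derivationOf : Primrec₂ (derivationOf (L := L)) := by
  classical
  refine (Primrec.ite (PrimrecPred.and (Primrec.eq.comp (Primrec.fst.comp Primrec.snd)
    (Primrec.const 7)) (PrimrecPred.and (Primrec.eq.comp (Primrec.fst.comp (Primrec.snd.comp
      Primrec.snd)) (Primrec.const [])) (Primrec.eq.comp (Primrec.list_head?.comp
        (Primrec.snd.comp (Primrec.snd.comp Primrec.snd)))
          (Primrec.option_some.comp Primrec.fst))))
    (Primrec.option_some.comp (Primrec.list_reverse.comp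
      (Primrec.snd.comp (Primrec.snd.comp Primrec.snd)))) (Primrec.const none)).of_eq fun q => ?_
  simp only [derivationOf]
  congr

/-- The numbers are searched for a code of a list of rule instances whose last fact is a derivation
that ends with the given string. Completeness of the rules makes the search halt, and soundness
makes its result correct. -/
theorem exists_partrec_derivation (h : Computable (strArity : Str L → ℕ)) :
    ∃ φ : Str L →. List (Str L), Partrec φ ∧ ∀ (B A : Formula L), B.IsSententialTautology →
      ReflTransGen AccessibleStep B A →
      ∃ D : List (Formula L), IsProof D A ∧ D.map Formula.code ∈ φ A.code := by
  let search (a : Str L) (k : ℕ) : Option (List (Str L)) :=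
    (Encodable.decode (α := List (RuleInstance L)) k).bind fun c =>
      (derivedFacts (Rule.all L) c).head?.bind (derivationOf a)
  have hsearch : Computable₂ search := by
    refine Computable.option_bind (Computable.decode.comp .snd) ?_
    refine Computable.option_bind (Primrec.list_head?.to_comp.comp
      ((computable_derivedFacts h (Rule.all L)).comp .snd)) ?_
    exact primrec_derivationOf.to_comp.comp (Computable.fst.comp (Computable.fst.comp .fst)) .snd
  refine ⟨_, Partrec.rfindOpt hsearch, fun B A hB hA => ?_⟩
  have hdom : (Nat.rfindOpt (search A.code)).Dom := by
    obtain ⟨σ, hσ⟩ := provable_derivation hB hA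
    obtain ⟨c, hc⟩ := hσ.exists_head?_derivedFacts
    refine Nat.rfindOpt_dom.2 ⟨Encodable.encode c, (A.code :: σ).reverse, ?_⟩
    simp only [search, Encodable.encodek, Option.bind_some, hc, derivationOf]
    simp
  obtain ⟨E, hE⟩ := Part.dom_iff_mem.1 hdom
  obtain ⟨k, hk⟩ := Nat.rfindOpt_spec hE
  obtain ⟨c, -, hk⟩ := Option.bind_eq_some_iff.1 hk
  obtain ⟨⟨tag, args, σ⟩, hf, hk⟩ := Option.bind_eq_some_iff.1 hk
  rw [derivationOf] at hk
  split_ifs at hk with hcond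
  obtain ⟨rfl, rfl, hhead⟩ := hcond
  obtain rfl := Option.some.inj hk
  obtain ⟨D, rfl, hD⟩ := (derivable_of_mem_derivedFacts _ (List.mem_of_mem_head? hf)).holds
  have hA' : D.head? = some A := by
    simp only [List.head?_map, Option.map_eq_some_iff] at hhead
    obtain ⟨A', hA', hc⟩ := hhead
    rw [hA', Formula.code_injective hc]
  refine ⟨D.reverse, hD.isProof A hA', ?_⟩
  rw [List.map_reverse]
  exact hE

theorem primrec_length_flatten : Primrec fun D : List (Str L) => D.flatten.length + 2 :=
  Primrec.nat_add.comp (Primrec.list_length.comp Primrec.list_flatten) (Primrec.const 2)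

end Computable

/-- A tautology is valid up to level one, the steps add at most the total length, and the passage
from levels to orders adds one more. The resulting order depends only on the lengths of the
formulas, which makes it computable. -/
theorem IsProof.hasPropertyC {D : List (Formula L)} {A : Formula L} (h : IsProof D A)
    (hA : A.Rectified) : A.HasPropertyC ((D.map Formula.code).flatten.length + 2) := by
  obtain ⟨B, hB, hD⟩ := h
  refine ValidUpTo.hasPropertyC hA ?_
  rw [Nat.add_comm]
  exact (validUpTo_of_tautology hB 1).derivation hD

theorem AccessibleStep.exists_step {P Q : Formula L} (h : AccessibleStep P Q) {D : List (Formula L)}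
    (hD : ReverseProof (P :: D)) : ∃ D', ReverseProof (Q :: D') := by
  cases h with
  | contract C H hC => exact ⟨_, hD.step (.contract rfl H)⟩
  | gamma C x H t hC hx ht => exact ⟨_, hD.step (.gamma hC rfl ht)⟩
  | delta C y v H hC hy hvC hvH =>
    exact ⟨_, (hD.step (.delta hC rfl fun hm => hvC (C.freeVars_subset_allVars hm))).step
      (.unrename (fun hm => hvH (H.freeVars_subset_allVars hm))
        fun hm => hvH (H.boundVars_subset_allVars v hm))⟩

/-- This needs no coding of the symbols, so that the equivalence holds over every language,
effectively given or not. -/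
theorem exists_isProof {B A : Formula L} (hB : B.IsSententialTautology)
    (h : ReflTransGen AccessibleStep B A) : ∃ D : List (Formula L), IsProof D A := by
  suffices ∃ D, ReverseProof (A :: D) by
    obtain ⟨D, hD⟩ := this
    exact ⟨_, hD.isProof A rfl⟩
  induction h with
  | refl => exact ⟨[], .tautology hB⟩
  | tail _ hs ih =>
    obtain ⟨D, hD⟩ := ih
    exact hs.exists_step hD

end Herbrand

theorem mainTheorem1 (L : FirstOrder.Language.{u, v}) :
    (∀ A : Herbrand.Formula L, A.Rectified →
      ((∃ n : ℕ, 0 < n ∧ A.HasPropertyC n) ↔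
        ∃ D : List (Herbrand.Formula L), Herbrand.IsProof D A)) ∧
    (∀ [Primcodable (Σ n, L.Functions n)] [Primcodable (Σ n, L.Relations n)],
      Computable (fun f : Σ n, L.Functions n => f.1) →
      Computable (fun R : Σ n, L.Relations n => R.1) →
      (∃ φ : List (Herbrand.Token L) × ℕ →. List (List (Herbrand.Token L)), Partrec φ ∧
        ∀ (A : Herbrand.Formula L) (n : ℕ), A.Rectified → 0 < n → A.HasPropertyC n →
          ∃ D : List (Herbrand.Formula L), Herbrand.IsProof D A ∧
            D.map Herbrand.Formula.code ∈ φ (A.code, n)) ∧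
      (∃ ψ : List (List (Herbrand.Token L)) →. ℕ, Partrec ψ ∧
        ∀ (A : Herbrand.Formula L) (D : List (Herbrand.Formula L)), A.Rectified →
          Herbrand.IsProof D A →
          ∃ n : ℕ, 0 < n ∧ A.HasPropertyC n ∧
            n ∈ ψ (D.map Herbrand.Formula.code))) := by
  refine ⟨fun A hA => ⟨?_, ?_⟩, ?_⟩
  · rintro ⟨n, -, h⟩
    obtain ⟨B, hB, hBA⟩ := h.derives hA
    exact Herbrand.exists_isProof hB hBA
  · rintro ⟨D, hD⟩
    exact ⟨_, Nat.succ_pos _, hD.hasPropertyC hA⟩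
  · intro _ _ hf hr
    constructor
    · obtain ⟨φ, hφ, h⟩ := Herbrand.exists_partrec_derivation (Herbrand.computable_strArity hf hr)
      -- The order `n` only guarantees that a derivation exists; the search does not use it.
      refine ⟨fun q => φ q.1, hφ.comp Computable.fst, fun A n hA _ hn => ?_⟩
      obtain ⟨B, hB, hBA⟩ := hn.derives hA
      exact h B A hB hBA
    · exact ⟨_, Herbrand.primrec_length_flatten.to_comp.partrec, fun A D hA hD =>
        ⟨_, Nat.succ_pos _, hD.hasPropertyC hA, Part.mem_some _⟩⟩
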